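/- For $t\ge 0$ let $P_t$ be the path on $t$ vertices; a finite simple graph $G$ is $P_t$-free if it has no induced subgraph isomorphic to $P_t$. Below, an algorithm is a deterministic multi-stack Turing machine whose input is a graph on the vertex set $\{1,\dots,n\}$, given by $n$ and its adjacency matrix, and which outputs numbers in binary; it has to be correct on all $P_t$-free graphs, and its running time is its number of steps as a function of $n$. (1) Let $H$ be a finite simple graph that does not contain the cycle $C_4$ as a (not necessarily induced) subgraph. There is a constant $C$, depending only on $H$, such that for every $t$ there is an algorithm that computes the number of $H$-colourings of $G$ (graph homomorphisms $G\to H$) for every $P_t$-free graph $G$, in time at most $2^{C\sqrt{tn\log n}}$ if $G$ has $n\ge 2$ vertices. (2) There is an absolute constant $C$ such that for every $t$ there is an algorithm that computes the independent set polynomial $\sum_{S}x^{|S|}$ (the sum is over all independent sets $S$ of $G$; the polynomial is output as the list of its coefficients) for every $P_t$-free graph $G$, in time at most $2^{C\sqrt{tn\log n}}$ if $G$ has $n\ge 2$ vertices. (3) In particular, for every $t$ there is an algorithm that decides whether a $P_t$-free graph $G$ is $3$-colourable, and one that computes the number of proper $3$-colourings of a $P_t$-free graph $G$, in time at most $2^{C\sqrt{tn\log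 n}}$ for $n\ge 2$, where $C$ is an absolute constant; for each fixed $t$ the running time is subexponential, that is, $2^{o(n)}$. -/

import Mathlib

noncomputable section

namespace PathFreeColouring

open Polynomial

/-- `G` is `P_t`-free: the path on `t` vertices is not an induced subgraph of `G`. -/
def IsPathFree {V : Type*} (t : ℕ) (G : SimpleGraph V) : Prop :=
  ¬ (SimpleGraph.pathGraph t).IsIndContained G

open Classical in
/-- The independent set polynomial `∑ x ^ |S|`, over all independent sets `S` of `G`. -/
def indepSetPoly {V : Type*} [Fintype V] (G : SimpleGraph V) : ℕ[X] :=
  ∑ S : Finset V, if G.IsIndepSet (S : Set V) then X ^ S.card else 0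

open Classical in
/-- Input encoding of a graph on `Fin n`: the number `n` in unary, a terminating `false`, and then
the `n * n` bits of the adjacency matrix, row by row. -/
def encodeGraph {n : ℕ} (G : SimpleGraph (Fin n)) : List Bool :=
  List.replicate n true ++ false ::
    (List.finRange n).flatMap fun i => (List.finRange n).map fun j => decide (G.Adj i j)

/-- Output encoding of a polynomial: the coefficients of degrees `0, ..., natDegree p` in this
order, each of them in binary and followed by the separator `none`. -/
def encodePoly (p : ℕ[X]) : List (Option Bool) :=
  (List.range (p.natDegree + 1)).flatMap fun k =>
    (Computability.encodeNat (p.coeff k)).map some ++ [none]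

/-- The Turing machine `M`, started on input `x`, halts with output `y` after at most `s` steps. -/
def OutputsWithin {Γ₀ Γ₁ : Type} (M : Turing.TM2ComputableAux Γ₀ Γ₁)
    (x : List Γ₀) (y : List Γ₁) (s : ℕ) : Prop :=
  Nonempty (Turing.TM2OutputsInTime M.tm (x.map M.inputAlphabet.symm)
    (some (y.map M.outputAlphabet.symm)) s)

/-- Some (deterministic, multi-stack) Turing machine with finite alphabets computes `f G`, encoded
by `enc`, for every `P_t`-free graph `G`, within `T n` steps if `G` has `n` vertices. Nothing is
required of the machine on inputs outside the class. -/
def SolvableOnPathFree {β Γ : Type} (f : ∀ n : ℕ, SimpleGraph (Fin n) → β) (enc : β → List Γ)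
    (t : ℕ) (T : ℕ → ℕ) : Prop :=
  ∃ M : Turing.TM2ComputableAux Bool Γ, (∀ k, Finite (M.tm.Γ k)) ∧
    ∀ (n : ℕ) (G : SimpleGraph (Fin n)), IsPathFree t G →
      OutputsWithin M (encodeGraph G) (enc (f n G)) (T n)

/-- `T n ≤ 2 ^ (C * √(t * n * log n))`. Since `log 1 = 0`, this is asked for `n ≥ 2` only. -/
def SqrtExpBound (C : ℝ) (t : ℕ) (T : ℕ → ℕ) : Prop :=
  ∀ n : ℕ, 2 ≤ n → (T n : ℝ) ≤ (2 : ℝ) ^ (C * √((t : ℝ) * n * Real.log n))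

/-- `T n = 2 ^ o(n)`. -/
def Subexponential (T : ℕ → ℕ) : Prop :=
  (fun n : ℕ => Real.log (T n)) =o[Filter.atTop] fun n : ℕ => (n : ℝ)

end PathFreeColouring

end

/-!
Homomorphisms to a graph `H` are counted by branching. A subproblem gives every open (still
uncoloured) vertex a list of admissible colours; branching on a colour `a` of a vertex `v` means
adding the number of solutions with `v` coloured `a` (which restricts the lists of the neighbours of
`v`) and the number of solutions in which `a` is struck off the list of `v` (`val_branch`).

In the first phase the algorithm branches on `a` at `v` if this is the only colour of `v`, or if at
least `d` neighbours of `v` would lose a colour. The total length of the lists is at most `hn`, for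
`h` colours, so there are at most about `hn / d` assignments of the second kind on a branch of the
recursion tree, and only `n ^ O(hn / d)` branches (`Palette.small_of_budget`). When no such choice
is left, every list has at least two colours, and since `H` has no `C₄`, two distinct colours have
at most one common neighbour: every open neighbour of `v` loses a colour under one of two given
colours of `v`. Hence every open vertex has fewer than `2d` open neighbours.

In the second phase the open vertices are split into components, whose counts are multiplied
(`val_split`). In each component the algorithm colours a frontier. The first frontier is a single
vertex; a later one consists of the neighbours, in the component, of a single pivot, chosen in the
preceding frontier, which has just been coloured. The successive pivots form an induced path, so the
recursion has depth less than `t` in a `P_t`-free graph, and each frontier has at most `2d`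
vertices: the tree has at most `n * 2 ^ O(dt)` nodes (`Exploring.small`). With `d` about
`√(n log n / t)` both phases together have `2 ^ O(√(t n log n))` nodes (`sqrtExp_nodeBound`).

Some colours may be marked, and a vertex with a marked colour has weight `B`. For the graph on two
colours in which only the marked colour is not adjacent to itself, and for `B = 2 ^ (n + 1)`, the
weighted count is the value of the independent set polynomial at `B`, whose binary digits are those
of the coefficients, in blocks of length `n + 1`. Counting and deciding are read off from unweighted
counts in the same manner (`Palette.exists_solvable`).

For the model of computation, a small functional language on binary trees is compiled to programs
acting on four stacks besides those for input and output, and these to Mathlib's multi-stack Turing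
machines. `Poly c f` says that `f` is computed from the tree code `c` in polynomial time, by a
calculus of closure properties that does not mention machines; it yields that the recursion, run
with an explicit stack of tasks, takes polynomial time for each node (`exists_run`). The exponent
must not depend on `t`, so `t` is not built into the program: `exists_machine` writes it in unary
next to the input, and it affects the running time only as a part of the input size.
-/

noncomputable section

namespace PathFreeColouring

/-! ### Structured programs on stacks and their compilation to Turing machines -/

/-- The three symbols used on the internal stacks of the machines built below. They are also the
values of the finite register of these machines, which is `none` between any two instructions. -/
abbrev Symb := Fin 3

/-- Instructions of stack programs over the stacks `k : K` with alphabets `Γ k`. The functions `r`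
and `w` translate between the alphabets when a symbol is moved from one stack to another. -/
inductive StackOp {K : Type} (Γ : K → Type)
  | push (k : K) (a : Γ k)
  | pop (k : K)
  | mv (k k' : K) (r : Γ k → Symb) (w : Option Symb → Γ k')
  | mv₂ (k k' k'' : K) (r : Γ k → Symb) (w' : Option Symb → Γ k') (w'' : Option Symb → Γ k'')

/-- Stack programs: instructions, sequential composition, and branching and loops that are
controlled by a test on the top of a stack (`none` if the stack is empty). -/
inductive StackProg {K : Type} (Γ : K → Type)
  | op (o : StackOp Γ)
  | seq (p q : StackProg Γ)
  | ite (k : K) (t : Option (Γ k) → Bool) (p q : StackProg Γ)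
  | loop (k : K) (t : Option (Γ k) → Bool) (p : StackProg Γ)

section

variable {K : Type} [DecidableEq K] {Γ : K → Type}

open Function Turing

/-- The effect of an instruction on the stacks. -/
def StackOp.sem : StackOp Γ → (∀ k, List (Γ k)) → ∀ k, List (Γ k)
  | push k a, s => update s k (a :: s k)
  | pop k, s => update s k (s k).tail
  | mv k k' r w, s =>
    let s₁ := update s k (s k).tail
    update s₁ k' (w ((s k).head?.map r) :: s₁ k')
  | mv₂ k k' k'' r w' w'', s =>
    let s₁ := update s k (s k).tail
    let s₂ := update s₁ k' (w' ((s k).head?.map r) :: s₁ k')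
    update s₂ k'' (w'' ((s k).head?.map r) :: s₂ k'')

/-- `p.Run s s' m`: started with the stacks `s`, the program `p` terminates with the stacks `s'`
after `m` steps. -/
inductive StackProg.Run : StackProg Γ → (∀ k, List (Γ k)) → (∀ k, List (Γ k)) → ℕ → Prop
  | op (o s) : Run (.op o) s (o.sem s) 1
  | seq {p q s₁ s₂ s₃ m₁ m₂} :
    Run p s₁ s₂ m₁ → Run q s₂ s₃ m₂ → Run (.seq p q) s₁ s₃ (m₁ + m₂)
  | ite_true {k t p q s s' m} : t (s k).head? = true → Run p s s' m →
    Run (.ite k t p q) s s' (m + 1)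
  | ite_false {k t p q s s' m} : t (s k).head? = false → Run q s s' m →
    Run (.ite k t p q) s s' (m + 1)
  | loop_false {k t p s} : t (s k).head? = false → Run (.loop k t p) s s 1
  | loop_true {k t p s₁ s₂ s₃ m₁ m₂} : t (s₁ k).head? = true → Run p s₁ s₂ m₁ →
    Run (.loop k t p) s₂ s₃ m₂ → Run (.loop k t p) s₁ s₃ (m₁ + m₂ + 1)

/-- The machine labels needed for a program. -/
def StackProg.Label : StackProg Γ → Type
  | op _ => Unit
  | seq p q => p.Label ⊕ q.Label
  | ite _ _ p q => Option (p.Label ⊕ q.Label)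
  | loop _ _ p => Option p.Label

instance StackProg.finiteLabel : ∀ p : StackProg Γ, Finite p.Label
  | op _ => inferInstanceAs (Finite Unit)
  | seq p q =>
    have := p.finiteLabel
    have := q.finiteLabel
    inferInstanceAs (Finite (p.Label ⊕ q.Label))
  | ite _ _ p q =>
    have := p.finiteLabel
    have := q.finiteLabel
    inferInstanceAs (Finite (Option (p.Label ⊕ q.Label)))
  | loop _ _ p =>
    have := p.finiteLabel
    inferInstanceAs (Finite (Option p.Label))

/-- The label at which the execution of a program starts. -/
def StackProg.entry : ∀ p : StackProg Γ, p.Label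
  | op _ => ()
  | seq p _ => Sum.inl p.entry
  | ite _ _ _ _ => none
  | loop _ _ _ => none

/-- The machine statement that performs an instruction and continues at the label `ex`. -/
def StackOp.stmt {Λ : Type} (ex : Λ) : StackOp Γ → TM2.Stmt Γ Λ (Option Symb)
  | push k a => .push k (fun _ => a) (.goto fun _ => ex)
  | pop k => .pop k (fun v _ => v) (.goto fun _ => ex)
  | mv k k' r w => .pop k (fun _ o => o.map r) (.push k' w (.load (fun _ => none)
      (.goto fun _ => ex)))
  | mv₂ k k' k'' r w' w'' => .pop k (fun _ o => o.map r) (.push k' w' (.push k'' w''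
      (.load (fun _ => none) (.goto fun _ => ex))))

/-- The machine statement that tests the top of a stack and jumps accordingly. -/
def testStmt {Λ : Type} (k : K) (t : Option (Γ k) → Bool) (l₁ l₂ : Λ) :
    TM2.Stmt Γ Λ (Option Symb) :=
  .peek k (fun _ o => if t o then some 0 else none)
    (.branch Option.isSome (.load (fun _ => none) (.goto fun _ => l₁)) (.goto fun _ => l₂))

/-- The code of a program, for a machine in which its labels are embedded by `em`; the execution
continues at the label `ex` when the program terminates. -/
def StackProg.stmt {Λ : Type} : ∀ p : StackProg Γ, (p.Label → Λ) → Λ → p.Label →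
    TM2.Stmt Γ Λ (Option Symb)
  | op o, _, ex, _ => o.stmt ex
  | seq p q, em, _, .inl l => p.stmt (em ∘ .inl) (em (.inr q.entry)) l
  | seq _ q, em, ex, .inr l => q.stmt (em ∘ .inr) ex l
  | ite k t p q, em, _, none => testStmt k t (em (some (.inl p.entry))) (em (some (.inr q.entry)))
  | ite _ _ p _, em, ex, some (.inl l) => p.stmt (em ∘ some ∘ .inl) ex l
  | ite _ _ _ q, em, ex, some (.inr l) => q.stmt (em ∘ some ∘ .inr) ex l
  | loop k t p, em, ex, none => testStmt k t (em (some p.entry)) ex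
  | loop _ _ p, em, _, some l => p.stmt (em ∘ some) (em none) l

/-- The machine `M` gets from the configuration `c` to `c'` in exactly `m` steps. -/
def Steps {Λ : Type} (M : Λ → TM2.Stmt Γ Λ (Option Symb)) (c c' : TM2.Cfg Γ Λ (Option Symb))
    (m : ℕ) : Prop :=
  (flip bind (TM2.step M))^[m] (some c) = some c'

theorem Steps.trans {Λ : Type} {M : Λ → TM2.Stmt Γ Λ (Option Symb)}
    {c₁ c₂ c₃ : TM2.Cfg Γ Λ (Option Symb)} {m₁ m₂ : ℕ} (h₁ : Steps M c₁ c₂ m₁)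
    (h₂ : Steps M c₂ c₃ m₂) : Steps M c₁ c₃ (m₁ + m₂) := by
  unfold Steps at *
  rw [Nat.add_comm, iterate_add_apply, h₁, h₂]

theorem Steps.single {Λ : Type} {M : Λ → TM2.Stmt Γ Λ (Option Symb)} {l : Λ} {v : Option Symb}
    {s : ∀ k, List (Γ k)} {c : TM2.Cfg Γ Λ (Option Symb)} (h : TM2.stepAux (M l) v s = c) :
    Steps M ⟨some l, v, s⟩ c 1 := by
  subst h
  rfl

theorem stepAux_op {Λ : Type} (o : StackOp Γ) (ex : Λ) (s : ∀ k, List (Γ k)) :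
    TM2.stepAux (o.stmt ex) none s = ⟨some ex, none, o.sem s⟩ := by
  cases o <;> rfl

theorem Steps.of_test_true {Λ : Type} {M : Λ → TM2.Stmt Γ Λ (Option Symb)} {l l₁ l₂ : Λ} {k : K}
    {t : Option (Γ k) → Bool} {s : ∀ k, List (Γ k)} (h : M l = testStmt k t l₁ l₂)
    (ht : t (s k).head? = true) : Steps M ⟨some l, none, s⟩ ⟨some l₁, none, s⟩ 1 := by
  refine .single ?_
  rw [h, testStmt]
  simp [ht]

theorem Steps.of_test_false {Λ : Type} {M : Λ → TM2.Stmt Γ Λ (Option Symb)} {l l₁ l₂ : Λ} {k : K}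
    {t : Option (Γ k) → Bool} {s : ∀ k, List (Γ k)} (h : M l = testStmt k t l₁ l₂)
    (ht : t (s k).head? = false) : Steps M ⟨some l, none, s⟩ ⟨some l₂, none, s⟩ 1 := by
  refine .single ?_
  rw [h, testStmt]
  simp [ht]

/-- The compiled code of a program runs in lockstep with the program. -/
theorem StackProg.Run.steps {p : StackProg Γ} {s s' : ∀ k, List (Γ k)} {m : ℕ}
    (h : p.Run s s' m) {Λ : Type} (M : Λ → TM2.Stmt Γ Λ (Option Symb)) (em : p.Label → Λ) (ex : Λ)
    (hM : ∀ l, M (em l) = p.stmt em ex l) :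
    Steps M ⟨some (em p.entry), none, s⟩ ⟨some ex, none, s'⟩ m := by
  induction h generalizing ex with
  | op o s => exact .single (by rw [hM]; exact stepAux_op o ex s)
  | @seq p q _ _ _ _ _ _ _ ih₁ ih₂ =>
    exact (ih₁ (em ∘ .inl) (em (.inr q.entry)) fun l => hM (.inl l)).trans
      (ih₂ (em ∘ .inr) ex fun l => hM (.inr l))
  | @ite_true k t p q s s' m ht _ ih =>
    rw [Nat.add_comm]
    exact (Steps.of_test_true (hM none) ht).trans
      (ih (em ∘ some ∘ .inl) ex fun l => hM (some (.inl l)))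
  | @ite_false k t p q s s' m ht _ ih =>
    rw [Nat.add_comm]
    exact (Steps.of_test_false (hM none) ht).trans
      (ih (em ∘ some ∘ .inr) ex fun l => hM (some (.inr l)))
  | @loop_false k t p s ht => exact Steps.of_test_false (hM none) ht
  | @loop_true k t p s₁ s₂ s₃ m₁ m₂ ht _ _ ih₁ ih₂ =>
    rw [Nat.add_comm]
    exact (Steps.of_test_true (hM none) ht).trans
      ((ih₁ (em ∘ some) (em none) fun l => hM (some l)).trans (ih₂ em ex hM))

/-- The statements of the machine that runs a program once and halts; `none` is the label of the
final statement. -/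
def StackProg.machine (p : StackProg Γ) : Option p.Label → TM2.Stmt Γ (Option p.Label) (Option Symb)
  | some l => p.stmt some none l
  | none => .halt

theorem StackProg.Run.machine_steps {p : StackProg Γ} {s s' : ∀ k, List (Γ k)} {m : ℕ}
    (h : p.Run s s' m) :
    Steps p.machine ⟨some (some p.entry), none, s⟩ ⟨none, none, s'⟩ (m + 1) :=
  (h.steps p.machine some none fun _ => rfl).trans (.single rfl)

end

/-! ### A functional language on binary trees and its compilation to stack programs -/

/-- Binary trees, the data type on which all computations take place. -/
inductive Tree
  | nil
  | cons (a b : Tree)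

namespace Tree

/-- The number of nodes, leaves included. -/
def size : Tree → ℕ
  | nil => 1
  | cons a b => a.size + b.size + 1

/-- Polish notation, with `0` for a leaf and `1` for an inner node. -/
def code : Tree → List Symb
  | nil => [0]
  | cons a b => 1 :: (a.code ++ b.code)

/-- The left subtree, and `nil` for a leaf. -/
def fst : Tree → Tree
  | nil => nil
  | cons a _ => a

/-- The right subtree, and `nil` for a leaf. -/
def snd : Tree → Tree
  | nil => nil
  | cons _ b => b

@[simp] theorem fst_cons (a b : Tree) : (cons a b).fst = a := rfl
@[simp] theorem snd_cons (a b : Tree) : (cons a b).snd = b := rfl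
@[simp] theorem fst_nil : nil.fst = nil := rfl
@[simp] theorem snd_nil : nil.snd = nil := rfl

@[simp] theorem length_code (t : Tree) : t.code.length = t.size := by
  induction t with
  | nil => rfl
  | cons a b iha ihb => simp [code, size, iha, ihb]

theorem size_pos (t : Tree) : 1 ≤ t.size := by
  cases t <;> simp [size]

theorem ne_two_of_mem_code {t : Tree} {a : Symb} (h : a ∈ t.code) : a ≠ 2 := by
  induction t with
  | nil => simp_all [code]
  | cons x y ihx ihy =>
    simp only [code, List.mem_cons, List.mem_append] at h
    rcases h with rfl | h | h
    · decide
    · exact ihx h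
    · exact ihy h

end Tree

/-- Programs that compute with trees. In `ite c f g` and `loop c f` the condition is that the value
of `c` is not `nil`; `comp f g` is `f` followed by `g`. -/
inductive Fn
  | id
  | const (d : Tree)
  | fst
  | snd
  | pair (f g : Fn)
  | comp (f g : Fn)
  | ite (c f g : Fn)
  | loop (c f : Fn)

/-- `p.Eval x y m`: the program `p` computes `y` from `x` at cost `m`, which bounds the number of
steps of the compiled program. -/
inductive Fn.Eval : Fn → Tree → Tree → ℕ → Prop
  | id (x) : Eval .id x x 2
  | const (d x) : Eval (.const d) x d (2 * x.size + d.size + 3)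
  | fst (x) : Eval .fst x x.fst (8 * x.size + 8)
  | snd (x) : Eval .snd x x.snd (8 * x.size + 8)
  | pair {f g x y z m₁ m₂} : Eval f x y m₁ → Eval g x z m₂ →
    Eval (.pair f g) x (.cons y z) (m₁ + m₂ + (12 * x.size + 8 * y.size + 4 * z.size + 16))
  | comp {f g x y z m₁ m₂} : Eval f x y m₁ → Eval g y z m₂ → Eval (.comp f g) x z (m₁ + m₂)
  | ite_true {c f g x b y m₁ m₂} : Eval c x b m₁ → b ≠ .nil → Eval f x y m₂ →
    Eval (.ite c f g) x y (m₁ + m₂ + (8 * x.size + 2 * b.size + 12))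
  | ite_false {c f g x y m₁ m₂} : Eval c x .nil m₁ → Eval g x y m₂ →
    Eval (.ite c f g) x y (m₁ + m₂ + (8 * x.size + 14))
  | loop_false {c f x m} : Eval c x .nil m → Eval (.loop c f) x x (m + (8 * x.size + 14))
  | loop_true {c f x b y z m₁ m₂ m₃} : Eval c x b m₁ → b ≠ .nil → Eval f x y m₂ →
    Eval (.loop c f) y z m₃ →
    Eval (.loop c f) x z (m₁ + m₂ + m₃ + (8 * x.size + 2 * b.size + 12))

/-- The stacks of the machines: input, output, and four internal ones. -/
inductive Stk
  | inp
  | out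
  | int (j : Fin 4)
  deriving DecidableEq

instance : Finite Stk :=
  Finite.of_injective (β := Option (Option (Fin 4)))
    (fun | .inp => none | .out => some none | .int j => some (some j))
    (by rintro (_ | _ | i) (_ | _ | j) h <;> simp_all)

/-- The alphabets of the stacks of a machine with output alphabet `Γ`. -/
abbrev Alph (Γ : Type) : Stk → Type
  | .inp => Bool
  | .out => Γ
  | .int _ => Symb

section

variable {Γ : Type} {i : List Bool} {o : List Γ} {m a b c : List Symb}

open Function

/-- The contents of all stacks. The internal ones are the main stack, which holds codes of trees,
each followed by the symbol `2`, two auxiliary stacks, and a unary counter. -/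
def store (i : List Bool) (o : List Γ) (m a b c : List Symb) : ∀ k, List (Alph Γ k)
  | .inp => i
  | .out => o
  | .int 0 => m
  | .int 1 => a
  | .int 2 => b
  | .int 3 => c

@[simp] theorem store_inp : store i o m a b c .inp = i := rfl
@[simp] theorem store_out : store i o m a b c .out = o := rfl
@[simp] theorem store_zero : store i o m a b c (.int 0) = m := rfl
@[simp] theorem store_one : store i o m a b c (.int 1) = a := rfl
@[simp] theorem store_two : store i o m a b c (.int 2) = b := rfl
@[simp] theorem store_three : store i o m a b c (.int 3) = c := rfl

theorem store_ext {s s' : ∀ k, List (Alph Γ k)} (hi : s .inp = s' .inp) (ho : s .out = s' .out)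
    (h : ∀ j, s (.int j) = s' (.int j)) : s = s' := by
  funext k
  rcases k with _ | _ | j
  exacts [hi, ho, h j]

@[simp] theorem update_inp (l : List Bool) :
    update (store i o m a b c) .inp l = store l o m a b c :=
  store_ext (by simp) (by simp) fun j => by fin_cases j <;> simp
@[simp] theorem update_out (l : List Γ) :
    update (store i o m a b c) .out l = store i l m a b c :=
  store_ext (by simp) (by simp) fun j => by fin_cases j <;> simp
@[simp] theorem update_zero (l : List Symb) :
    update (store i o m a b c) (.int 0) l = store i o l a b c :=
  store_ext (by simp) (by simp) fun j => by fin_cases j <;> simp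
@[simp] theorem update_one (l : List Symb) :
    update (store i o m a b c) (.int 1) l = store i o m l b c :=
  store_ext (by simp) (by simp) fun j => by fin_cases j <;> simp
@[simp] theorem update_two (l : List Symb) :
    update (store i o m a b c) (.int 2) l = store i o m a l c :=
  store_ext (by simp) (by simp) fun j => by fin_cases j <;> simp
@[simp] theorem update_three (l : List Symb) :
    update (store i o m a b c) (.int 3) l = store i o m a b l :=
  store_ext (by simp) (by simp) fun j => by fin_cases j <;> simp

/-- The program terminates within `m` steps. -/
def StackProg.RunLe (p : StackProg (Alph Γ)) (s s' : ∀ k, List (Alph Γ k)) (m : ℕ) : Prop :=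
  ∃ m' ≤ m, p.Run s s' m'

theorem StackProg.RunLe.mono {p : StackProg (Alph Γ)} {s s' : ∀ k, List (Alph Γ k)} {m m' : ℕ}
    (h : p.RunLe s s' m) (hm : m ≤ m') : p.RunLe s s' m' :=
  let ⟨k, hk, hr⟩ := h
  ⟨k, hk.trans hm, hr⟩

theorem StackProg.RunLe.cast {p : StackProg (Alph Γ)} {s s₁ s₂ : ∀ k, List (Alph Γ k)} {m : ℕ}
    (h : p.RunLe s s₁ m) (hs : s₁ = s₂) : p.RunLe s s₂ m :=
  hs ▸ h

theorem StackProg.RunLe.seq {p q : StackProg (Alph Γ)} {s₁ s₂ s₃ : ∀ k, List (Alph Γ k)}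
    {m₁ m₂ : ℕ} (h₁ : p.RunLe s₁ s₂ m₁) (h₂ : q.RunLe s₂ s₃ m₂) :
    (StackProg.seq p q).RunLe s₁ s₃ (m₁ + m₂) :=
  let ⟨_, hk, hr⟩ := h₁
  let ⟨_, hk', hr'⟩ := h₂
  ⟨_, Nat.add_le_add hk hk', .seq hr hr'⟩

theorem StackProg.RunLe.op {o : StackOp (Alph Γ)} {s s' : ∀ k, List (Alph Γ k)}
    (h : o.sem s = s') : (StackProg.op o).RunLe s s' 1 :=
  ⟨1, le_rfl, h ▸ .op o s⟩

theorem StackProg.RunLe.ite_true {k : Stk} {t : Option (Alph Γ k) → Bool}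
    {p q : StackProg (Alph Γ)} {s s' : ∀ k, List (Alph Γ k)} {m : ℕ}
    (ht : t (s k).head? = true) (h : p.RunLe s s' m) :
    (StackProg.ite k t p q).RunLe s s' (m + 1) :=
  let ⟨_, hk, hr⟩ := h
  ⟨_, Nat.add_le_add_right hk 1, .ite_true ht hr⟩

theorem StackProg.RunLe.ite_false {k : Stk} {t : Option (Alph Γ k) → Bool}
    {p q : StackProg (Alph Γ)} {s s' : ∀ k, List (Alph Γ k)} {m : ℕ}
    (ht : t (s k).head? = false) (h : q.RunLe s s' m) :
    (StackProg.ite k t p q).RunLe s s' (m + 1) :=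
  let ⟨_, hk, hr⟩ := h
  ⟨_, Nat.add_le_add_right hk 1, .ite_false ht hr⟩

theorem StackProg.RunLe.loop_false {k : Stk} {t : Option (Alph Γ k) → Bool}
    {p : StackProg (Alph Γ)} {s : ∀ k, List (Alph Γ k)} (ht : t (s k).head? = false) :
    (StackProg.loop k t p).RunLe s s 1 :=
  ⟨1, le_rfl, .loop_false ht⟩

theorem StackProg.RunLe.loop_true {k : Stk} {t : Option (Alph Γ k) → Bool}
    {p : StackProg (Alph Γ)} {s₁ s₂ s₃ : ∀ k, List (Alph Γ k)} {m₁ m₂ : ℕ}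
    (ht : t (s₁ k).head? = true) (h₁ : p.RunLe s₁ s₂ m₁)
    (h₂ : (StackProg.loop k t p).RunLe s₂ s₃ m₂) :
    (StackProg.loop k t p).RunLe s₁ s₃ (m₁ + m₂ + 1) :=
  let ⟨_, hk, hr⟩ := h₁
  let ⟨_, hk', hr'⟩ := h₂
  ⟨_, Nat.add_le_add_right (Nat.add_le_add hk hk') 1, .loop_true ht hr hr'⟩

namespace StackProg

/-- Push a symbol to an internal stack. -/
def push (j : Fin 4) (x : Symb) : StackProg (Alph Γ) := .op (.push (.int j) x)

/-- Pop a symbol from an internal stack. -/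
def pop (j : Fin 4) : StackProg (Alph Γ) := .op (.pop (.int j))

/-- Move a symbol between internal stacks. -/
def move (j j' : Fin 4) : StackProg (Alph Γ) :=
  .op (.mv (.int j) (.int j') (fun x => x) (fun x => x.getD 0))

/-- Move a symbol from an internal stack to two other ones. -/
def move₂ (j j' j'' : Fin 4) : StackProg (Alph Γ) :=
  .op (.mv₂ (.int j) (.int j') (.int j'') (fun x => x) (fun x => x.getD 0) (fun x => x.getD 0))

/-- Do nothing (in two steps). -/
def skip : StackProg (Alph Γ) := .seq (push 0 0) (pop 0)

/-- The test that the top symbol of a stack exists and is not the separator. -/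
def inCode (x : Option Symb) : Bool := x.any (· != 2)

/-- The test that the top symbol of a stack is `x`. -/
def topIs (x : Symb) (y : Option Symb) : Bool := y == some x

/-- Branch on the top symbol of an internal stack. -/
def ifTop (j : Fin 4) (x : Symb) (p q : StackProg (Alph Γ)) : StackProg (Alph Γ) :=
  .ite (.int j) (topIs x) p q

/-- Move symbols between internal stacks, up to the separator or the end of the stack. -/
def moveCode (j j' : Fin 4) : StackProg (Alph Γ) := .loop (.int j) inCode (move j j')

/-- Move symbols from an internal stack to two other ones, up to the separator or the end of the
stack. -/
def moveCode₂ (j j' j'' : Fin 4) : StackProg (Alph Γ) := .loop (.int j) inCode (move₂ j j' j'')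

/-- Delete symbols from an internal stack, up to the separator or the end of the stack. -/
def dropCode (j : Fin 4) : StackProg (Alph Γ) := .loop (.int j) inCode (pop j)

/-- Push a list of symbols to the main stack. -/
def pushList : List Symb → StackProg (Alph Γ)
  | [] => skip
  | x :: l => .seq (pushList l) (push 0 x)

/-- Duplicate the top tree of the main stack. -/
def dup : StackProg (Alph Γ) :=
  .seq (moveCode 0 1) <| .seq (moveCode₂ 1 0 2) <| .seq (push 0 2) <| .seq (moveCode 2 1)
    (moveCode 1 0)

/-- Exchange the two top trees of the main stack. -/
def swap : StackProg (Alph Γ) :=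
  .seq (moveCode 0 1) <| .seq (pop 0) <| .seq (moveCode 0 2) <| .seq (moveCode 1 0) <|
    .seq (push 0 2) (moveCode 2 0)

/-- Combine the two top trees of the main stack to one. -/
def join : StackProg (Alph Γ) :=
  .seq (moveCode 0 1) <| .seq (pop 0) <| .seq (moveCode 1 0) (push 0 1)

/-- Delete the top tree of the main stack. -/
def drop : StackProg (Alph Γ) := .seq (dropCode 0) (pop 0)

/-- Move the code of a tree that starts at the top of the main stack to the first auxiliary stack.
The end of the code is found by counting the subtrees that are still missing. -/
def splitLoop : StackProg (Alph Γ) :=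
  .loop (.int 3) Option.isSome (.seq (ifTop 0 1 (push 3 0) (pop 3)) (move 0 1))

end StackProg

open StackProg

theorem runLe_push_zero (x : Symb) :
    (push 0 x).RunLe (store i o m a b c) (store i o (x :: m) a b c) 1 :=
  .op (by simp [StackOp.sem])

theorem runLe_push_three (x : Symb) :
    (push 3 x).RunLe (store i o m a b c) (store i o m a b (x :: c)) 1 :=
  .op (by simp [StackOp.sem])

theorem runLe_pop_zero (x : Symb) :
    (pop 0).RunLe (store i o (x :: m) a b c) (store i o m a b c) 1 :=
  .op (by simp [StackOp.sem])

theorem runLe_pop_three (x : Symb) :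
    (pop 3).RunLe (store i o m a b (x :: c)) (store i o m a b c) 1 :=
  .op (by simp [StackOp.sem])

theorem runLe_move_zero_one (x : Symb) :
    (move 0 1).RunLe (store i o (x :: m) a b c) (store i o m (x :: a) b c) 1 :=
  .op (by simp [StackOp.sem])

theorem runLe_skip : skip.RunLe (store i o m a b c) (store i o m a b c) 2 :=
  (runLe_push_zero 0).seq (runLe_pop_zero 0)

theorem inCode_two (l : List Symb) : inCode (2 :: l).head? = false := rfl

theorem inCode_nil : inCode ([] : List Symb).head? = false := rfl

theorem inCode_cons {x : Symb} (hx : x ≠ 2) (l : List Symb) : inCode (x :: l).head? = true := by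
  simp [inCode, hx]

theorem runLe_moveCode {j j' : Fin 4} (hj : j ≠ j') (w r : List Symb) (hw : ∀ x ∈ w, x ≠ 2)
    (hr : inCode r.head? = false) (s : ∀ k, List (Alph Γ k)) (hs : s (.int j) = w ++ r) :
    (moveCode j j').RunLe s
      (update (update s (.int j) r) (.int j') (w.reverse ++ s (.int j'))) (2 * w.length + 1) := by
  induction w generalizing s with
  | nil =>
    have : update (update s (.int j) r) (.int j') ([].reverse ++ s (.int j')) = s := by
      simp only [List.nil_append] at hs
      rw [← hs]
      simp
    rw [this]
    exact .loop_false (by rw [hs]; exact hr)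
  | cons x w ih =>
    have hne : (Stk.int j') ≠ .int j := by simpa using hj.symm
    have hop :
        (StackOp.mv (Γ := Alph Γ) (.int j) (.int j') (fun x => x) (fun x => x.getD 0)).sem s =
        update (update s (.int j) (w ++ r)) (.int j') (x :: s (.int j')) := by
      simp only [StackOp.sem, hs, update_of_ne hne]
      rfl
    have := ih (fun y hy => hw y (by simp [hy]))
      (update (update s (.int j) (w ++ r)) (.int j') (x :: s (.int j')))
      (by rw [update_of_ne hne.symm, update_self])
    refine (StackProg.RunLe.loop_true ?_ (.op hop) (this.cast ?_)).mono (by simp; omega)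
    · rw [hs]
      exact inCode_cons (hw x (by simp)) _
    · rw [update_self, update_comm hne, update_idem, update_idem]
      simp only [List.reverse_cons, List.append_assoc, List.singleton_append]

theorem runLe_moveCode₂ (w r : List Symb) (hw : ∀ x ∈ w, x ≠ 2) (hr : inCode r.head? = false) :
    (moveCode₂ 1 0 2).RunLe (store i o m (w ++ r) b c)
      (store i o (w.reverse ++ m) r (w.reverse ++ b) c) (2 * w.length + 1) := by
  induction w generalizing m b with
  | nil => exact .loop_false hr
  | cons x w ih =>
    refine (StackProg.RunLe.loop_true (s₂ := store i o (x :: m) (w ++ r) (x :: b) c)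
      (m₁ := 1) (m₂ := 2 * w.length + 1) ?_ (.op (by simp [StackOp.sem])) ?_).mono
      (by simp; omega)
    · exact inCode_cons (hw x (by simp)) _
    · rw [List.reverse_cons, List.append_assoc, List.append_assoc]
      exact ih (fun y hy => hw y (by simp [hy]))

theorem runLe_dropCode (j : Fin 4) (w r : List Symb) (hw : ∀ x ∈ w, x ≠ 2)
    (hr : inCode r.head? = false) (s : ∀ k, List (Alph Γ k)) (hs : s (.int j) = w ++ r) :
    (dropCode j).RunLe s (update s (.int j) r) (2 * w.length + 1) := by
  induction w generalizing s with
  | nil =>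
    have : update s (.int j) r = s := by
      simp only [List.nil_append] at hs
      rw [← hs]
      simp
    rw [this]
    exact .loop_false (by rw [hs]; exact hr)
  | cons x w ih =>
    have hop : (StackOp.pop (Γ := Alph Γ) (.int j)).sem s = update s (.int j) (w ++ r) := by
      simp only [StackOp.sem, hs]
      rfl
    have := ih (fun y hy => hw y (by simp [hy])) (update s (.int j) (w ++ r)) (by rw [update_self])
    refine (StackProg.RunLe.loop_true ?_ (.op hop) (this.cast ?_)).mono (by simp; omega)
    · rw [hs]
      exact inCode_cons (hw x (by simp)) _
    · rw [update_idem]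

theorem runLe_pushList (l : List Symb) :
    (pushList l).RunLe (store i o m a b c) (store i o (l ++ m) a b c) (l.length + 2) := by
  induction l with
  | nil => exact runLe_skip
  | cons x l ih => exact (ih.seq (runLe_push_zero x)).mono (by simp)

variable (x y : Tree)

theorem runLe_dup :
    dup.RunLe (store i o (x.code ++ 2 :: m) [] [] c)
      (store i o (x.code ++ 2 :: (x.code ++ 2 :: m)) [] [] c) (8 * x.size + 5) := by
  have hx : ∀ s ∈ x.code, s ≠ 2 := fun s => x.ne_two_of_mem_code
  have hx' : ∀ s ∈ x.code.reverse, s ≠ 2 := fun s hs => hx s (List.mem_reverse.1 hs)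
  have h₁ := runLe_moveCode (j := 0) (j' := 1) (by decide) x.code (2 :: m) hx (inCode_two _)
    (store i o (x.code ++ 2 :: m) [] [] c) rfl
  have h₂ := runLe_moveCode₂ (i := i) (o := o) (m := 2 :: m) (b := []) (c := c)
    x.code.reverse [] hx' inCode_nil
  have h₃ := runLe_moveCode (j := 2) (j' := 1) (by decide) x.code [] hx inCode_nil
    (store i o (2 :: (x.code ++ 2 :: m)) [] x.code c) (by simp)
  have h₄ := runLe_moveCode (j := 1) (j' := 0) (by decide) x.code.reverse [] hx' inCode_nil
    (store i o (2 :: (x.code ++ 2 :: m)) x.code.reverse [] c) (by simp)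
  simp only [store_zero, store_one, update_zero, update_one, update_two,
    List.append_nil, List.reverse_reverse, List.length_reverse, Tree.length_code] at h₁ h₂ h₃ h₄
  exact (h₁.seq (h₂.seq ((runLe_push_zero 2).seq (h₃.seq h₄)))).mono (by omega)

theorem runLe_swap :
    swap.RunLe (store i o (x.code ++ 2 :: (y.code ++ 2 :: m)) [] [] c)
      (store i o (y.code ++ 2 :: (x.code ++ 2 :: m)) [] [] c) (4 * x.size + 4 * y.size + 6) := by
  have hx : ∀ s ∈ x.code, s ≠ 2 := fun s => x.ne_two_of_mem_code
  have hx' : ∀ s ∈ x.code.reverse, s ≠ 2 := fun s hs => hx s (List.mem_reverse.1 hs)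
  have hy : ∀ s ∈ y.code, s ≠ 2 := fun s => y.ne_two_of_mem_code
  have hy' : ∀ s ∈ y.code.reverse, s ≠ 2 := fun s hs => hy s (List.mem_reverse.1 hs)
  have h₁ := runLe_moveCode (j := 0) (j' := 1) (by decide) x.code (2 :: (y.code ++ 2 :: m)) hx
    (inCode_two _) (store i o (x.code ++ 2 :: (y.code ++ 2 :: m)) [] [] c) rfl
  have h₂ := runLe_moveCode (j := 0) (j' := 2) (by decide) y.code (2 :: m) hy
    (inCode_two _) (store i o (y.code ++ 2 :: m) x.code.reverse [] c) rfl
  have h₃ := runLe_moveCode (j := 1) (j' := 0) (by decide) x.code.reverse [] hx' inCode_nil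
    (store i o (2 :: m) x.code.reverse y.code.reverse c) (by simp)
  have h₄ := runLe_moveCode (j := 2) (j' := 0) (by decide) y.code.reverse [] hy' inCode_nil
    (store i o (2 :: (x.code ++ 2 :: m)) [] y.code.reverse c) (by simp)
  simp only [store_zero, store_one, store_two, update_zero, update_one, update_two,
    List.append_nil, List.reverse_reverse, List.length_reverse, Tree.length_code] at h₁ h₂ h₃ h₄
  exact (h₁.seq ((runLe_pop_zero 2).seq (h₂.seq (h₃.seq ((runLe_push_zero 2).seq h₄))))).mono
    (by omega)

theorem runLe_join :
    join.RunLe (store i o (x.code ++ 2 :: (y.code ++ 2 :: m)) [] b c)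
      (store i o ((Tree.cons x y).code ++ 2 :: m) [] b c) (4 * x.size + 4) := by
  have hx : ∀ s ∈ x.code, s ≠ 2 := fun s => x.ne_two_of_mem_code
  have hx' : ∀ s ∈ x.code.reverse, s ≠ 2 := fun s hs => hx s (List.mem_reverse.1 hs)
  have h₁ := runLe_moveCode (j := 0) (j' := 1) (by decide) x.code (2 :: (y.code ++ 2 :: m)) hx
    (inCode_two _) (store i o (x.code ++ 2 :: (y.code ++ 2 :: m)) [] b c) rfl
  have h₂ := runLe_moveCode (j := 1) (j' := 0) (by decide) x.code.reverse [] hx' inCode_nil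
    (store i o (y.code ++ 2 :: m) x.code.reverse b c) (by simp)
  simp only [store_zero, store_one, update_zero, update_one,
    List.append_nil, List.reverse_reverse, List.length_reverse, Tree.length_code] at h₁ h₂
  refine ((h₁.seq ((runLe_pop_zero 2).seq (h₂.seq (runLe_push_zero 1)))).mono (by omega)).cast ?_
  simp [Tree.code]

theorem runLe_drop :
    drop.RunLe (store i o (x.code ++ 2 :: m) a b c) (store i o m a b c) (2 * x.size + 2) := by
  have h := runLe_dropCode 0 x.code (2 :: m) (fun s => x.ne_two_of_mem_code) (inCode_two _)
    (store i o (x.code ++ 2 :: m) a b c) rfl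
  simp only [update_zero, Tree.length_code] at h
  exact (h.seq (runLe_pop_zero 2)).mono (by omega)

/-- One counter symbol stands for one tree that the loop still has to move. -/
theorem runLe_splitLoop {s' : ∀ k, List (Alph Γ k)} {n : ℕ}
    (h : splitLoop.RunLe (store i o m (x.code.reverse ++ a) b c) s' n) :
    splitLoop.RunLe (store i o (x.code ++ m) a b (0 :: c)) s' (n + 4 * x.size) := by
  induction x generalizing m a c n with
  | nil =>
    refine (StackProg.RunLe.loop_true (m₁ := 3) rfl
      (StackProg.RunLe.seq (m₁ := 2) (m₂ := 1) (.ite_false rfl (runLe_pop_three 0))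
        (runLe_move_zero_one 0)) h).mono (by simp [Tree.size]; omega)
  | cons x y ihx ihy =>
    have h₂ := ihx (m := y.code ++ m) (a := 1 :: a) (c := 0 :: c) (ihy (n := n) (by
      simpa [Tree.code] using h))
    refine (StackProg.RunLe.loop_true (m₁ := 3) rfl
      (StackProg.RunLe.seq (m₁ := 2) (m₂ := 1) (.ite_true rfl (runLe_push_three 0))
        (runLe_move_zero_one 1)) ?_).mono (m := 3 + (n + 4 * y.size + 4 * x.size) + 1)
        (by simp [Tree.size]; omega)
    rw [List.append_eq, List.append_assoc]
    exact h₂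

theorem runLe_split :
    (StackProg.seq (push 3 0) splitLoop).RunLe (store i o (x.code ++ m) [] b [])
      (store i o m x.code.reverse b []) (4 * x.size + 2) :=
  ((runLe_push_three 0).seq (runLe_splitLoop x (n := 1)
    (by rw [List.append_nil]; exact .loop_false rfl))).mono (by omega)

/-- The stack program of a tree program: it replaces the top tree of the main stack by the result
and leaves the rest of this stack and the other stacks unchanged. -/
def Fn.prog : Fn → StackProg (Alph Γ)
  | id => skip
  | const d => .seq (dropCode 0) (pushList d.code)
  | fst => ifTop 0 0 skip (.seq (pop 0) <| .seq (.seq (push 3 0) splitLoop) <|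
      .seq (dropCode 0) (moveCode 1 0))
  | snd => ifTop 0 0 skip (.seq (pop 0) <| .seq (.seq (push 3 0) splitLoop) (dropCode 1))
  | pair f g => .seq dup <| .seq g.prog <| .seq swap <| .seq f.prog join
  | comp f g => .seq f.prog g.prog
  | ite c f g => .seq dup <| .seq c.prog <| ifTop 0 0 (.seq drop g.prog) (.seq drop f.prog)
  | loop c f => .seq dup <| .seq c.prog <|
      .seq (.loop (.int 0) (topIs 1) (.seq drop <| .seq f.prog <| .seq dup c.prog)) drop

theorem runLe_fst :
    (Fn.fst.prog : StackProg (Alph Γ)).RunLe (store i o (x.code ++ 2 :: m) [] b [])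
      (store i o (x.fst.code ++ 2 :: m) [] b []) (8 * x.size + 8) := by
  cases x with
  | nil => exact (StackProg.RunLe.ite_true rfl runLe_skip).mono (by simp [Tree.size])
  | cons x y =>
    have hx' : ∀ s ∈ x.code.reverse, s ≠ 2 :=
      fun s hs => x.ne_two_of_mem_code (List.mem_reverse.1 hs)
    have h₁ := runLe_dropCode 0 y.code (2 :: m) (fun s => y.ne_two_of_mem_code) (inCode_two _)
      (store i o (y.code ++ 2 :: m) x.code.reverse b []) rfl
    have h₂ := runLe_moveCode (j := 1) (j' := 0) (by decide) x.code.reverse [] hx' inCode_nil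
      (store i o (2 :: m) x.code.reverse b []) (by simp)
    simp only [store_zero, update_zero, update_one, List.reverse_reverse, List.length_reverse,
      Tree.length_code] at h₁ h₂
    refine (StackProg.RunLe.ite_false rfl ((runLe_pop_zero 1).seq ((?_ : StackProg.RunLe _ _
      (store i o (y.code ++ 2 :: m) x.code.reverse b []) (4 * x.size + 2)).seq
        (h₁.seq h₂)))).mono (by simp [Tree.size]; omega)
    rw [List.append_eq, List.append_assoc]
    exact runLe_split x

theorem runLe_snd :
    (Fn.snd.prog : StackProg (Alph Γ)).RunLe (store i o (x.code ++ 2 :: m) [] b [])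
      (store i o (x.snd.code ++ 2 :: m) [] b []) (8 * x.size + 8) := by
  cases x with
  | nil => exact (StackProg.RunLe.ite_true rfl runLe_skip).mono (by simp [Tree.size])
  | cons x y =>
    have hx' : ∀ s ∈ x.code.reverse, s ≠ 2 :=
      fun s hs => x.ne_two_of_mem_code (List.mem_reverse.1 hs)
    have h₁ := runLe_dropCode 1 x.code.reverse [] hx' inCode_nil
      (store i o (y.code ++ 2 :: m) x.code.reverse b []) (by simp)
    simp only [update_one, List.length_reverse, Tree.length_code] at h₁
    refine (StackProg.RunLe.ite_false rfl ((runLe_pop_zero 1).seq ((?_ : StackProg.RunLe _ _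
      (store i o (y.code ++ 2 :: m) x.code.reverse b []) (4 * x.size + 2)).seq
        h₁))).mono (by simp [Tree.size]; omega)
    rw [List.append_eq, List.append_assoc]
    exact runLe_split x

theorem topIs_code_of_ne_nil {t : Tree} (ht : t ≠ .nil) (l : List Symb) :
    topIs 0 (t.code ++ l).head? = false ∧ topIs 1 (t.code ++ l).head? = true := by
  cases t with
  | nil => exact absurd rfl ht
  | cons x y => exact ⟨rfl, rfl⟩

/-- Compiled tree programs are correct, and their cost bounds their number of steps. -/
theorem Fn.Eval.runLe {p : Fn} {x y : Tree} {n : ℕ} (h : p.Eval x y n) (m : List Symb) :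
    (p.prog : StackProg (Alph Γ)).RunLe (store i o (x.code ++ 2 :: m) [] [] [])
      (store i o (y.code ++ 2 :: m) [] [] []) n := by
  induction h generalizing m with
  | id x => exact runLe_skip
  | const d x =>
    have h₁ := runLe_dropCode 0 x.code (2 :: m) (fun s => x.ne_two_of_mem_code) (inCode_two _)
      (store i o (x.code ++ 2 :: m) [] [] []) rfl
    simp only [update_zero, Tree.length_code] at h₁
    exact (h₁.seq (runLe_pushList d.code)).mono (by simp; omega)
  | fst x => exact runLe_fst x
  | snd x => exact runLe_snd x
  | @pair f g x y z m₁ m₂ _ _ ihf ihg =>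
    exact ((runLe_dup x).seq ((ihg (x.code ++ 2 :: m)).seq ((runLe_swap z x).seq
      ((ihf (z.code ++ 2 :: m)).seq (runLe_join y z))))).mono (by omega)
  | comp _ _ ihf ihg => exact (ihf m).seq (ihg m)
  | @ite_true c f g x b y m₁ m₂ _ hb _ ihc ihf =>
    exact ((runLe_dup x).seq ((ihc (x.code ++ 2 :: m)).seq
      (.ite_false (topIs_code_of_ne_nil hb _).1 ((runLe_drop b).seq (ihf m))))).mono (by omega)
  | @ite_false c f g x y m₁ m₂ _ _ ihc ihg =>
    exact ((runLe_dup x).seq ((ihc (x.code ++ 2 :: m)).seq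
      (.ite_true rfl ((runLe_drop .nil).seq (ihg m))))).mono (by simp [Tree.size]; omega)
  | @loop_false c f x n _ ih =>
    exact ((runLe_dup x).seq ((ih (x.code ++ 2 :: m)).seq
      ((StackProg.RunLe.loop_false rfl).seq (runLe_drop .nil)))).mono (by simp [Tree.size]; omega)
  | @loop_true c f x b y z m₁ m₂ m₃ _ hb _ _ ihc ihf ihl =>
    obtain ⟨k, hk, hr⟩ := ihl m
    -- The run of the loop from `y` consists of a test, which is also the end of the loop body
    -- here, and of the remaining run of the inner loop.
    cases hr with
    | @seq _ _ _ s₁ _ k₁ k₂ r₁ r₂ =>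
    cases r₂ with
    | @seq _ _ _ s₂ _ k₃ k₄ r₃ r₄ =>
    cases r₄ with
    | @seq _ _ _ s₃ _ k₅ k₆ r₅ r₆ =>
    refine ((runLe_dup x).seq ((ihc (x.code ++ 2 :: m)).seq (StackProg.RunLe.seq (m₁ := _)
      (.loop_true (topIs_code_of_ne_nil hb _).2 ((runLe_drop b).seq ((ihf m).seq
        (StackProg.RunLe.seq ⟨k₁, le_rfl, r₁⟩ ⟨k₃, le_rfl, r₃⟩))) ⟨k₅, le_rfl, r₅⟩)
          ⟨k₆, le_rfl, r₆⟩))).mono (by omega)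

end

/-! ### Functions computable in polynomial time -/

/-- `g x` is at most a power of the size of the tree `c x`, with a fixed exponent. The size is
increased by one, so that the base is at least `2`. -/
def PolyBd {X : Type} (c : X → Tree) (g : X → ℕ) : Prop :=
  ∃ k, ∀ x, g x ≤ ((c x).size + 1) ^ k

namespace PolyBd

variable {X : Type} {c d : X → Tree} {f g : X → ℕ}

theorem two_le_base (c : X → Tree) (x : X) : 2 ≤ (c x).size + 1 := by
  have := (c x).size_pos
  omega

theorem of_le (hg : PolyBd c g) (h : ∀ x, f x ≤ g x) : PolyBd c f :=
  let ⟨k, hk⟩ := hg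
  ⟨k, fun x => (h x).trans (hk x)⟩

theorem const (n : ℕ) : PolyBd c fun _ => n :=
  ⟨n, fun x => (Nat.lt_two_pow_self).le.trans (Nat.pow_le_pow_left (two_le_base c x) n)⟩

theorem size : PolyBd c fun x => (c x).size := ⟨1, fun x => by simp⟩

theorem mul (hf : PolyBd c f) (hg : PolyBd c g) : PolyBd c fun x => f x * g x :=
  let ⟨k, hk⟩ := hf
  let ⟨l, hl⟩ := hg
  ⟨k + l, fun x => by rw [pow_add]; exact Nat.mul_le_mul (hk x) (hl x)⟩

theorem add (hf : PolyBd c f) (hg : PolyBd c g) : PolyBd c fun x => f x + g x :=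
  let ⟨k, hk⟩ := hf
  let ⟨l, hl⟩ := hg
  ⟨k + l + 1, fun x => by
    have h2 := two_le_base c x
    have h1 : ((c x).size + 1) ^ k ≤ ((c x).size + 1) ^ (k + l) :=
      Nat.pow_le_pow_right (by omega) (by omega)
    have h3 : ((c x).size + 1) ^ l ≤ ((c x).size + 1) ^ (k + l) :=
      Nat.pow_le_pow_right (by omega) (by omega)
    have := hk x
    have := hl x
    rw [pow_succ]
    nlinarith⟩

theorem pow (hf : PolyBd c f) (n : ℕ) : PolyBd c fun x => f x ^ n :=
  let ⟨k, hk⟩ := hf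
  ⟨k * n, fun x => by rw [pow_mul]; exact Nat.pow_le_pow_left (hk x) n⟩

theorem trans (hg : PolyBd d g) (hd : PolyBd c fun x => (d x).size) : PolyBd c g :=
  let ⟨k, hk⟩ := hg
  ((hd.add (const 1)).pow k).of_le hk

theorem precomp {Y : Type} (hf : PolyBd c f) (e : Y → X) :
    PolyBd (fun y => c (e y)) fun y => f (e y) :=
  let ⟨k, hk⟩ := hf
  ⟨k, fun y => hk (e y)⟩

end PolyBd

/-- The tree that represents a list of trees. -/
def tlist : List Tree → Tree
  | [] => .nil
  | a :: l => .cons a (tlist l)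

/-- The tree that represents a natural number in unary. -/
def unary (n : ℕ) : Tree := tlist (List.replicate n .nil)

/-- The tree that represents a truth value. -/
def tbool (b : Bool) : Tree := bif b then .cons .nil .nil else .nil

@[simp] theorem tlist_nil : tlist [] = .nil := rfl
@[simp] theorem tlist_cons (a : Tree) (l : List Tree) : tlist (a :: l) = .cons a (tlist l) := rfl
@[simp] theorem unary_zero : unary 0 = .nil := rfl
@[simp] theorem unary_succ (n : ℕ) : unary (n + 1) = .cons .nil (unary n) := rfl

@[simp] theorem snd_tlist (l : List Tree) : (tlist l).snd = tlist l.tail := by cases l <;> rfl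

@[simp] theorem snd_unary (n : ℕ) : (unary n).snd = unary (n - 1) := by cases n <;> rfl

theorem fst_tlist (l : List Tree) : (tlist l).fst = l.getD 0 .nil := by cases l <;> rfl

@[simp] theorem size_unary (n : ℕ) : (unary n).size = 2 * n + 1 := by
  induction n with
  | zero => rfl
  | succ n ih => simp only [unary_succ, Tree.size, ih]; ring

theorem size_tlist (l : List Tree) : (tlist l).size = (l.map fun t => t.size + 1).sum + 1 := by
  induction l with
  | nil => rfl
  | cons a l ih => simp only [tlist_cons, Tree.size, ih, List.map_cons, List.sum_cons]; ring

theorem length_le_size_tlist (l : List Tree) : l.length ≤ (tlist l).size := by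
  induction l with
  | nil => simp
  | cons a l ih => simp only [tlist_cons, Tree.size, List.length_cons]; omega

theorem size_le_size_tlist {l : List Tree} {t : Tree} (h : t ∈ l) : t.size ≤ (tlist l).size := by
  induction l with
  | nil => simp at h
  | cons a l ih =>
    simp only [tlist_cons, Tree.size]
    rcases List.mem_cons.1 h with rfl | h
    · omega
    · have := ih h
      omega

theorem size_tlist_drop_le (l : List Tree) (i : ℕ) : (tlist (l.drop i)).size ≤ (tlist l).size := by
  induction l generalizing i with
  | nil => simp
  | cons a l ih =>
    cases i with
    | zero => simp
    | succ i =>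
      simp only [tlist_cons, Tree.size, List.drop_succ_cons]
      have := ih i
      omega

theorem size_tlist_le {l : List Tree} {m : ℕ} (h : ∀ t ∈ l, t.size ≤ m) :
    (tlist l).size ≤ l.length * (m + 1) + 1 := by
  induction l with
  | nil => simp [Tree.size]
  | cons a l ih =>
    have h₁ := ih fun t ht => h t (by simp [ht])
    have h₂ := h a (by simp)
    simp only [tlist_cons, Tree.size, List.length_cons]
    nlinarith

theorem size_tbool_le (b : Bool) : (tbool b).size ≤ 3 := by cases b <;> simp [tbool, Tree.size]

theorem Tree.size_fst_le (t : Tree) : t.fst.size ≤ t.size := by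
  cases t <;> simp only [Tree.fst, Tree.size] <;> omega

theorem Tree.size_snd_le (t : Tree) : t.snd.size ≤ t.size := by
  cases t <;> simp only [Tree.snd, Tree.size] <;> omega

/-- The program computes `y` from `x` at cost at most `m`. -/
def Fn.EvalLe (p : Fn) (x y : Tree) (m : ℕ) : Prop := ∃ m' ≤ m, p.Eval x y m'

/-- A loop that runs through the states `z 0, ..., z N`. -/
theorem Fn.evalLe_loop {c f : Fn} {N M : ℕ} (z b : ℕ → Tree)
    (hc : ∀ i ≤ N, c.EvalLe (z i) (b i) M) (hb : ∀ i < N, b i ≠ .nil) (hN : b N = .nil)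
    (hf : ∀ i < N, f.EvalLe (z i) (z (i + 1)) M) (hz : ∀ i ≤ N, (z i).size ≤ M)
    (hbM : ∀ i ≤ N, (b i).size ≤ M) :
    (Fn.loop c f).EvalLe (z 0) (z N) ((N + 1) * (12 * M + 14)) := by
  induction N generalizing z b with
  | zero =>
    obtain ⟨m, hm, h⟩ := hc 0 le_rfl
    rw [hN] at h
    have := hz 0 le_rfl
    exact ⟨_, by omega, .loop_false h⟩
  | succ N ih =>
    obtain ⟨m₁, hm₁, h₁⟩ := hc 0 (by omega)
    obtain ⟨m₂, hm₂, h₂⟩ := hf 0 (by omega)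
    obtain ⟨m₃, hm₃, h₃⟩ := ih (fun i => z (i + 1)) (fun i => b (i + 1))
      (fun i hi => hc _ (by omega)) (fun i hi => hb _ (by omega)) hN (fun i hi => hf _ (by omega))
      (fun i hi => hz _ (by omega)) (fun i hi => hbM _ (by omega))
    have := hz 0 (by omega)
    have := hbM 0 (by omega)
    refine ⟨_, ?_, .loop_true h₁ (hb 0 (by omega)) h₂ h₃⟩
    nlinarith

/-- `f x` can be computed from `c x` by a program that does not depend on `x`, in time bounded by a
polynomial in the size of `c x`. The type `X` carries the mathematical objects that are encoded by
the trees. -/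
def Poly {X : Type} (c f : X → Tree) : Prop :=
  ∃ (p : Fn) (n : X → ℕ), (∀ x, p.Eval (c x) (f x) (n x)) ∧ PolyBd c n ∧
    PolyBd c fun x => (f x).size

namespace Poly

variable {X Y : Type} {c f g : X → Tree}

theorem bd (hf : Poly c f) : PolyBd c fun x => (f x).size :=
  let ⟨_, _, _, _, h⟩ := hf
  h

theorem of_eq (hf : Poly c f) (h : ∀ x, f x = g x) : Poly c g := funext h ▸ hf

theorem of_eq_left {d : X → Tree} (hf : Poly c f) (h : ∀ x, c x = d x) : Poly d f := funext h ▸ hf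

protected theorem id : Poly c c := ⟨.id, fun _ => 2, fun _ => .id _, .const 2, .size⟩

theorem const (d : Tree) : Poly c fun _ => d :=
  ⟨.const d, _, fun _ => .const d _, (((PolyBd.const 2).mul .size).add (.const _)).add (.const _),
    .const _⟩

theorem trans (hf : Poly c f) (hg : Poly f g) : Poly c g :=
  let ⟨p, _, hp, hn, hs⟩ := hf
  let ⟨q, _, hq, hn', hs'⟩ := hg
  ⟨.comp p q, _, fun x => .comp (hp x) (hq x), hn.add (hn'.trans hs), hs'.trans hs⟩

theorem fst (hf : Poly c f) : Poly c fun x => (f x).fst :=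
  hf.trans ⟨.fst, _, fun _ => .fst _, ((PolyBd.const 8).mul .size).add (.const 8),
    PolyBd.size.of_le fun _ => Tree.size_fst_le _⟩

theorem snd (hf : Poly c f) : Poly c fun x => (f x).snd :=
  hf.trans ⟨.snd, _, fun _ => .snd _, ((PolyBd.const 8).mul .size).add (.const 8),
    PolyBd.size.of_le fun _ => Tree.size_snd_le _⟩

theorem cons (hf : Poly c f) (hg : Poly c g) : Poly c fun x => .cons (f x) (g x) :=
  let ⟨_, _, hp, hn, hs⟩ := hf
  let ⟨_, _, hq, hn', hs'⟩ := hg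
  ⟨.pair _ _, _, fun x => .pair (hp x) (hq x), (hn.add hn').add (((((PolyBd.const 12).mul .size).add
    ((PolyBd.const 8).mul hs)).add ((PolyBd.const 4).mul hs')).add (.const 16)),
    (hs.add hs').add (.const 1)⟩

theorem precomp (hf : Poly c f) (e : Y → X) : Poly (fun y => c (e y)) fun y => f (e y) :=
  let ⟨p, n, hp, hn, hs⟩ := hf
  ⟨p, fun y => n (e y), fun y => hp (e y), hn.precomp e, hs.precomp e⟩

theorem left (hf : Poly c fun x => .cons (f x) (g x)) : Poly c f := hf.fst

theorem right (hf : Poly c fun x => .cons (f x) (g x)) : Poly c g := hf.snd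

/-- Definition by cases, where each case has to be computed on its own domain only. -/
theorem cases {b : X → Bool} (hb : Poly c fun x => tbool (b x))
    (h₁ : Poly (fun x : {x // b x = true} => c x) fun x => f x)
    (h₂ : Poly (fun x : {x // b x = false} => c x) fun x => f x) : Poly c f := by
  obtain ⟨p, n, hp, hn, hs⟩ := hb
  obtain ⟨p₁, n₁, hp₁, ⟨k₁, hn₁⟩, l₁, hs₁⟩ := h₁
  obtain ⟨p₂, n₂, hp₂, ⟨k₂, hn₂⟩, l₂, hs₂⟩ := h₂
  have key : ∀ x, ∃ m ≤ n x + (((c x).size + 1) ^ k₁ + ((c x).size + 1) ^ k₂)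
      + (8 * (c x).size + 20), (Fn.ite p p₁ p₂).Eval (c x) (f x) m := by
    intro x
    cases h : b x with
    | true =>
      have hx := hp x
      simp only [h, tbool, cond_true] at hx
      have := hn₁ ⟨x, h⟩
      exact ⟨_, by simp only [Tree.size] at *; omega, .ite_true hx (by simp) (hp₁ ⟨x, h⟩)⟩
    | false =>
      have hx := hp x
      simp only [h, tbool, cond_false] at hx
      have := hn₂ ⟨x, h⟩
      exact ⟨_, by simp only at *; omega, .ite_false hx (hp₂ ⟨x, h⟩)⟩
  choose m hm hm' using key
  refine ⟨_, m, hm', PolyBd.of_le ?_ hm, PolyBd.of_le (g := fun x => ((c x).size + 1) ^ l₁ +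
    ((c x).size + 1) ^ l₂) ?_ fun x => ?_⟩
  · exact (hn.add (((PolyBd.size.add (.const 1)).pow k₁).add
      ((PolyBd.size.add (.const 1)).pow k₂))).add (((PolyBd.const 8).mul .size).add (.const 20))
  · exact ((PolyBd.size.add (.const 1)).pow l₁).add ((PolyBd.size.add (.const 1)).pow l₂)
  · cases h : b x with
    | true => exact (hs₁ ⟨x, h⟩).trans (Nat.le_add_right _ _)
    | false => exact (hs₂ ⟨x, h⟩).trans (Nat.le_add_left _ _)

theorem cond {b : X → Bool} (hb : Poly c fun x => tbool (b x)) (hf : Poly c f) (hg : Poly c g) :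
    Poly c fun x => bif b x then f x else g x :=
  cases hb ((hf.precomp Subtype.val).of_eq fun x => by rw [x.2, cond_true])
    ((hg.precomp Subtype.val).of_eq fun x => by rw [x.2, cond_false])

/-- The test for `nil`. -/
theorem tbool_of_tree {b : X → Bool} (hf : Poly c f) (hb : ∀ x, b x = false ↔ f x = .nil) :
    Poly c fun x => tbool (b x) := by
  obtain ⟨p, n, hp, hn, hs⟩ := hf
  have key : ∀ x, ∃ m ≤ n x + (2 * (c x).size + 6) + (8 * (c x).size + 2 * (f x).size + 14),
      (Fn.ite p (.const (.cons .nil .nil)) (.const .nil)).Eval (c x) (tbool (b x)) m := by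
    intro x
    cases h : b x with
    | true =>
      exact ⟨_, by simp only [Tree.size]; omega,
        .ite_true (hp x) (fun h' => by simp [(hb x).2 h'] at h) (.const _ _)⟩
    | false =>
      have hx := hp x
      rw [(hb x).1 h] at hx
      exact ⟨_, by simp only [Tree.size]; omega, .ite_false hx (.const _ _)⟩
  choose m hm hm' using key
  refine ⟨_, m, hm', PolyBd.of_le ?_ hm, (PolyBd.const 3).of_le fun x => size_tbool_le _⟩
  exact (hn.add (((PolyBd.const 2).mul .size).add (.const 6))).add
    ((((PolyBd.const 8).mul .size).add ((PolyBd.const 2).mul hs)).add (.const 14))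

theorem not {b : X → Bool} (hb : Poly c fun x => tbool (b x)) : Poly c fun x => tbool (!b x) :=
  (cond hb (const (tbool false)) (const (tbool true))).of_eq fun x => by cases b x <;> rfl

theorem and {b b' : X → Bool} (hb : Poly c fun x => tbool (b x))
    (hb' : Poly c fun x => tbool (b' x)) : Poly c fun x => tbool (b x && b' x) :=
  (cond hb hb' (const (tbool false))).of_eq fun x => by cases b x <;> rfl

theorem or {b b' : X → Bool} (hb : Poly c fun x => tbool (b x))
    (hb' : Poly c fun x => tbool (b' x)) : Poly c fun x => tbool (b x || b' x) :=
  (cond hb (const (tbool true)) hb').of_eq fun x => by cases b x <;> rfl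

theorem tbool_cond {b b₁ b₂ : X → Bool} (hb : Poly c fun x => tbool (b x))
    (h₁ : Poly c fun x => tbool (b₁ x)) (h₂ : Poly c fun x => tbool (b₂ x)) :
    Poly c fun x => tbool (bif b x then b₁ x else b₂ x) :=
  (cond hb h₁ h₂).of_eq fun x => by cases b x <;> rfl

/-- Iteration over a list is computable in polynomial time if the steps are and if the intermediate
results have polynomial size. -/
theorem foldl {E S : X → Type} {ℓ : ∀ x, List (E x)} {eE : ∀ x, E x → Tree} {eS : ∀ x, S x → Tree}
    {init : ∀ x, S x} {step : ∀ x, S x → E x → S x}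
    (hℓ : Poly c fun x => tlist ((ℓ x).map (eE x))) (hi : Poly c fun x => eS x (init x))
    (hs : Poly (fun z : Σ x, S x × E x => .cons (c z.1) (.cons (eS z.1 z.2.1) (eE z.1 z.2.2)))
      fun z => eS z.1 (step z.1 z.2.1 z.2.2))
    {B : X → ℕ} (hB : PolyBd c B)
    (hb : ∀ x l, l <+: ℓ x → (eS x (l.foldl (step x) (init x))).size ≤ B x) :
    Poly c fun x => eS x ((ℓ x).foldl (step x) (init x)) := by
  -- One round of the loop acts on triples of the parameters, the accumulator, and a list.
  let Z : Type := Σ x, S x × E x × List Tree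
  let cz : Z → Tree := fun z =>
    .cons (c z.1) (.cons (eS z.1 z.2.1) (.cons (eE z.1 z.2.2.1) (tlist z.2.2.2)))
  have hz : Poly cz cz := .id
  have hz1 : Poly cz fun z => c z.1 := hz.left
  have hz2 : Poly cz fun z => eS z.1 z.2.1 := hz.right.left
  have hz3 : Poly cz fun z => eE z.1 z.2.2.1 := hz.right.right.left
  have hz4 : Poly cz fun z => tlist z.2.2.2 := hz.right.right.right
  have hbody : Poly cz fun z =>
      .cons (c z.1) (.cons (eS z.1 (step z.1 z.2.1 z.2.2.1)) (tlist z.2.2.2)) :=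
    hz1.cons (((hz1.cons (hz2.cons hz3)).trans
      (hs.precomp fun z : Z => ⟨z.1, z.2.1, z.2.2.1⟩)).cons hz4)
  obtain ⟨p, n, hp, ⟨k, hn⟩, -⟩ := hbody
  have hstart : Poly c fun x => .cons (c x) (.cons (eS x (init x)) (tlist ((ℓ x).map (eE x)))) :=
    Poly.id.cons (hi.cons hℓ)
  let acc : ∀ x, ℕ → S x := fun x i => ((ℓ x).take i).foldl (step x) (init x)
  let z : X → ℕ → Tree := fun x i =>
    .cons (c x) (.cons (eS x (acc x i)) (tlist (((ℓ x).map (eE x)).drop i)))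
  let size : X → ℕ := fun x => (c x).size + (B x + (tlist ((ℓ x).map (eE x))).size + 1) + 1
  have hsize : ∀ x i, (z x i).size ≤ size x := by
    intro x i
    have h₁ := hb x _ (List.take_prefix i (ℓ x))
    have h₂ := size_tlist_drop_le ((ℓ x).map (eE x)) i
    simp only [z, size, Tree.size, acc]
    omega
  have hsize' : PolyBd c size := (PolyBd.size.add ((hB.add hℓ.bd).add (.const 1))).add (.const 1)
  let M : X → ℕ := fun x => 40 * size x + 40 + (size x + 1) ^ k
  have hM : PolyBd c M := (((PolyBd.const 40).mul hsize').add (.const 40)).add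
    ((hsize'.add (.const 1)).pow k)
  have hloop : ∀ x, (Fn.loop (.comp .snd .snd) p).EvalLe (z x 0) (z x (ℓ x).length)
      (((ℓ x).length + 1) * (12 * M x + 14)) := by
    intro x
    refine Fn.evalLe_loop (z x) (fun i => tlist (((ℓ x).map (eE x)).drop i)) (fun i _ => ?_)
      (fun i hi h => ?_) ?_ (fun i hi => ?_) (fun i _ => ?_) (fun i _ => ?_)
    · refine ⟨_, ?_, .comp (.snd _) (.snd _)⟩
      have := hsize x i
      simp only [z, Tree.size, M, Tree.snd] at *
      omega
    · rw [List.drop_eq_getElem_cons (by simpa using hi)] at h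
      simp at h
    · rw [List.drop_eq_nil_of_le (by simp)]
      rfl
    · have hi' : i < ((ℓ x).map (eE x)).length := by simpa using hi
      have h := hp ⟨x, acc x i, (ℓ x)[i], ((ℓ x).map (eE x)).drop (i + 1)⟩
      have e₁ : cz ⟨x, acc x i, (ℓ x)[i], ((ℓ x).map (eE x)).drop (i + 1)⟩ = z x i := by
        simp only [cz, z]
        rw [List.drop_eq_getElem_cons hi', tlist_cons, List.getElem_map]
      have e₂ : step x (acc x i) (ℓ x)[i] = acc x (i + 1) := by
        simp only [acc]
        rw [List.take_add_one, List.getElem?_eq_getElem hi, Option.toList_some, List.foldl_append]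
        rfl
      have h₃ := hn ⟨x, acc x i, (ℓ x)[i], ((ℓ x).map (eE x)).drop (i + 1)⟩
      simp only [e₂] at h
      rw [e₁] at h h₃
      refine ⟨_, h₃.trans ?_, h⟩
      exact (Nat.pow_le_pow_left (Nat.add_le_add_right (hsize x i) 1) k).trans (by simp [M])
    · have := hsize x i
      simp only [M]
      omega
    · have := hsize x i
      simp only [z, Tree.size, M] at *
      omega
  choose m hm hm' using hloop
  have hlen : PolyBd c fun x => (ℓ x).length :=
    hℓ.bd.of_le fun x => by simpa using length_le_size_tlist ((ℓ x).map (eE x))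
  have hend : Poly (fun x => z x 0) fun x => z x (ℓ x).length := by
    refine ⟨_, m, hm', PolyBd.of_le (g := fun x => (size x + 1) * (12 * M x + 14)) ?_ ?_, ?_⟩
    · refine PolyBd.trans (d := c) ?_ (PolyBd.size.of_le fun x => by simp [z, Tree.size]; omega)
      exact (hsize'.add (.const 1)).mul (((PolyBd.const 12).mul hM).add (.const 14))
    · intro x
      refine (hm x).trans (Nat.mul_le_mul_right _ (Nat.add_le_add_right ?_ 1))
      have := length_le_size_tlist ((ℓ x).map (eE x))
      simp only [size, List.length_map] at *
      omega
    · exact PolyBd.trans (d := c) (hsize'.of_le fun x => hsize x _)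
        (PolyBd.size.of_le fun x => by simp [z, Tree.size]; omega)
  refine (hstart.trans (g := fun x => z x (ℓ x).length) (hend.of_eq_left fun x => ?_)).snd.fst.of_eq
    fun x => ?_
  · simp [z, acc]
  · simp [z, acc]

/-- Iteration of a function, where the number of rounds is given in unary. -/
theorem iterate {S : X → Type} {eS : ∀ x, S x → Tree} {N : X → ℕ} {init : ∀ x, S x}
    {step : ∀ x, S x → S x} (hN : Poly c fun x => unary (N x)) (hi : Poly c fun x => eS x (init x))
    (hs : Poly (fun z : Σ x, S x => .cons (c z.1) (eS z.1 z.2)) fun z => eS z.1 (step z.1 z.2))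
    {B : X → ℕ} (hB : PolyBd c B)
    (hb : ∀ x i, i ≤ N x → (eS x ((step x)^[i] (init x))).size ≤ B x) :
    Poly c fun x => eS x ((step x)^[N x] (init x)) := by
  have key : ∀ x i, (List.replicate i ()).foldl (fun a _ => step x a) (init x) =
      (step x)^[i] (init x) := by
    intro x i
    induction i with
    | zero => rfl
    | succ i ih =>
      rw [List.replicate_succ', List.foldl_append, ih, Function.iterate_succ_apply']; rfl
  refine (foldl (E := fun _ => Unit) (ℓ := fun x => List.replicate (N x) ())
    (eE := fun _ _ => .nil) (step := fun x a _ => step x a) (hN.of_eq fun x => by simp [unary]) hi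
    (Poly.trans (f := fun z => .cons (c z.1) (eS z.1 z.2.1)) (Poly.id.left.cons Poly.id.right.left)
      (hs.precomp fun z : Σ x, S x × Unit => ⟨z.1, z.2.1⟩)) hB
        fun x l hl => ?_).of_eq fun x => by rw [key]
  obtain ⟨i, hi, rfl⟩ : ∃ i, i ≤ N x ∧ l = List.replicate i () :=
    ⟨l.length, by simpa using hl.length_le, List.eq_replicate_iff.2 ⟨rfl, fun _ _ => rfl⟩⟩
  rw [key]
  exact hb x i hi

theorem reverse {l : X → List Tree} (hl : Poly c fun x => tlist (l x)) :
    Poly c fun x => tlist (l x).reverse := by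
  refine (foldl (E := fun _ => Tree) (S := fun _ => List Tree) (ℓ := l) (eE := fun _ t => t)
    (eS := fun _ => tlist) (init := fun _ => []) (step := fun _ a e => e :: a)
    (hl.of_eq fun x => by simp) (const _)
    (Poly.id.right.right.cons Poly.id.right.left) hl.bd fun x l' hl' => ?_).of_eq fun x => by simp
  obtain ⟨r, hr⟩ := hl'
  rw [List.foldl_flip_cons_eq_append, List.append_nil, size_tlist, size_tlist, ← hr]
  simp

/-- The list of the results of a computation for all elements of a list. -/
theorem map {E : X → Type} {ℓ : ∀ x, List (E x)} {eE : ∀ x, E x → Tree} {F : ∀ x, E x → Tree}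
    (hℓ : Poly c fun x => tlist ((ℓ x).map (eE x)))
    (hF : Poly (fun z : Σ x, E x => .cons (c z.1) (eE z.1 z.2)) fun z => F z.1 z.2) :
    Poly c fun x => tlist ((ℓ x).map (F x)) := by
  have hfold : ∀ x (l : List (E x)) (a : List Tree),
      l.foldl (fun a e => F x e :: a) a = (l.map (F x)).reverse ++ a := by
    intro x l
    induction l with
    | nil => simp
    | cons e l ih => intro a; simp [ih]
  obtain ⟨k, hk⟩ := hF.bd
  refine (foldl (S := fun _ => List Tree) (eS := fun _ => tlist) (init := fun _ => [])
    (step := fun x a e => F x e :: a) hℓ (const _)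
    (B := fun x => (tlist ((ℓ x).map (eE x))).size *
      (((c x).size + (tlist ((ℓ x).map (eE x))).size + 1 + 1) ^ k + 1) + 1) ?_ ?_
    fun x l hl => ?_).reverse.of_eq fun x => by simp [hfold]
  · exact ((Poly.id.left.cons Poly.id.right.right).trans
      (hF.precomp fun z : Σ x, List Tree × E x => ⟨z.1, z.2.2⟩)).cons Poly.id.right.left
  · exact (hℓ.bd.mul (((((PolyBd.size.add hℓ.bd).add (.const 1)).add (.const 1)).pow k).add
      (.const 1))).add (.const 1)
  · rw [hfold, List.append_nil]
    refine (size_tlist_le (m := ((c x).size + (tlist ((ℓ x).map (eE x))).size + 1 + 1) ^ k)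
      fun t ht => ?_).trans ?_
    · obtain ⟨e, he, rfl⟩ := List.mem_map.1 (List.mem_reverse.1 ht)
      refine (hk ⟨x, e⟩).trans (Nat.pow_le_pow_left ?_ k)
      have := size_le_size_tlist (List.mem_map_of_mem (f := eE x) (hl.subset he))
      simp only [Tree.size]
      omega
    · refine Nat.add_le_add_right (Nat.mul_le_mul_right _ ?_) 1
      have := length_le_size_tlist ((ℓ x).map (eE x))
      have := hl.length_le
      simp at *
      omega

theorem getD {l : X → List Tree} {i : X → ℕ} (hl : Poly c fun x => tlist (l x))
    (hi : Poly c fun x => unary (i x)) : Poly c fun x => (l x).getD (i x) .nil := by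
  have key : ∀ (l : List Tree) (i : ℕ), List.tail^[i] l = l.drop i := by
    intro l i
    induction i with
    | zero => rfl
    | succ i ih => rw [Function.iterate_succ_apply', ih, List.tail_drop]
  refine (iterate (S := fun _ => List Tree) (eS := fun _ => tlist) (init := l)
    (step := fun _ => List.tail) hi hl (Poly.id.right.snd.of_eq fun z => by simp) hl.bd
    fun x i _ => ?_).fst.of_eq fun x => ?_
  · rw [key]
    exact size_tlist_drop_le _ _
  · rw [key, fst_tlist]
    simp [List.getD_eq_getElem?_getD]

/-! ### Unary arithmetic and bounded quantifiers -/

section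

variable {M N : X → ℕ}

theorem lt (hM : Poly c fun x => unary (M x)) (hN : Poly c fun x => unary (N x)) :
    Poly c fun x => tbool (decide (M x < N x)) := by
  have key : ∀ n i : ℕ, (fun n => n - 1)^[i] n = n - i := by
    intro n i
    induction i with
    | zero => rfl
    | succ i ih => rw [Function.iterate_succ_apply', ih]; omega
  refine (iterate (S := fun _ => ℕ) (eS := fun _ => unary) (init := N)
    (step := fun _ n => n - 1) hM hN (Poly.id.right.snd.of_eq fun z => by simp) hN.bd
    fun x i _ => ?_).tbool_of_tree fun x => ?_
  · rw [key]
    simp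
  · rw [key, decide_eq_false_iff_not]
    cases h : N x - M x with
    | zero => simp; omega
    | succ n => simp; omega

theorem le (hM : Poly c fun x => unary (M x)) (hN : Poly c fun x => unary (N x)) :
    Poly c fun x => tbool (decide (M x ≤ N x)) :=
  (lt hN hM).not.of_eq fun x => by
    congr 1
    rw [← decide_not, decide_eq_decide]
    omega

theorem eq (hM : Poly c fun x => unary (M x)) (hN : Poly c fun x => unary (N x)) :
    Poly c fun x => tbool (decide (M x = N x)) :=
  ((le hM hN).and (le hN hM)).of_eq fun x => by
    congr 1
    rw [← Bool.decide_and, decide_eq_decide]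
    omega

theorem bd_unary (hM : Poly c fun x => unary (M x)) : PolyBd c M :=
  hM.bd.of_le fun x => by simp; omega

theorem succ (hM : Poly c fun x => unary (M x)) : Poly c fun x => unary (M x + 1) :=
  ((const .nil).cons hM).of_eq fun x => by simp

theorem add (hM : Poly c fun x => unary (M x)) (hN : Poly c fun x => unary (N x)) :
    Poly c fun x => unary (M x + N x) := by
  have key : ∀ n i : ℕ, (fun n => n + 1)^[i] n = n + i := by
    intro n i
    induction i with
    | zero => rfl
    | succ i ih => rw [Function.iterate_succ_apply', ih]; omega
  refine (iterate (S := fun _ => ℕ) (eS := fun _ => unary) (init := M)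
    (step := fun _ n => n + 1) hN hM (succ Poly.id.right)
    (((PolyBd.const 2).mul (hM.bd_unary.add hN.bd_unary)).add (.const 1))
    fun x i hi => ?_).of_eq fun x => by rw [key]
  rw [key]
  simp only [size_unary]
  omega

theorem mul (hM : Poly c fun x => unary (M x)) (hN : Poly c fun x => unary (N x)) :
    Poly c fun x => unary (M x * N x) := by
  have key : ∀ m i : ℕ, (fun n => n + m)^[i] 0 = m * i := by
    intro n i
    induction i with
    | zero => rfl
    | succ i ih => rw [Function.iterate_succ_apply', ih]; ring
  refine (iterate (S := fun _ => ℕ) (eS := fun _ => unary) (init := fun _ => 0)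
    (step := fun x n => n + M x) hN (const _)
    (add Poly.id.right (Poly.id.left.trans (hM.precomp fun z : Σ _, ℕ => z.1)))
    (((PolyBd.const 2).mul (hM.bd_unary.mul hN.bd_unary)).add (.const 1))
    fun x i hi => ?_).of_eq fun x => by rw [key]
  rw [key]
  simp only [size_unary]
  exact Nat.add_le_add_right (Nat.mul_le_mul_left 2 (Nat.mul_le_mul_left _ hi)) 1

theorem range (hN : Poly c fun x => unary (N x)) :
    Poly c fun x => tlist ((List.range (N x)).map unary) := by
  have key : ∀ i : ℕ, (fun n => n + 1)^[i] 0 = i := by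
    intro i
    induction i with
    | zero => rfl
    | succ i ih => rw [Function.iterate_succ_apply', ih]
  refine (iterate (S := fun _ => ℕ)
    (eS := fun _ n => .cons (unary n) (tlist ((List.range n).map unary).reverse))
    (init := fun _ => 0) (step := fun _ n => n + 1) (B := fun x => (2 * N x + 1) +
      (N x * (2 * N x + 1 + 1) + 1) + 1) hN (const _)
    ((succ Poly.id.right.left).cons ((Poly.id.right.left.cons Poly.id.right.right).of_eq
      fun x => ?_)) ?_ fun x i hi => ?_).snd.reverse.of_eq fun x => by rw [key]; simp
  · simp [List.range_succ]
  · have h2 := ((PolyBd.const 2).mul hN.bd_unary).add (.const 1)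
    exact (h2.add ((hN.bd_unary.mul (h2.add (.const 1))).add (.const 1))).add (.const 1)
  · rw [key]
    have : (tlist ((List.range i).map unary).reverse).size ≤ N x * (2 * N x + 1 + 1) + 1 := by
      refine (size_tlist_le (m := 2 * N x + 1) fun t ht => ?_).trans ?_
      · simp only [List.mem_reverse, List.mem_map, List.mem_range] at ht
        obtain ⟨j, hj, rfl⟩ := ht
        simp only [size_unary]
        omega
      · simpa using Nat.mul_le_mul_right (2 * N x + 1 + 1) hi
    simp only [Tree.size, size_unary]
    omega

/-- Iteration over all indices below a bound that is given in unary. -/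
theorem finRange (hN : Poly c fun x => unary (N x)) :
    Poly c fun x => tlist ((List.finRange (N x)).map fun i => unary i.val) :=
  (range hN).of_eq fun x => by
    rw [← List.map_coe_finRange_eq_range, List.map_map]
    rfl

/-- Tabulation of a function of an index. -/
theorem tab {F : ∀ x, Fin (N x) → Tree} (hN : Poly c fun x => unary (N x))
    (hF : Poly (fun z : Σ x, Fin (N x) => .cons (c z.1) (unary z.2)) fun z => F z.1 z.2) :
    Poly c fun x => tlist (List.ofFn (F x)) :=
  (map (finRange hN) hF).of_eq fun x => by rw [List.ofFn_eq_map]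

/-- Access to a table. -/
theorem get {F : ∀ x, Fin (N x) → Tree} {i : ∀ x, Fin (N x)}
    (hF : Poly c fun x => tlist (List.ofFn (F x))) (hi : Poly c fun x => unary (i x)) :
    Poly c fun x => F x (i x) :=
  (getD hF hi).of_eq fun x => by simp [List.getD_eq_getElem?_getD]

theorem any {E : X → Type} {ℓ : ∀ x, List (E x)} {eE : ∀ x, E x → Tree} {q : ∀ x, E x → Bool}
    (hℓ : Poly c fun x => tlist ((ℓ x).map (eE x)))
    (hq : Poly (fun z : Σ x, E x => .cons (c z.1) (eE z.1 z.2)) fun z => tbool (q z.1 z.2)) :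
    Poly c fun x => tbool ((ℓ x).any (q x)) := by
  have key : ∀ x (l : List (E x)) (a : Bool), l.foldl (fun a e => a || q x e) a =
      (a || l.any (q x)) := by
    intro x l
    induction l with
    | nil => simp
    | cons e l ih => intro a; simp [ih, Bool.or_assoc]
  exact (foldl (S := fun _ => Bool) (eS := fun _ => tbool) (init := fun _ => false)
    (step := fun x a e => a || q x e) hℓ (const _) (or Poly.id.right.left
      ((Poly.id.left.cons Poly.id.right.right).trans
        (hq.precomp fun z : Σ x, Bool × E x => ⟨z.1, z.2.2⟩))) (.const 3)
        fun x l _ => size_tbool_le _).of_eq fun x => by rw [key, Bool.false_or]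

/-- Bounded existential quantification. -/
theorem ex {q : ∀ x, Fin (N x) → Bool} (hN : Poly c fun x => unary (N x))
    (hq : Poly (fun z : Σ x, Fin (N x) => .cons (c z.1) (unary z.2)) fun z => tbool (q z.1 z.2)) :
    Poly c fun x => tbool (decide (∃ i, q x i = true)) :=
  (any (finRange hN) hq).of_eq fun x => by
    congr 1
    rw [Bool.eq_iff_iff]
    simp

/-- Counting the indices that satisfy a condition. -/
theorem card {q : ∀ x, Fin (N x) → Bool} (hN : Poly c fun x => unary (N x))
    (hq : Poly (fun z : Σ x, Fin (N x) => .cons (c z.1) (unary z.2)) fun z => tbool (q z.1 z.2)) :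
    Poly c fun x => unary (Finset.univ.filter fun i => q x i = true).card := by
  have key : ∀ x (l : List (Fin (N x))) (a : ℕ),
      l.foldl (fun a e => bif q x e then a + 1 else a) a = a + l.countP (q x) := by
    intro x l
    induction l with
    | nil => simp
    | cons e l ih =>
      intro a
      rw [List.foldl_cons, ih, List.countP_cons]
      cases q x e
      · simp
      · simp; omega
  refine (foldl (S := fun _ => ℕ) (eS := fun _ => unary) (init := fun _ => 0)
    (step := fun x a e => bif q x e then a + 1 else a) (finRange hN) (const _)
    ((cond ((Poly.id.left.cons Poly.id.right.right).trans
      (hq.precomp fun z : Σ x, ℕ × Fin (N x) => ⟨z.1, z.2.2⟩)) (succ Poly.id.right.left)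
        Poly.id.right.left).of_eq fun z => ?_) (B := fun x => 2 * N x + 1) ?_
        fun x l hl => ?_).of_eq fun x => ?_
  · cases q z.1 z.2.2 <;> rfl
  · exact ((PolyBd.const 2).mul hN.bd_unary).add (.const 1)
  · rw [key, size_unary]
    have h₁ := hl.length_le
    have h₂ := List.countP_le_length (l := l) (p := q x)
    simp at h₁
    omega
  · rw [key, Nat.zero_add, List.countP_eq_length_filter, Fin.univ_def]
    simp [Finset.card, Finset.filter]

/-- The tree that represents an optional index. -/
def topt {n : ℕ} : Option (Fin n) → Tree
  | none => .nil
  | some i => .cons .nil (unary i)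

/-- Search for the first index that satisfies a condition. -/
theorem find {q : ∀ x, Fin (N x) → Bool} (hN : Poly c fun x => unary (N x))
    (hq : Poly (fun z : Σ x, Fin (N x) => .cons (c z.1) (unary z.2)) fun z => tbool (q z.1 z.2)) :
    Poly c fun x => topt ((List.finRange (N x)).find? (q x)) := by
  have key : ∀ x (l : List (Fin (N x))) (a : Option (Fin (N x))),
      l.foldl (fun a e => bif a.isSome || !q x e then a else some e) a = a.or (l.find? (q x)) := by
    intro x l
    induction l with
    | nil => simp
    | cons e l ih =>
      intro a
      rw [List.foldl_cons, ih, List.find?_cons]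
      cases a <;> cases q x e <;> simp
  have hsome : Poly (fun z : Σ x, Option (Fin (N x)) × Fin (N x) =>
      .cons (c z.1) (.cons (topt z.2.1) (unary z.2.2.val))) fun z => tbool z.2.1.isSome :=
    tbool_of_tree Poly.id.right.left fun z => by
      rcases z with ⟨x, _ | i, j⟩ <;> simp [topt]
  refine (foldl (S := fun x => Option (Fin (N x))) (eS := fun _ => topt) (init := fun _ => none)
    (step := fun x a e => bif a.isSome || !q x e then a else some e) (finRange hN) (const _)
    ((cond (or hsome
      (not ((Poly.id.left.cons Poly.id.right.right).trans
      (hq.precomp fun z : Σ x, Option (Fin (N x)) × Fin (N x) => ⟨z.1, z.2.2⟩))))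
        Poly.id.right.left ((const .nil).cons Poly.id.right.right)).of_eq fun z => ?_)
        (B := fun x => 2 * N x + 3) ?_ fun x l hl => ?_).of_eq fun x => ?_
  · cases (z.2.1.isSome || !q z.1 z.2.2) <;> rfl
  · exact ((PolyBd.const 2).mul hN.bd_unary).add (.const 3)
  · rw [key]
    cases (none.or (l.find? (q x))) with
    | none => simp [topt, Tree.size]
    | some i =>
      simp only [topt, Tree.size, size_unary]
      omega
  · rw [key, Option.none_or]

end

/-- Functions on a finite type are computed by a table. -/
theorem finmap {m : ℕ} {i : X → Fin m} (hi : Poly c fun x => unary (i x)) (F : Fin m → Tree) :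
    Poly c fun x => F (i x) :=
  get (F := fun _ => F) (const _) hi

end Poly

/-! ### Input, output, and the resulting Turing machines -/

section

variable {Γ : Type} {i : List Bool} {o : List Γ} {m a b c : List Symb}

open StackProg

/-- The tree that represents an output symbol. -/
def tsymb (s : Symb) : Tree := unary s.val

/-- Convert the input to the code of a list of truth values on the main stack. -/
def inputProg : StackProg (Alph Γ) :=
  .seq (.loop .inp Option.isSome (.op (.mv .inp (.int 1) (fun x => if x then 1 else 0)
    (fun x => x.getD 0)))) <|
  .seq (push 0 2) <| .seq (push 0 0) <|
  .loop (.int 1) Option.isSome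
    (ifTop 1 1 (.seq (pop 1) (pushList [1, 1, 0, 0])) (.seq (pop 1) (pushList [1, 0])))

/-- Convert the code of a list of symbols on the main stack to the output. -/
def outputProg (w : Symb → Γ) : StackProg (Alph Γ) :=
  .seq (.loop (.int 0) (topIs 1) (.seq (pop 0) <| ifTop 0 0 (.seq (pop 0) (push 1 0)) <|
    .seq (pop 0) <| .seq (pop 0) <| ifTop 0 0 (.seq (pop 0) (push 1 1)) <|
    .seq (pop 0) <| .seq (pop 0) <| .seq (pop 0) (push 1 2))) <|
  .seq (pop 0) <| .seq (pop 0) <|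
  .loop (.int 1) Option.isSome (.op (.mv (.int 1) .out (fun x => x) (fun x => w (x.getD 0))))

theorem runLe_pop_one (x : Symb) :
    (pop 1).RunLe (store i o m (x :: a) b c) (store i o m a b c) 1 :=
  .op (by simp [StackOp.sem])

theorem runLe_push_one (x : Symb) :
    (push 1 x).RunLe (store i o m a b c) (store i o m (x :: a) b c) 1 :=
  .op (by simp [StackOp.sem])

theorem runLe_inputProg (l : List Bool) :
    inputProg.RunLe (store l o [] [] b c)
      (store [] o ((tlist (l.map tbool)).code ++ [2]) [] b c) (12 * l.length + 4) := by
  have h₁ : ∀ (l : List Bool) (a : List Symb), (StackProg.loop .inp Option.isSome (.op (.mv .inp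
      (.int 1) (fun x => if x then 1 else 0) (fun x => x.getD 0)))).RunLe
      (store l o [] a b c) (store [] o [] ((l.map fun x => if x then 1 else 0).reverse ++ a) b c)
      (2 * l.length + 1) := by
    intro l
    induction l with
    | nil => exact fun a => .loop_false rfl
    | cons x l ih =>
      intro a
      refine (StackProg.RunLe.loop_true rfl
        (.op (s' := store l o [] ((if x then 1 else 0) :: a) b c)
        (by simp [StackOp.sem])) ((ih _).cast ?_)).mono (by simp; omega)
      simp
  have h₂ : ∀ (l r : List Bool), (StackProg.loop (.int 1) Option.isSome
      (ifTop 1 1 (.seq (pop 1) (pushList [1, 1, 0, 0])) (.seq (pop 1) (pushList [1, 0])))).RunLe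
      (store [] o ((tlist (r.map tbool)).code ++ [2])
        (l.reverse.map fun x => if x then 1 else 0) b c)
      (store [] o ((tlist ((l ++ r).map tbool)).code ++ [2]) [] b c) (9 * l.length + 1) := by
    intro l
    induction l using List.reverseRecOn with
    | nil => exact fun r => .loop_false rfl
    | append_singleton l x ih =>
      intro r
      have h := ih (x :: r)
      simp only [List.reverse_append, List.reverse_cons, List.reverse_nil, List.nil_append,
        List.singleton_append, List.map_cons, List.append_assoc, List.length_append,
        List.length_singleton]
      refine (StackProg.RunLe.loop_true rfl (s₂ := store [] o ((tlist ((x :: r).map tbool)).code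
        ++ [2]) (l.reverse.map fun x => if x then 1 else 0) b c) (m₁ := 8) ?_ h).mono (by omega)
      cases x with
      | true =>
        exact (StackProg.RunLe.ite_true rfl (((runLe_pop_one 1).seq
          (runLe_pushList [1, 1, 0, 0])).cast rfl)).mono (by simp)
      | false =>
        exact (StackProg.RunLe.ite_false rfl (((runLe_pop_one 0).seq
          (runLe_pushList [1, 0])).cast rfl)).mono (by simp)
  have h₃ := h₂ l []
  simp only [List.append_nil, List.map_reverse] at h₃
  have h₄ := h₁ l []
  simp only [List.append_nil] at h₄
  exact (h₄.seq ((runLe_push_zero 2).seq ((runLe_push_zero 0).seq h₃))).mono (by omega)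

theorem runLe_outputProg (w : Symb → Γ) (l : List Symb) :
    (outputProg w).RunLe (store i [] ((tlist (l.map tsymb)).code ++ [2]) [] b c)
      (store i (l.map w) [] [] b c) (14 * l.length + 4) := by
  have h₁ : ∀ (l a : List Symb), (StackProg.loop (.int 0) (topIs 1)
      (.seq (pop 0) <| ifTop 0 0 (.seq (pop 0) (push 1 0)) <|
      .seq (pop 0) <| .seq (pop 0) <| ifTop 0 0 (.seq (pop 0) (push 1 1)) <|
      .seq (pop 0) <| .seq (pop 0) <| .seq (pop 0) (push 1 2))).RunLe
      (store i ([] : List Γ) ((tlist (l.map tsymb)).code ++ [2]) a b c)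
      (store i [] [0, 2] (l.reverse ++ a) b c) (12 * l.length + 1) := by
    intro l
    induction l with
    | nil => exact fun a => .loop_false rfl
    | cons x l ih =>
      intro a
      have h := ih (x :: a)
      simp only [List.reverse_cons, List.append_assoc, List.singleton_append]
      refine (StackProg.RunLe.loop_true rfl (s₂ := store i [] ((tlist (l.map tsymb)).code ++ [2])
        (x :: a) b c) (m₁ := 9) ?_ h).mono (by simp; omega)
      refine (StackProg.RunLe.seq (m₂ := 8) ((runLe_pop_zero 1).cast rfl) ?_)
      have hx : x = 0 ∨ x = 1 ∨ x = 2 := by fin_cases x <;> simp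
      rcases hx with rfl | rfl | rfl
      · exact (StackProg.RunLe.ite_true rfl ((runLe_pop_zero 0).seq (runLe_push_one 0))).mono
          (by omega)
      · exact (StackProg.RunLe.ite_false rfl ((runLe_pop_zero 1).seq ((runLe_pop_zero 0).seq
          (.ite_true rfl ((runLe_pop_zero 0).seq (runLe_push_one 1)))))).mono (by omega)
      · exact (StackProg.RunLe.ite_false rfl ((runLe_pop_zero 1).seq ((runLe_pop_zero 0).seq
          (.ite_false rfl ((runLe_pop_zero 1).seq ((runLe_pop_zero 0).seq ((runLe_pop_zero 0).seq
            (runLe_push_one 2)))))))).mono (by omega)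
  have h₂ : ∀ (l : List Symb) (o : List Γ), (StackProg.loop (.int 1) Option.isSome
      (.op (.mv (.int 1) .out (fun x => x) (fun x => w (x.getD 0))))).RunLe
      (store i o [] l b c) (store i (l.reverse.map w ++ o) [] [] b c) (2 * l.length + 1) := by
    intro l
    induction l with
    | nil => exact fun a => .loop_false rfl
    | cons x l ih =>
      intro o
      refine (StackProg.RunLe.loop_true rfl (.op (s' := store i (w x :: o) [] l b c)
        (by simp [StackOp.sem])) ((ih _).cast ?_)).mono (by simp; omega)
      simp
  have h₃ := h₁ l []
  have h₄ := h₂ l.reverse []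
  simp only [List.append_nil, List.reverse_reverse, List.length_reverse] at h₃ h₄
  exact (h₃.seq ((runLe_pop_zero 0).seq ((runLe_pop_zero 2).seq h₄))).mono (by omega)

/-- The Turing machine that computes a function given by a tree program. -/
def Fn.machine (Γ : Type) (w : Symb → Γ) (p : Fn) : Turing.TM2ComputableAux Bool Γ :=
  let q : StackProg (Alph Γ) := .seq inputProg (.seq p.prog (outputProg w))
  { tm :=
      { K := Stk
        kFin := Fintype.ofFinite Stk
        k₀ := .inp
        k₁ := .out
        Γ := Alph Γ
        Λ := Option q.Label
        main := some q.entry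
        ΛFin := Fintype.ofFinite _
        σ := Option Symb
        initialState := none
        Γk₀Fin := inferInstanceAs (Fintype Bool)
        m := q.machine }
    inputAlphabet := Equiv.refl Bool
    outputAlphabet := Equiv.refl Γ }

theorem Fn.finite_machine [Finite Γ] (w : Symb → Γ) (p : Fn) (k : Stk) :
    Finite ((p.machine Γ w).tm.Γ k) := by
  cases k
  exacts [inferInstanceAs (Finite Bool), inferInstanceAs (Finite Γ), inferInstanceAs (Finite Symb)]

theorem Fn.Eval.outputsWithin {w : Symb → Γ} {p : Fn} {l : List Bool} {y : List Symb} {n : ℕ}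
    (h : p.Eval (tlist (l.map tbool)) (tlist (y.map tsymb)) n) :
    OutputsWithin (p.machine Γ w) l (y.map w) (12 * l.length + n + 14 * y.length + 9) := by
  have hrun : (StackProg.seq inputProg (.seq p.prog (outputProg w))).RunLe
      (store l [] [] [] [] []) (store [] (y.map w) [] [] [] []) _ :=
    (runLe_inputProg l).seq ((h.runLe []).seq (runLe_outputProg w y))
  obtain ⟨s, hs, hr⟩ := hrun
  have hsteps := hr.machine_steps
  unfold Steps at hsteps
  have hle : s + 1 ≤ 12 * l.length + n + 14 * y.length + 9 := by omega
  refine ⟨⟨⟨s + 1, Eq.trans ?_ (hsteps.trans ?_)⟩, hle⟩⟩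
  · congr 2
    show Turing.TM2.Cfg.mk _ _ _ = Turing.TM2.Cfg.mk _ _ _
    congr 1
    refine store_ext ?_ ?_ fun j => ?_
    · exact List.map_id _
    · rfl
    · fin_cases j <;> rfl
  · show some (Turing.TM2.Cfg.mk _ _ _) = some (Turing.TM2.Cfg.mk _ _ _)
    congr 2
    refine store_ext ?_ ?_ fun j => ?_
    · rfl
    · exact (List.map_id _).symm
    · fin_cases j <;> rfl

end

/-! ### Binary arithmetic -/

/-- The tree that represents a natural number in binary: the list of its binary digits, the least
significant one first, without leading zeros. -/
def tbits (n : ℕ) : Tree := tlist (n.bits.map tbool)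

theorem foldr_bit_bits (n : ℕ) : n.bits.foldr Nat.bit 0 = n := by
  induction n using Nat.binaryRec' with
  | zero => simp
  | bit b n h ih => rw [Nat.bits_append_bit n b h, List.foldr_cons, ih]

theorem foldr_bit_testBit (n N : ℕ) :
    ((List.range N).map n.testBit).foldr Nat.bit 0 = n % 2 ^ N := by
  induction N generalizing n with
  | zero => simp [Nat.mod_one]
  | succ N ih =>
    have h := ih (n / 2)
    simp only [List.range_succ_eq_map, List.map_cons, List.map_map, List.foldr_cons]
    have e : n.testBit ∘ Nat.succ = (n / 2).testBit := by
      funext i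
      simp [Nat.testBit_succ]
    rw [e, h, pow_succ', Nat.mod_mul, Nat.testBit_zero, Nat.bit_val]
    rcases Nat.mod_two_eq_zero_or_one n with h | h
    · simp [h]
    · simp [h]
      omega

theorem size_tbits_le (n : ℕ) : (tbits n).size ≤ 4 * n.size + 1 := by
  refine (size_tlist_le (m := 3) fun t ht => ?_).trans ?_
  · obtain ⟨b, -, rfl⟩ := List.mem_map.1 ht
    exact size_tbool_le b
  · rw [List.length_map, Nat.size_eq_bits_len]
    omega

theorem natSize_le_size_tbits (n : ℕ) : n.size ≤ (tbits n).size := by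
  simpa [Nat.size_eq_bits_len, tbits] using length_le_size_tlist (n.bits.map tbool)

theorem natSize_mul_le (a b : ℕ) : (a * b).size ≤ a.size + b.size := by
  rw [Nat.size_le, pow_add]
  exact Nat.mul_lt_mul'' a.lt_size_self b.lt_size_self

theorem natSize_add_le (a b : ℕ) : (a + b).size ≤ a.size + b.size + 1 := by
  rw [Nat.size_le, pow_succ, pow_add]
  have := a.lt_size_self
  have := b.lt_size_self
  have := Nat.one_le_two_pow (n := a.size)
  have := Nat.one_le_two_pow (n := b.size)
  nlinarith

theorem natSize_pow_le (a k : ℕ) : (a ^ k).size ≤ k * a.size + 1 := by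
  rw [Nat.size_le, pow_succ, mul_comm k, pow_mul]
  have := Nat.pow_le_pow_left a.lt_size_self.le k
  have := Nat.one_le_two_pow (n := a.size * k)
  rw [pow_mul] at this
  omega

/-- The carry into position `i` in the addition of `a` and `b`. -/
def carry (a b i : ℕ) : Bool := decide ((a + b) / 2 ^ i = a / 2 ^ i + b / 2 ^ i + 1)

theorem add_div_two_pow (a b i : ℕ) :
    (a + b) / 2 ^ i = a / 2 ^ i + b / 2 ^ i + (carry a b i).toNat := by
  have h : (a + b) / 2 ^ i = a / 2 ^ i + b / 2 ^ i ∨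
      (a + b) / 2 ^ i = a / 2 ^ i + b / 2 ^ i + 1 := by
    induction i with
    | zero => simp
    | succ i ih =>
      simp only [pow_succ, ← Nat.div_div_eq_div_mul]
      omega
  rcases h with h | h <;> simp [carry, h]

theorem testBit_add_carry (a b i : ℕ) :
    (a + b).testBit i = ((a.testBit i ^^ b.testBit i) ^^ carry a b i) := by
  have h := add_div_two_pow a b i
  simp only [Nat.testBit_eq_decide_div_mod_eq, h]
  rcases Nat.mod_two_eq_zero_or_one (a / 2 ^ i) with h₁ | h₁ <;>
  rcases Nat.mod_two_eq_zero_or_one (b / 2 ^ i) with h₂ | h₂ <;>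
  cases carry a b i <;> simp [h₁, h₂, Nat.add_mod]

theorem carry_succ (a b i : ℕ) :
    carry a b (i + 1) = ((a.testBit i && b.testBit i) ||
      (carry a b i && (a.testBit i || b.testBit i))) := by
  have h := add_div_two_pow a b i
  have e : carry a b (i + 1) =
      decide ((a + b) / 2 ^ i / 2 = a / 2 ^ i / 2 + b / 2 ^ i / 2 + 1) := by
    simp only [carry, pow_succ, ← Nat.div_div_eq_div_mul]
  rw [e, h]
  simp only [Nat.testBit_eq_decide_div_mod_eq]
  rcases Nat.mod_two_eq_zero_or_one (a / 2 ^ i) with h₁ | h₁ <;>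
  rcases Nat.mod_two_eq_zero_or_one (b / 2 ^ i) with h₂ | h₂ <;>
  cases carry a b i <;> simp [h₁, h₂] <;> omega

namespace Poly

variable {X : Type} {c : X → Tree} {f g N : X → ℕ}

theorem xor {b b' : X → Bool} (hb : Poly c fun x => tbool (b x))
    (hb' : Poly c fun x => tbool (b' x)) : Poly c fun x => tbool (b x ^^ b' x) :=
  (cond hb hb'.not hb').of_eq fun x => by cases b x <;> simp

theorem bd_tbits (hf : Poly c fun x => tbits (f x)) : PolyBd c fun x => (f x).size :=
  hf.bd.of_le fun x => natSize_le_size_tbits (f x)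

theorem testBit {i : X → ℕ} (hf : Poly c fun x => tbits (f x)) (hi : Poly c fun x => unary (i x)) :
    Poly c fun x => tbool ((f x).testBit (i x)) :=
  (getD hf hi).of_eq fun x => by
    rw [Nat.testBit_eq_inth, List.getI, List.getD_eq_getElem?_getD, List.getD_eq_getElem?_getD,
      List.getElem?_map]
    cases (f x).bits[i x]? <;> rfl

theorem length {l : X → List Tree} (hl : Poly c fun x => tlist (l x)) :
    Poly c fun x => unary (l x).length :=
  (map (E := fun _ => Tree) (ℓ := l) (eE := fun _ t => t) (F := fun _ _ => .nil)
    (hl.of_eq fun x => by simp) (const _)).of_eq fun x => by simp [unary]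

theorem natSize (hf : Poly c fun x => tbits (f x)) : Poly c fun x => unary (f x).size :=
  (length hf).of_eq fun x => by rw [List.length_map, Nat.size_eq_bits_len]

/-- Prepending a binary digit. -/
theorem bit {b : X → Bool} (hb : Poly c fun x => tbool (b x)) (hf : Poly c fun x => tbits (f x)) :
    Poly c fun x => tbits (Nat.bit (b x) (f x)) := by
  have h0 : Poly c fun x => tbool (decide (f x ≠ 0)) := hf.tbool_of_tree fun x => by
    rw [decide_eq_false_iff_not, not_not]
    constructor
    · intro h
      simp [h, tbits]
    · intro h
      rw [← foldr_bit_bits (f x)]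
      cases h' : (f x).bits with
      | nil => rfl
      | cons a l => simp [tbits, h'] at h
  refine (cond (hb.or h0) (hb.cons hf) (const .nil)).of_eq fun x => ?_
  by_cases h : f x = 0
  · cases hb : b x <;> simp [h, tbits]
  · simp [h, tbits, Nat.bits_append_bit (f x) (b x) fun h' => absurd h' h]

theorem foldr_bit {l : X → List Bool} (hl : Poly c fun x => tlist ((l x).map tbool)) :
    Poly c fun x => tbits ((l x).foldr Nat.bit 0) := by
  have hle : ∀ (l : List Bool), l.foldr Nat.bit 0 < 2 ^ l.length := by
    intro l
    induction l with
    | nil => simp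
    | cons b l ih =>
      rw [List.foldr_cons, List.length_cons, pow_succ', Nat.bit_val]
      cases b <;> simp <;> omega
  refine (foldl (E := fun _ => Bool) (ℓ := fun x => (l x).reverse) (eE := fun _ => tbool)
    (S := fun _ => ℕ) (eS := fun _ => tbits) (init := fun _ => 0)
    (step := fun _ n b => Nat.bit b n) (hl.reverse.of_eq fun x => by simp) (const (tbits 0))
    (bit Poly.id.right.right Poly.id.right.left)
    (((PolyBd.const 4).mul hl.bd).add (.const 1))
    fun x l' hl' => (size_tbits_le _).trans ?_).of_eq fun x => by rw [List.foldl_reverse]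
  have h₁ := hle l'.reverse
  rw [List.foldr_reverse, List.length_reverse, ← Nat.size_le] at h₁
  have h₂ := hl'.length_le
  have h₃ := length_le_size_tlist ((l x).map tbool)
  simp at h₂ h₃
  omega

/-- A number is computable if its digits are. -/
theorem ofDigits (hN : Poly c fun x => unary (N x))
    (hf : Poly (fun z : Σ x, Fin (N x) => .cons (c z.1) (unary z.2))
      fun z => tbool ((f z.1).testBit z.2)) : Poly c fun x => tbits (f x % 2 ^ N x) := by
  refine (foldr_bit (l := fun x => (List.range (N x)).map (f x).testBit)
    ((tab (F := fun x i => tbool ((f x).testBit i.val)) hN hf).of_eq fun x => ?_)).of_eq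
      fun x => by rw [foldr_bit_testBit]
  rw [List.ofFn_eq_map, ← List.map_coe_finRange_eq_range, List.map_map, List.map_map]
  rfl

theorem addBits (hf : Poly c fun x => tbits (f x)) (hg : Poly c fun x => tbits (g x)) :
    Poly c fun x => tbits (f x + g x) := by
  have key : ∀ i : ℕ, (fun n => n + 1)^[i] 0 = i := by
    intro i
    induction i with
    | zero => rfl
    | succ i ih => rw [Function.iterate_succ_apply', ih]
  let eS : X → ℕ → Tree := fun x i => .cons (unary i) (.cons (tbool (carry (f x) (g x) i))
    (tlist (((List.range i).map fun j => tbool ((f x + g x).testBit j)).reverse)))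
  let cS : (Σ _ : X, ℕ) → Tree := fun z => .cons (c z.1) (eS z.1 z.2)
  have hid : Poly cS fun z => .cons (c z.1) (eS z.1 z.2) := .id
  have hi : Poly cS fun z => unary z.2 := hid.right.left
  have hc : Poly cS fun z => tbool (carry (f z.1) (g z.1) z.2) := hid.right.right.left
  have hl := hid.right.right.right
  have ha : Poly cS fun z => tbool ((f z.1).testBit z.2) :=
    (testBit (hid.left.trans (hf.precomp Sigma.fst)) hi)
  have hb : Poly cS fun z => tbool ((g z.1).testBit z.2) :=
    (testBit (hid.left.trans (hg.precomp Sigma.fst)) hi)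
  have hstep : Poly cS fun z => eS z.1 (z.2 + 1) := by
    refine (hi.succ.cons (((ha.and hb).or (hc.and (ha.or hb))).cons
      (((ha.xor hb).xor hc).cons hl))).of_eq fun z => ?_
    simp only [eS, carry_succ, List.range_succ, List.map_append, List.reverse_append,
      List.map_cons, List.map_nil, List.reverse_cons, List.reverse_nil, List.nil_append,
      List.singleton_append, tlist_cons, testBit_add_carry]
  have hsz := hf.natSize.add hg.natSize
  have h := iterate (S := fun _ => ℕ) (eS := eS) (init := fun _ => 0) (step := fun _ n => n + 1)
    (N := fun x => (f x).size + (g x).size + 1) hsz.succ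
    ((const (.cons .nil (.cons .nil .nil))).of_eq fun x => ?_)
    hstep (B := fun x => 6 * ((f x).size + (g x).size + 1) + 7) ?_ fun x i hi => ?_
  · refine (foldr_bit (l := fun x => (List.range ((f x).size + (g x).size + 1)).map
      (f x + g x).testBit) (h.right.right.reverse.of_eq fun x => ?_)).of_eq fun x => ?_
    · rw [key, List.reverse_reverse, List.map_map]
      rfl
    · rw [foldr_bit_testBit, Nat.mod_eq_of_lt]
      rw [← Nat.size_le]
      exact natSize_add_le _ _
  · simp [eS, carry, tbool]
  · exact ((PolyBd.const 6).mul (hsz.succ.bd_unary)).add (.const 7)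
  · rw [key]
    have h₁ : (tlist (((List.range i).map
        fun j => tbool ((f x + g x).testBit j)).reverse)).size ≤ i * (3 + 1) + 1 := by
      refine (size_tlist_le (m := 3) fun t ht => ?_).trans (by simp)
      obtain ⟨b, -, rfl⟩ := List.mem_map.1 (List.mem_reverse.1 ht)
      exact size_tbool_le _
    have h₂ := size_tbool_le (carry (f x) (g x) i)
    simp only [eS, Tree.size, size_unary]
    omega

theorem mulBits (hf : Poly c fun x => tbits (f x)) (hg : Poly c fun x => tbits (g x)) :
    Poly c fun x => tbits (f x * g x) := by
  have hval : ∀ (l : List Bool) (b : ℕ),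
      l.foldr (fun e n => Nat.bit false n + bif e then b else 0) 0 = l.foldr Nat.bit 0 * b := by
    intro l b
    induction l with
    | nil => simp
    | cons e l ih =>
      rw [List.foldr_cons, ih, List.foldr_cons, Nat.bit_val, Nat.bit_val]
      cases e <;> simp <;> ring
  have hle : ∀ (t s : List Bool), s.foldr Nat.bit 0 ≤ (t ++ s).foldr Nat.bit 0 := by
    intro t s
    induction t with
    | nil => simp
    | cons e t ih =>
      refine ih.trans ?_
      rw [List.cons_append, List.foldr_cons, Nat.bit_val]
      omega
  refine (foldl (E := fun _ => Bool) (ℓ := fun x => (f x).bits.reverse) (eE := fun _ => tbool)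
    (S := fun _ => ℕ) (eS := fun _ => tbits) (init := fun _ => 0)
    (step := fun x n e => Nat.bit false n + bif e then g x else 0)
    (hf.reverse.of_eq fun x => by simp) (const (tbits 0))
    (addBits (bit (const (tbool false)) Poly.id.right.left) ((cond Poly.id.right.right
      (Poly.id.left.trans (hg.precomp fun z : Σ _, ℕ × Bool => z.1)) (const (tbits 0))).of_eq
      fun z => by cases z.2.2 <;> rfl))
    (((PolyBd.const 4).mul (hf.bd_tbits.add hg.bd_tbits)).add (.const 1))
    fun x l' hl' => (size_tbits_le _).trans ?_).of_eq fun x => ?_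
  · obtain ⟨r, hr⟩ := hl'
    have hr' : r.reverse ++ l'.reverse = (f x).bits := by
      rw [← List.reverse_append, hr, List.reverse_reverse]
    have h₁ := hle r.reverse l'.reverse
    rw [hr', foldr_bit_bits] at h₁
    have h₂ := hval l'.reverse (g x)
    rw [List.foldr_reverse] at h₂
    rw [h₂]
    have := (Nat.size_le_size (Nat.mul_le_mul_right (g x) h₁)).trans (natSize_mul_le _ _)
    omega
  · rw [List.foldl_reverse, hval, foldr_bit_bits]

theorem powBits {k : X → ℕ} (hf : Poly c fun x => tbits (f x)) (hk : Poly c fun x => unary (k x)) :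
    Poly c fun x => tbits (f x ^ k x) := by
  have key : ∀ m i : ℕ, (fun n => n * m)^[i] 1 = m ^ i := by
    intro n i
    induction i with
    | zero => rfl
    | succ i ih => rw [Function.iterate_succ_apply', ih]; ring
  refine (iterate (S := fun _ => ℕ) (eS := fun _ => tbits) (init := fun _ => 1)
    (step := fun x n => n * f x) hk (const (tbits 1))
    (mulBits Poly.id.right (Poly.id.left.trans (hf.precomp fun z : Σ _, ℕ => z.1)))
    (((PolyBd.const 4).mul ((hk.bd_unary.mul hf.bd_tbits).add (.const 1))).add (.const 1))
    fun x i hi => (size_tbits_le _).trans ?_).of_eq fun x => by rw [key]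
  rw [key]
  have := natSize_pow_le (f x) i
  have := Nat.mul_le_mul_right (f x).size hi
  omega

/-- Conversion from unary to binary. -/
theorem unaryToBits (hN : Poly c fun x => unary (N x)) : Poly c fun x => tbits (N x) := by
  have key : ∀ i : ℕ, (fun n => n + 1)^[i] 0 = i := by
    intro i
    induction i with
    | zero => rfl
    | succ i ih => rw [Function.iterate_succ_apply', ih]
  refine (iterate (S := fun _ => ℕ) (eS := fun _ => tbits) (init := fun _ => 0)
    (step := fun x n => n + 1) hN (const (tbits 0)) (addBits Poly.id.right (const (tbits 1)))
    (((PolyBd.const 4).mul hN.bd_unary).add (.const 1))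
    fun x i hi => (size_tbits_le _).trans ?_).of_eq fun x => by rw [key]
  rw [key]
  have : i.size ≤ i := Nat.size_le.2 Nat.lt_two_pow_self
  omega

end Poly

/-- The binary encoding of Mathlib lists the binary digits. -/
theorem encodeNat_eq_bits (n : ℕ) : Computability.encodeNat n = n.bits := by
  have h : ∀ p : PosNum, Computability.encodePosNum p = (p : ℕ).bits := by
    intro p
    induction p with
    | one => simp [Computability.encodePosNum]
    | bit0 p ih =>
      rw [Computability.encodePosNum, ih, PosNum.cast_bit0, ← two_mul, Nat.bit0_bits]
      exact (PosNum.cast_pos p).ne'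
    | bit1 p ih =>
      rw [Computability.encodePosNum, ih, PosNum.cast_bit1, ← two_mul, Nat.bit1_bits]
  have h' : ∀ k : Num, Computability.encodeNum k = (k : ℕ).bits := by
    rintro (_ | p)
    · simp [Computability.encodeNum]
    · exact h p
  rw [Computability.encodeNat, h', Num.to_of_nat]

/-! ### The branching algorithm -/

/-- The state of a vertex during the algorithm: whether it is open, that is, still to be coloured,
whether it belongs to the frontier, whether it has received a marked colour, and the list of the
colours it may still receive. The last two components are relevant only for closed and for open
vertices, respectively. -/
abbrev VState (h : ℕ) := Bool × Bool × Bool × Finset (Fin h)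

namespace VState

variable {h : ℕ}

/-- The vertex is still to be coloured. -/
def op (s : VState h) : Bool := s.1

/-- The vertex belongs to the frontier. -/
def fr (s : VState h) : Bool := s.2.1

/-- The vertex has received a marked colour. -/
def marked (s : VState h) : Bool := s.2.2.1

/-- The colours the vertex may still receive. -/
def cols (s : VState h) : Finset (Fin h) := s.2.2.2

end VState

/-- The data that stay fixed during the algorithm: the number of vertices, the adjacency relation,
the degree threshold of the first phase, and the weight of the marked colours. -/
structure Ctx where
  n : ℕ
  A : Fin n → Fin n → Bool
  d : ℕ
  B : ℕ

/-- A subproblem. -/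
abbrev Inst (h n : ℕ) := Fin n → VState h

/-- Subproblems are either solved directly or reduced to two other ones, whose results have to be
added or multiplied. -/
inductive Node (h n : ℕ)
  | leaf (v : ℕ)
  | add (I J : Inst h n)
  | mul (I J : Inst h n)

/-- The colour graph: a relation on the colours and the set of marked colours. -/
structure Palette (h : ℕ) where
  R : Fin h → Fin h → Bool
  marked : Fin h → Bool

namespace Palette

variable {h : ℕ} (P : Palette h)

/-- The colours that are compatible with the colour `a`. -/
def nbhd (a : Fin h) : Finset (Fin h) := Finset.univ.filter fun b => P.R a b = true

variable (C : Ctx) (I : Inst h C.n)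

/-- The number of open neighbours of `v` that lose a colour if `v` receives the colour `a`. -/
def defect (v : Fin C.n) (a : Fin h) : ℕ :=
  (Finset.univ.filter fun w =>
    (C.A v w && ((I w).op && !decide ((I w).cols ⊆ P.nbhd a))) = true).card

/-- Whether there is a frontier. This distinguishes the two phases of the algorithm. -/
def hasFrontier {n : ℕ} (I : Inst h n) : Bool := decide (∃ v, (I v).fr = true)

/-- Whether the algorithm may branch on the colour `a` of `v`. In the second phase it branches on
the vertices of the frontier; in the first one, it branches if `a` is the only colour left or if the
colour `a` at `v` affects at least `C.d` neighbours. -/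
def cand (v : Fin C.n) (a : Fin h) : Bool :=
  ((I v).op && decide (a ∈ (I v).cols)) && bif hasFrontier I then (I v).fr else
    (decide ((I v).cols.card = 1) || decide (C.d ≤ P.defect C I v a))

/-- The first vertex on which the algorithm may branch. -/
def pickVertex : Option (Fin C.n) :=
  (List.finRange C.n).find? fun v => decide (∃ a, P.cand C I v a = true)

/-- The first colour on which the algorithm may branch at a given vertex. -/
def pickColour (v : Fin C.n) : Option (Fin h) := (List.finRange h).find? (P.cand C I v)

/-- Give the colour `a` to `v`, and restrict the lists of the neighbours accordingly. -/
def assign (v : Fin C.n) (a : Fin h) : Inst h C.n := fun w =>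
  bif decide (w = v) then (false, (I w).fr, P.marked a, (I w).cols)
  else bif C.A v w then ((I w).op, (I w).fr, (I w).marked, (I w).cols ∩ P.nbhd a) else I w

end Palette

section

variable {h : ℕ} (C : Ctx) (I : Inst h C.n)

/-- Forbid the colour `a` at `v`. -/
def forbid {n : ℕ} (I : Inst h n) (v : Fin n) (a : Fin h) : Inst h n := fun w =>
  bif decide (w = v) then ((I w).op, (I w).fr, (I w).marked, (I w).cols.erase a) else I w

/-- Add the open neighbours of a set of vertices to this set. -/
def grow (S : Fin C.n → Bool) : Fin C.n → Bool := fun w =>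
  S w || ((I w).op && decide (∃ z, (C.A z w && S z) = true))

/-- The component of `x` in the graph of the open vertices. -/
def component (x : Fin C.n) : Fin C.n → Bool := (grow C I)^[C.n] fun w => decide (w = x)

/-- The first vertex of the frontier with a neighbour in `S`. -/
def nextPivot (S : Fin C.n → Bool) : Option (Fin C.n) :=
  (List.finRange C.n).find? fun q => (I q).fr && decide (∃ w, (C.A q w && S w) = true)

/-- The new frontier when the algorithm descends into the component `S` of `x`: the neighbours in
`S` of some vertex of the old frontier, and `x` if there is no such vertex. -/
def newFrontier (S : Fin C.n → Bool) (x : Fin C.n) : Fin C.n → Bool :=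
  match nextPivot C I S with
  | some q => fun w => C.A q w && S w
  | none => fun w => decide (w = x)

/-- The subproblem on a component `S` of the open vertices. -/
def inner (S : Fin C.n → Bool) (x : Fin C.n) : Inst h C.n := fun w =>
  (S w, newFrontier C I S x w, false, (I w).cols)

/-- The subproblem that remains when a component `S` of the open vertices is left out. -/
def outer {n : ℕ} (I : Inst h n) (S : Fin n → Bool) : Inst h n := fun w =>
  bif S w then (false, (I w).fr, false, (I w).cols) else I w

/-- The first open vertex. -/
def firstOpen {n : ℕ} (I : Inst h n) : Option (Fin n) := (List.finRange n).find? fun v => (I v).op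

/-- Whether some open vertex has no colour left. -/
def isDead {n : ℕ} (I : Inst h n) : Bool :=
  decide (∃ v, ((I v).op && decide ((I v).cols = ∅)) = true)

/-- The number of vertices with a marked colour. -/
def markCount {n : ℕ} (I : Inst h n) : ℕ :=
  (Finset.univ.filter fun v => (!(I v).op && (I v).marked) = true).card

/-- One step of the recursion: how to reduce a subproblem. -/
def Palette.expand (P : Palette h) : Node h C.n :=
  if isDead I then .leaf 0 else
  match P.pickVertex C I with
  | some v =>
    match P.pickColour C I v with
    | some a => .add (P.assign C I v a) (forbid I v a)
    | none => .leaf 0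
  | none =>
    match firstOpen I with
    | some x => .mul (inner C I (component C I x) x) (outer I (component C I x))
    | none => .leaf (C.B ^ markCount I)

section

variable {C I} {P : Palette h}

theorem Palette.expand_dead (h₁ : isDead I = true) : P.expand C I = .leaf 0 := by
  simp [expand, h₁]

theorem Palette.expand_none {v : Fin C.n} (h₁ : isDead I = false)
    (h₂ : P.pickVertex C I = some v) (h₃ : P.pickColour C I v = none) :
    P.expand C I = .leaf 0 := by
  simp [expand, h₁, h₂, h₃]

theorem Palette.expand_add {v : Fin C.n} {a : Fin h} (h₁ : isDead I = false)
    (h₂ : P.pickVertex C I = some v) (h₃ : P.pickColour C I v = some a) :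
    P.expand C I = .add (P.assign C I v a) (forbid I v a) := by
  simp [expand, h₁, h₂, h₃]

theorem Palette.expand_mul {x : Fin C.n} (h₁ : isDead I = false) (h₂ : P.pickVertex C I = none)
    (h₃ : firstOpen I = some x) :
    P.expand C I = .mul (inner C I (component C I x) x) (outer I (component C I x)) := by
  simp [expand, h₁, h₂, h₃]

theorem Palette.expand_closed (h₁ : isDead I = false) (h₂ : P.pickVertex C I = none)
    (h₃ : firstOpen I = none) : P.expand C I = .leaf (C.B ^ markCount I) := by
  simp [expand, h₁, h₂, h₃]

end

end

/-- A task of the stack machine that organizes the recursion: solve a subproblem, or add or multiply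
the two topmost results. -/
inductive Task (h n : ℕ)
  | inst (I : Inst h n)
  | add
  | mul

/-- Whether the task is to solve a subproblem. -/
def Task.isInst {h n : ℕ} : Task h n → Bool
  | .inst _ => true
  | _ => false

/-- Whether the task is a multiplication. -/
def Task.isMul {h n : ℕ} : Task h n → Bool
  | .mul => true
  | _ => false

/-- A configuration of the stack machine: a stack of tasks and a stack of results. -/
structure Config (h : ℕ) where
  C : Ctx
  tasks : List (Task h C.n)
  vals : List ℕ

/-- Replace a subproblem by the tasks to which it is reduced. -/
def Node.push {h : ℕ} (C : Ctx) (ts : List (Task h C.n)) (vs : List ℕ) : Node h C.n → Config h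
  | .leaf v => ⟨C, ts, v :: vs⟩
  | .add I J => ⟨C, .inst I :: .inst J :: .add :: ts, vs⟩
  | .mul I J => ⟨C, .inst I :: .inst J :: .mul :: ts, vs⟩

/-- Perform the first task. -/
def Palette.step {h : ℕ} (P : Palette h) : Config h → Config h
  | ⟨C, [], vs⟩ => ⟨C, [], vs⟩
  | ⟨C, .inst I :: ts, vs⟩ => (P.expand C I).push C ts vs
  | ⟨C, .add :: ts, vs⟩ => ⟨C, ts, (vs.getD 0 0 + vs.getD 1 0) :: vs.drop 2⟩
  | ⟨C, .mul :: ts, vs⟩ => ⟨C, ts, (vs.getD 0 0 * vs.getD 1 0) :: vs.drop 2⟩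

section

variable {h : ℕ} (P : Palette h) {x : Config h} {ts : List (Task h x.C.n)}

theorem Palette.step_nil (hx : x.tasks = []) : P.step x = x := by
  obtain ⟨C, _, vs⟩ := x
  dsimp only at hx
  subst hx
  rfl

theorem Palette.step_inst {I : Inst h x.C.n} (hx : x.tasks = .inst I :: ts) :
    P.step x = (P.expand x.C I).push x.C ts x.vals := by
  obtain ⟨C, _, vs⟩ := x
  dsimp only at ts I hx
  subst hx
  rfl

theorem Palette.step_add (hx : x.tasks = .add :: ts) :
    P.step x = ⟨x.C, ts, (x.vals.getD 0 0 + x.vals.getD 1 0) :: x.vals.drop 2⟩ := by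
  obtain ⟨C, _, vs⟩ := x
  dsimp only at ts hx
  subst hx
  rfl

theorem Palette.step_mul (hx : x.tasks = .mul :: ts) :
    P.step x = ⟨x.C, ts, (x.vals.getD 0 0 * x.vals.getD 1 0) :: x.vals.drop 2⟩ := by
  obtain ⟨C, _, vs⟩ := x
  dsimp only at ts hx
  subst hx
  rfl

end

/-! ### The algorithm takes polynomial time per step -/

/-- The tree that represents the state of a vertex. -/
def tstate {h : ℕ} (s : VState h) : Tree := unary (Fintype.equivFin (VState h) s).val

/-- The tree that represents a subproblem. -/
def tinst {h n : ℕ} (I : Inst h n) : Tree := tlist (List.ofFn fun v => tstate (I v))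

/-- The tree that represents a set of vertices. -/
def tset {n : ℕ} (S : Fin n → Bool) : Tree := tlist (List.ofFn fun v => tbool (S v))

/-- The tree that represents the fixed data. -/
def tctx (C : Ctx) : Tree :=
  .cons (unary C.n) (.cons (tlist (List.ofFn fun v => tset (C.A v)))
    (.cons (unary C.d) (tbits C.B)))

/-- The tree that represents a task. -/
def ttask {h n : ℕ} : Task h n → Tree
  | .inst I => .cons (unary 2) (tinst I)
  | .add => .cons (unary 0) .nil
  | .mul => .cons (unary 1) .nil

/-- The tree that represents a configuration. -/
def tconfig {h : ℕ} (x : Config h) : Tree :=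
  .cons (tctx x.C) (.cons (tlist (x.tasks.map ttask)) (tlist (x.vals.map tbits)))

namespace Poly

section

variable {X : Type} {c : X → Tree}

/-- What can be computed from some data can be computed from more data. -/
theorem lift {E : X → Type} {e : ∀ x, E x → Tree} {f : X → Tree} (hf : Poly c f) :
    Poly (fun z : Σ x, E x => .cons (c z.1) (e z.1 z.2)) fun z => f z.1 :=
  Poly.id.left.trans (hf.precomp Sigma.fst)

/-- The index of a bounded quantifier can be computed. -/
theorem var {N : X → ℕ} :
    Poly (fun z : Σ x, Fin (N x) => .cons (c z.1) (unary z.2.val)) fun z => unary z.2.val :=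
  Poly.id.right

/-- What can be computed from the context of a bounded quantifier. -/
theorem liftFin {N : X → ℕ} {f : X → Tree} (hf : Poly c f) :
    Poly (fun z : Σ x, Fin (N x) => .cons (c z.1) (unary z.2.val)) fun z => f z.1 :=
  hf.lift (e := fun x (i : Fin (N x)) => unary i.val)

/-- Case distinction, where the cases may use that they are the case at hand. -/
theorem casesOn {b : X → Bool} {f : X → Tree} (hb : Poly c fun x => tbool (b x))
    (h : ∀ {Y : Type} (d : Y → Tree) (g : Y → X) (b' : Bool),
      (∀ {f' : X → Tree}, Poly c f' → Poly d fun y => f' (g y)) → (∀ y, b (g y) = b') →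
      Poly d fun y => f (g y)) : Poly c f :=
  hb.cases (h _ Subtype.val true (fun hf => hf.precomp _) fun y => y.2)
    (h _ Subtype.val false (fun hf => hf.precomp _) fun y => y.2)

/-- Distinguishing whether a search was successful. -/
theorem optionCases {N : X → ℕ} {o : ∀ x, Option (Fin (N x))} {f : X → Tree}
    (ho : Poly c fun x => topt (o x))
    (hnone : ∀ {Y : Type} (d : Y → Tree) (g : Y → X),
      (∀ {f' : X → Tree}, Poly c f' → Poly d fun y => f' (g y)) → (∀ y, o (g y) = none) →
      Poly d fun y => f (g y))
    (hsome : ∀ {Y : Type} (d : Y → Tree) (g : Y → X) (i : ∀ y, Fin (N (g y))),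
      (∀ {f' : X → Tree}, Poly c f' → Poly d fun y => f' (g y)) →
      (Poly d fun y => unary (i y).val) → (∀ y, o (g y) = some (i y)) →
      Poly d fun y => f (g y)) : Poly c f := by
  have hb : Poly c fun x => tbool (o x).isSome := ho.tbool_of_tree fun x => by
    cases o x <;> simp [topt]
  refine hb.cases ?_ ?_
  · refine hsome _ Subtype.val (fun y => (o y.1).get y.2) (fun hf => hf.precomp _) ?_ fun y => ?_
    · refine (ho.precomp Subtype.val).snd.of_eq fun x => ?_
      obtain ⟨x, hx⟩ := x
      obtain ⟨i, hi⟩ := Option.isSome_iff_exists.1 hx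
      simp [topt, hi]
    · simp
  · exact hnone _ Subtype.val (fun hf => hf.precomp _) fun y => by simpa using y.2

variable {h : ℕ} {C : X → Ctx} (hC : Poly c fun x => tctx (C x))

include hC in
theorem ctx_n : Poly c fun x => unary (C x).n := hC.left

include hC in
theorem ctx_d : Poly c fun x => unary (C x).d := hC.right.right.left

include hC in
theorem ctx_B : Poly c fun x => tbits (C x).B := hC.right.right.right

include hC in
theorem ctx_A {v w : ∀ x, Fin (C x).n} (hv : Poly c fun x => unary (v x))
    (hw : Poly c fun x => unary (w x)) : Poly c fun x => tbool ((C x).A (v x) (w x)) :=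
  get (F := fun x w => tbool ((C x).A (v x) w)) (get (F := fun x v => tset ((C x).A v))
    hC.right.left hv) hw

theorem mem_set {N : X → ℕ} {S : ∀ x, Fin (N x) → Bool} {v : ∀ x, Fin (N x)}
    (hS : Poly c fun x => tset (S x)) (hv : Poly c fun x => unary (v x)) :
    Poly c fun x => tbool (S x (v x)) :=
  get (F := fun x v => tbool (S x v)) hS hv

theorem eqFin {N : X → ℕ} {v w : ∀ x, Fin (N x)}
    (hv : Poly c fun x => unary (v x)) (hw : Poly c fun x => unary (w x)) :
    Poly c fun x => tbool (decide (v x = w x)) :=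
  (eq hv hw).of_eq fun x => by simp [Fin.ext_iff]

variable {N : X → ℕ} {I : ∀ x, Inst h (N x)} (hI : Poly c fun x => tinst (I x))

include hI in
/-- Any function of the state of a vertex. -/
theorem state {v : ∀ x, Fin (N x)} (hv : Poly c fun x => unary (v x)) (F : VState h → Tree) :
    Poly c fun x => F (I x (v x)) :=
  (finmap (get (F := fun x v => tstate (I x v)) hI hv)
    fun i => F ((Fintype.equivFin (VState h)).symm i)).of_eq fun x => by simp

include hI in
/-- Any function of the state of a vertex and a colour. -/
theorem state₂ {v : ∀ x, Fin (N x)} {a : X → Fin h} (hv : Poly c fun x => unary (v x))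
    (ha : Poly c fun x => unary (a x)) (F : VState h → Fin h → Tree) :
    Poly c fun x => F (I x (v x)) (a x) :=
  get (F := fun x a => F (I x (v x)) a) (state hI hv fun s => tlist (List.ofFn (F s))) ha

include hI in
theorem mkState {v : ∀ x, Fin (N x)} (hv : Poly c fun x => unary (v x)) {b₁ b₂ b₃ : X → Bool}
    (h₁ : Poly c fun x => tbool (b₁ x)) (h₂ : Poly c fun x => tbool (b₂ x))
    (h₃ : Poly c fun x => tbool (b₃ x)) :
    Poly c fun x => tstate (b₁ x, b₂ x, b₃ x, (I x (v x)).cols) := by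
  have hF : ∀ b₁ b₂ b₃, Poly c fun x => tstate (b₁, b₂, b₃, (I x (v x)).cols) := fun b₁ b₂ b₃ =>
    state hI hv fun s => tstate (b₁, b₂, b₃, s.cols)
  refine (cond h₁
    (cond h₂ (cond h₃ (hF true true true) (hF true true false))
      (cond h₃ (hF true false true) (hF true false false)))
    (cond h₂ (cond h₃ (hF false true true) (hF false true false))
      (cond h₃ (hF false false true) (hF false false false)))).of_eq fun x => ?_
  cases b₁ x <;> cases b₂ x <;> cases b₃ x <;> rfl

include hI in
theorem hasFrontier (hN : Poly c fun x => unary (N x)) :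
    Poly c fun x => tbool (Palette.hasFrontier (I x)) :=
  ex (q := fun x v => (I x v).fr) hN (state hI.liftFin var fun s => tbool s.fr)

include hI in
theorem isDead (hN : Poly c fun x => unary (N x)) :
    Poly c fun x => tbool (PathFreeColouring.isDead (I x)) :=
  ex (q := fun x v => ((I x v).op && decide ((I x v).cols = ∅))) hN
    (state hI.liftFin var fun s => tbool (s.op && decide (s.cols = ∅)))

include hI in
theorem firstOpen (hN : Poly c fun x => unary (N x)) :
    Poly c fun x => topt (PathFreeColouring.firstOpen (I x)) :=
  find (q := fun x v => (I x v).op) hN (state hI.liftFin var fun s => tbool s.op)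

include hI in
theorem markCount (hN : Poly c fun x => unary (N x)) :
    Poly c fun x => unary (PathFreeColouring.markCount (I x)) :=
  card (q := fun x v => (!(I x v).op && (I x v).marked)) hN
    (state hI.liftFin var fun s => tbool (!s.op && s.marked))

include hI in
theorem forbid (hN : Poly c fun x => unary (N x)) {v : ∀ x, Fin (N x)} {a : X → Fin h}
    (hv : Poly c fun x => unary (v x)) (ha : Poly c fun x => unary (a x)) :
    Poly c fun x => tinst (PathFreeColouring.forbid (I x) (v x) (a x)) :=
  tab (F := fun x w => tstate (PathFreeColouring.forbid (I x) (v x) (a x) w)) hN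
    ((cond (eqFin var hv.liftFin)
      (state₂ hI.liftFin var ha.liftFin
        fun s a => tstate (s.op, s.fr, s.marked, s.cols.erase a))
      (state hI.liftFin var tstate)).of_eq fun z => by
        unfold PathFreeColouring.forbid
        cases decide (z.2 = v z.1) <;> rfl)

include hI in
theorem outer (hN : Poly c fun x => unary (N x)) {S : ∀ x, Fin (N x) → Bool}
    (hS : Poly c fun x => tset (S x)) :
    Poly c fun x => tinst (PathFreeColouring.outer (I x) (S x)) :=
  tab (F := fun x w => tstate (PathFreeColouring.outer (I x) (S x) w)) hN
    ((cond (mem_set hS.liftFin var)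
      (state hI.liftFin var fun s => tstate (false, s.fr, false, s.cols))
      (state hI.liftFin var tstate)).of_eq fun z => by
        unfold PathFreeColouring.outer
        cases S z.1 z.2 <;> rfl)

end

section

variable {X : Type} {c : X → Tree} {h : ℕ} (P : Palette h) {C : X → Ctx}
  {I : ∀ x, Inst h (C x).n} (hC : Poly c fun x => tctx (C x)) (hI : Poly c fun x => tinst (I x))

include hC hI

theorem defect {v : ∀ x, Fin (C x).n} {a : X → Fin h} (hv : Poly c fun x => unary (v x))
    (ha : Poly c fun x => unary (a x)) :
    Poly c fun x => unary (P.defect (C x) (I x) (v x) (a x)) :=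
  card (q := fun x w => ((C x).A (v x) w && ((I x w).op && !decide ((I x w).cols ⊆ P.nbhd (a x)))))
    hC.ctx_n ((ctx_A hC.liftFin hv.liftFin var).and
      (state₂ hI.liftFin var ha.liftFin
        fun s a => tbool (s.op && !decide (s.cols ⊆ P.nbhd a))))

theorem cand {v : ∀ x, Fin (C x).n} {a : X → Fin h} (hv : Poly c fun x => unary (v x))
    (ha : Poly c fun x => unary (a x)) :
    Poly c fun x => tbool (P.cand (C x) (I x) (v x) (a x)) :=
  (state₂ hI hv ha fun s a => tbool (s.op && decide (a ∈ s.cols))).and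
    (tbool_cond (hI.hasFrontier hC.ctx_n) (state hI hv fun s => tbool s.fr)
      ((state hI hv fun s => tbool (decide (s.cols.card = 1))).or
        (le hC.ctx_d (defect P hC hI hv ha))))

theorem pickColour {v : ∀ x, Fin (C x).n} (hv : Poly c fun x => unary (v x)) :
    Poly c fun x => topt (P.pickColour (C x) (I x) (v x)) :=
  find (N := fun _ => h) (q := fun x => P.cand (C x) (I x) (v x)) (const (unary h))
    (cand P hC.liftFin hI.liftFin hv.liftFin var)

theorem exists_cand {v : ∀ x, Fin (C x).n} (hv : Poly c fun x => unary (v x)) :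
    Poly c fun x => tbool (decide (∃ a, P.cand (C x) (I x) (v x) a = true)) :=
  ex (N := fun _ => h) (q := fun x a => P.cand (C x) (I x) (v x) a) (const (unary h))
    (cand P hC.liftFin hI.liftFin hv.liftFin var)

theorem pickVertex : Poly c fun x => topt (P.pickVertex (C x) (I x)) :=
  find (q := fun x v => decide (∃ a, P.cand (C x) (I x) v a = true)) hC.ctx_n
    (exists_cand P hC.liftFin hI.liftFin var)

theorem assign {v : ∀ x, Fin (C x).n} {a : X → Fin h} (hv : Poly c fun x => unary (v x))
    (ha : Poly c fun x => unary (a x)) :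
    Poly c fun x => tinst (P.assign (C x) (I x) (v x) (a x)) :=
  tab (F := fun x w => tstate (P.assign (C x) (I x) (v x) (a x) w)) hC.ctx_n
    ((cond (eqFin var hv.liftFin)
      (state₂ hI.liftFin var ha.liftFin fun s a => tstate (false, s.fr, P.marked a, s.cols))
      (cond (ctx_A hC.liftFin hv.liftFin var)
        (state₂ hI.liftFin var ha.liftFin
          fun s a => tstate (s.op, s.fr, s.marked, s.cols ∩ P.nbhd a))
        (state hI.liftFin var tstate))).of_eq fun z => by
        unfold Palette.assign
        cases decide (z.2 = v z.1) <;> cases (C z.1).A (v z.1) z.2 <;> rfl)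

theorem grow {S : ∀ x, Fin (C x).n → Bool} {w : ∀ x, Fin (C x).n}
    (hS : Poly c fun x => tset (S x)) (hw : Poly c fun x => unary (w x)) :
    Poly c fun x => tbool (PathFreeColouring.grow (C x) (I x) (S x) (w x)) :=
  (mem_set hS hw).or ((state hI hw fun s => tbool s.op).and
    (ex (q := fun x y => ((C x).A y (w x) && S x y)) hC.ctx_n
      ((ctx_A hC.liftFin var hw.liftFin).and (mem_set hS.liftFin var))))

theorem component {v : ∀ x, Fin (C x).n} (hv : Poly c fun x => unary (v x)) :
    Poly c fun x => tset (PathFreeColouring.component (C x) (I x) (v x)) := by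
  have hC' : Poly (fun z : Σ x, Fin (C x).n → Bool => .cons (c z.1) (tset z.2))
      fun z => tctx (C z.1) := hC.lift (e := fun _ => tset)
  have hI' : Poly (fun z : Σ x, Fin (C x).n → Bool => .cons (c z.1) (tset z.2))
      fun z => tinst (I z.1) := hI.lift (e := fun _ => tset)
  have hS' : Poly (fun z : Σ x, Fin (C x).n → Bool => .cons (c z.1) (tset z.2))
      fun z => tset z.2 := Poly.id.right
  have hw : Poly (fun w : Σ z : Σ x, Fin (C x).n → Bool, Fin (C z.1).n =>
      .cons (.cons (c w.1.1) (tset w.1.2)) (unary w.2.val)) fun w => unary w.2.val :=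
    var (c := fun z : Σ x, Fin (C x).n → Bool => .cons (c z.1) (tset z.2))
  refine iterate (S := fun x => Fin (C x).n → Bool) (eS := fun _ => tset)
    (init := fun x w => decide (w = v x))
    (step := fun x => PathFreeColouring.grow (C x) (I x)) hC.ctx_n
    (tab (F := fun x w => tbool (decide (w = v x))) hC.ctx_n (eqFin var hv.liftFin))
    (tab (F := fun (z : Σ x, Fin (C x).n → Bool) w =>
      tbool (PathFreeColouring.grow (C z.1) (I z.1) z.2 w)) hC'.ctx_n
      (grow hC'.liftFin hI'.liftFin hS'.liftFin hw))
    (B := fun x => (C x).n * (3 + 1) + 1) ?_ fun x i _ => ?_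
  · exact (hC.ctx_n.bd_unary.mul (.const (3 + 1))).add (.const 1)
  · refine (size_tlist_le (m := 3) fun t ht => ?_).trans (by simp)
    obtain ⟨w, rfl⟩ := (List.mem_ofFn' _ _).1 ht
    exact size_tbool_le _

omit hI in
theorem exists_adj {S : ∀ x, Fin (C x).n → Bool} {v : ∀ x, Fin (C x).n}
    (hS : Poly c fun x => tset (S x)) (hv : Poly c fun x => unary (v x)) :
    Poly c fun x => tbool (decide (∃ w, ((C x).A (v x) w && S x w) = true)) :=
  ex (q := fun x w => ((C x).A (v x) w && S x w)) hC.ctx_n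
    ((ctx_A hC.liftFin hv.liftFin var).and (mem_set hS.liftFin var))

theorem nextPivot {S : ∀ x, Fin (C x).n → Bool} (hS : Poly c fun x => tset (S x)) :
    Poly c fun x => topt (PathFreeColouring.nextPivot (C x) (I x) (S x)) :=
  find (q := fun x q => (I x q).fr && decide (∃ w, ((C x).A q w && S x w) = true)) hC.ctx_n
    ((state hI.liftFin var fun s => tbool s.fr).and (exists_adj hC.liftFin hS.liftFin var))

theorem newFrontier {S : ∀ x, Fin (C x).n → Bool} {v : ∀ x, Fin (C x).n}
    (hS : Poly c fun x => tset (S x)) (hv : Poly c fun x => unary (v x)) :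
    Poly c fun x => tset (PathFreeColouring.newFrontier (C x) (I x) (S x) (v x)) := by
  refine optionCases (nextPivot hC hI hS) (fun d g pull hg => ?_) fun d g q pull hq hg => ?_
  · exact (tab (F := fun x w => tbool (decide (w = v (g x)))) (pull hC.ctx_n)
      (eqFin var (pull hv).liftFin)).of_eq fun x => by
        simp [PathFreeColouring.newFrontier, hg, tset]
  · exact (tab (F := fun z w => tbool ((C (g z)).A (q z) w && S (g z) w)) (pull hC.ctx_n)
      ((ctx_A (pull hC).liftFin hq.liftFin var).and (mem_set (pull hS).liftFin var))).of_eq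
        fun x => by simp [PathFreeColouring.newFrontier, hg, tset]

theorem inner {S : ∀ x, Fin (C x).n → Bool} {v : ∀ x, Fin (C x).n}
    (hS : Poly c fun x => tset (S x)) (hv : Poly c fun x => unary (v x)) :
    Poly c fun x => tinst (PathFreeColouring.inner (C x) (I x) (S x) (v x)) :=
  tab (F := fun x w => tstate (PathFreeColouring.inner (C x) (I x) (S x) (v x) w)) hC.ctx_n
    (mkState hI.liftFin var (mem_set hS.liftFin var)
      (mem_set (newFrontier hC hI hS hv).liftFin var) (const (tbool false)))

theorem expand {ts : ∀ x, List (Task h (C x).n)} {vs : X → List ℕ}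
    (ht : Poly c fun x => tlist ((ts x).map ttask))
    (hv : Poly c fun x => tlist ((vs x).map tbits)) :
    Poly c fun x => tconfig ((P.expand (C x) (I x)).push (C x) (ts x) (vs x)) := by
  have hleaf0 : Poly c fun x => tconfig ⟨C x, ts x, 0 :: vs x⟩ :=
    hC.cons (ht.cons ((const (tbits 0)).cons hv))
  refine casesOn (hI.isDead hC.ctx_n) fun d g b pull hb => ?_
  cases b with
  | true => exact (pull hleaf0).of_eq fun x => by rw [Palette.expand_dead (hb x)]; rfl
  | false =>
    refine optionCases (pull (pickVertex P hC hI)) (fun d' g' pull' hg' => ?_)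
      fun d' g' v pull' hv' hg' => ?_
    · refine optionCases (pull' (pull (hI.firstOpen hC.ctx_n))) (fun d'' g'' pull'' hg'' => ?_)
        fun d'' g'' v pull'' hv' hg'' => ?_
      · refine (pull'' (pull' (pull (hC.cons (ht.cons
          ((powBits hC.ctx_B (hI.markCount hC.ctx_n)).cons hv)))))).of_eq fun x => ?_
        rw [Palette.expand_closed (hb _) (hg' _) (hg'' x)]; rfl
      · have hC' := pull'' (pull' (pull hC))
        have hI' := pull'' (pull' (pull hI))
        have hcomp := component hC' hI' hv'
        refine (hC'.cons ((((const (unary 2)).cons (inner hC' hI' hcomp hv')).cons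
          (((const (unary 2)).cons (hI'.outer hC'.ctx_n hcomp)).cons
            ((const (ttask (h := 0) (n := 0) .mul)).cons (pull'' (pull' (pull ht)))))).cons
              (pull'' (pull' (pull hv))))).of_eq fun x => ?_
        rw [Palette.expand_mul (hb _) (hg' _) (hg'' x)]; rfl
    · refine optionCases (pickColour P (pull' (pull hC)) (pull' (pull hI)) hv')
        (fun d'' g'' pull'' hg'' => ?_) fun d'' g'' a pull'' ha hg'' => ?_
      · refine (pull'' (pull' (pull hleaf0))).of_eq fun x => ?_
        rw [Palette.expand_none (hb _) (hg' _) (hg'' x)]; rfl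
      · have hC' := pull'' (pull' (pull hC))
        have hI' := pull'' (pull' (pull hI))
        refine (hC'.cons ((((const (unary 2)).cons (assign P hC' hI' (pull'' hv') ha)).cons
          (((const (unary 2)).cons (hI'.forbid hC'.ctx_n (pull'' hv') ha)).cons
            ((const (ttask (h := 0) (n := 0) .add)).cons (pull'' (pull' (pull ht)))))).cons
              (pull'' (pull' (pull hv))))).of_eq fun x => ?_
        rw [Palette.expand_add (hb _) (hg' _) (hg'' x)]; rfl

end

/-- A step of the stack machine takes polynomial time. -/
theorem step {h : ℕ} (P : Palette h) :
    Poly (fun x : Config h => tconfig x) fun x => tconfig (P.step x) := by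
  have hC : Poly (fun x : Config h => tconfig x) fun x => tctx x.C := Poly.id.left
  have ht : Poly (fun x : Config h => tconfig x) fun x => tlist (x.tasks.map ttask) :=
    Poly.id.right.left
  have hv : Poly (fun x : Config h => tconfig x) fun x => tlist (x.vals.map tbits) :=
    Poly.id.right.right
  have h0 : Poly (fun x : Config h => tconfig x) fun x => tbool (!x.tasks.isEmpty) :=
    ht.tbool_of_tree fun ⟨C, ts, vs⟩ => by cases ts <;> simp
  refine casesOn h0 fun d g b pull hb => ?_
  cases b with
  | false =>
    refine (pull Poly.id).of_eq fun y => ?_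
    have hy : (g y).tasks = [] := by simpa using hb y
    rw [P.step_nil hy]
  | true =>
    have hex : ∀ y, ∃ t ts, (g y).tasks = t :: ts := fun y =>
      List.exists_cons_of_ne_nil (by simpa using hb y)
    choose t ts hts using hex
    have htask : Poly d fun y => ttask (t y) := (pull ht).fst.of_eq fun y => by simp [hts]
    have hts' : Poly d fun y => tlist ((ts y).map ttask) :=
      (pull ht).snd.of_eq fun y => by simp [hts]
    have hval : ∀ i, Poly d fun y => tbits ((g y).vals.getD i 0) := fun i =>
      (getD (pull hv) (const (unary i))).of_eq fun y => by
        rw [show Tree.nil = tbits 0 by simp [tbits], List.getD_map]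
    have hdrop : Poly d fun y => tlist (((g y).vals.drop 2).map tbits) :=
      (pull hv).snd.snd.of_eq fun y => by
        rcases (g y).vals with _ | ⟨_, _ | ⟨_, _⟩⟩ <;> simp
    have hinst : Poly d fun y => tbool (t y).isInst := htask.fst.snd.tbool_of_tree fun y => by
      cases t y <;> simp [ttask, Task.isInst]
    refine casesOn hinst fun d' g' b pull' hb' => ?_
    cases b with
    | true =>
      have hI : ∀ y, ∃ I, t (g' y) = .inst I := fun y => by
        have := hb' y
        cases h : t (g' y) with
        | inst I => exact ⟨I, rfl⟩
        | _ => simp [h, Task.isInst] at this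
      choose I hI using hI
      refine (expand (ts := fun y => ts (g' y)) P (pull' (pull hC))
        (I := I) ((pull' htask.snd).of_eq fun y => ?_) (pull' hts')
        (pull' (pull hv))).of_eq fun y => ?_
      · simp [hI, ttask]
      · rw [P.step_inst ((hts _).trans (by rw [hI y]))]
    | false =>
      have hmul : Poly d' fun y => tbool (t (g' y)).isMul := (pull' htask.fst).tbool_of_tree
        fun y => by
          have := hb' y
          cases h : t (g' y) <;> simp_all [ttask, Task.isMul, Task.isInst]
      refine casesOn hmul fun d'' g'' b pull'' hb'' => ?_
      cases b with
      | true =>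
        refine ((pull'' (pull' (pull hC))).cons ((pull'' (pull' hts')).cons
          ((mulBits (pull'' (pull' (hval 0))) (pull'' (pull' (hval 1)))).cons
            (pull'' (pull' hdrop))))).of_eq fun y => ?_
        have h₁ := hb'' y
        have h₂ := hb' (g'' y)
        cases h : t (g' (g'' y)) <;> simp [h, Task.isMul, Task.isInst] at h₁ h₂
        rw [P.step_mul ((hts _).trans (by rw [h]))]
        rfl
      | false =>
        refine ((pull'' (pull' (pull hC))).cons ((pull'' (pull' hts')).cons
          ((addBits (pull'' (pull' (hval 0))) (pull'' (pull' (hval 1)))).cons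
            (pull'' (pull' hdrop))))).of_eq fun y => ?_
        have h₁ := hb'' y
        have h₂ := hb' (g'' y)
        cases h : t (g' (g'' y)) <;> simp [h, Task.isMul, Task.isInst] at h₁ h₂
        rw [P.step_add ((hts _).trans (by rw [h]))]
        rfl

end Poly

/-! ### The running time of the stack machine -/

namespace Palette

variable {h : ℕ} (P : Palette h)

/-- `P.Evals C I v k`: the recursion tree of the subproblem `I` has `k` nodes, and its result
is `v`. -/
inductive Evals (C : Ctx) : Inst h C.n → ℕ → ℕ → Prop
  | leaf {I v} : P.expand C I = .leaf v → Evals C I v 1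
  | add {I J J' v v' k k'} : P.expand C I = .add J J' → Evals C J v k → Evals C J' v' k' →
      Evals C I (v + v') (k + k' + 1)
  | mul {I J J' v v' k k'} : P.expand C I = .mul J J' → Evals C J v k → Evals C J' v' k' →
      Evals C I (v * v') (k + k' + 1)

variable {P}

/-- The stack machine performs a recursion in at most twice as many steps as there are nodes in the
recursion tree. -/
theorem Evals.exists_steps {C : Ctx} {I : Inst h C.n} {v k : ℕ} (hI : P.Evals C I v k) :
    ∃ s ≤ 2 * k, ∀ ts vs, P.step^[s] ⟨C, .inst I :: ts, vs⟩ = ⟨C, ts, v :: vs⟩ := by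
  induction hI with
  | leaf he => exact ⟨1, by omega, fun ts vs => by simp [step, he, Node.push]⟩
  | add he _ _ ih ih' =>
    obtain ⟨s, hs, h⟩ := ih
    obtain ⟨s', hs', h'⟩ := ih'
    refine ⟨1 + (s' + (s + 1)), by omega, fun ts vs => ?_⟩
    rw [Function.iterate_add_apply, Function.iterate_add_apply, Function.iterate_add_apply]
    simp [step, he, Node.push, h, h', Nat.add_comm]
  | mul he _ _ ih ih' =>
    obtain ⟨s, hs, h⟩ := ih
    obtain ⟨s', hs', h'⟩ := ih'
    refine ⟨1 + (s' + (s + 1)), by omega, fun ts vs => ?_⟩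
    rw [Function.iterate_add_apply, Function.iterate_add_apply, Function.iterate_add_apply]
    simp [step, he, Node.push, h, h', Nat.mul_comm]

end Palette

section

variable {h : ℕ}

theorem n_le_size_tctx (C : Ctx) : C.n ≤ (tctx C).size := by
  simp only [tctx, Tree.size, size_unary]
  omega

theorem natSize_le_size_tctx (C : Ctx) : C.B.size ≤ (tctx C).size := by
  have := natSize_le_size_tbits C.B
  simp only [tctx, Tree.size, size_unary]
  omega

/-- The number of cells that suffice for a task, up to a factor that depends on the number of
vertices. -/
def taskConst (h : ℕ) : ℕ := 2 * Fintype.card (VState h) + 10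

theorem size_ttask_le (C : Ctx) (t : Task h C.n) :
    (ttask t).size + 1 ≤ taskConst h * ((tctx C).size + 1) := by
  cases t with
  | inst I =>
    have h₁ : (tinst I).size ≤ C.n * (2 * Fintype.card (VState h) + 1 + 1) + 1 := by
      refine (size_tlist_le (m := 2 * Fintype.card (VState h) + 1) fun t ht => ?_).trans (by simp)
      obtain ⟨w, rfl⟩ := (List.mem_ofFn' _ _).1 ht
      have := (Fintype.equivFin (VState h) (I w)).isLt
      simp only [tstate, size_unary]
      omega
    have h₂ := Nat.mul_le_mul_right (2 * Fintype.card (VState h) + 1 + 1) (n_le_size_tctx C)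
    simp only [ttask, Tree.size, size_unary, taskConst]
    nlinarith
  | add =>
    simp only [ttask, Tree.size, size_unary, taskConst]
    nlinarith
  | mul =>
    simp only [ttask, Tree.size, size_unary, taskConst]
    nlinarith

/-- The number of cells that suffice for a list of results. -/
def valsBound (vs : List ℕ) : ℕ := (vs.map fun v => 4 * v.size + 5).sum

theorem size_vals_le (vs : List ℕ) : (tlist (vs.map tbits)).size ≤ valsBound vs + 1 := by
  induction vs with
  | nil => simp [valsBound, Tree.size]
  | cons v vs ih =>
    have := size_tbits_le v
    simp only [valsBound, List.map_cons, tlist_cons, Tree.size, List.sum_cons] at *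
    omega

theorem valsBound_le (vs : List ℕ) : valsBound vs ≤ 9 * (tlist (vs.map tbits)).size := by
  induction vs with
  | nil => simp [valsBound]
  | cons v vs ih =>
    have := natSize_le_size_tbits v
    simp only [valsBound, List.map_cons, tlist_cons, Tree.size, List.sum_cons] at *
    omega

theorem size_tconfig_le (x : Config h) : (tconfig x).size ≤ (tctx x.C).size +
    x.tasks.length * (taskConst h * ((tctx x.C).size + 1)) + valsBound x.vals + 4 := by
  have h₁ : (tlist (x.tasks.map ttask)).size ≤
      x.tasks.length * (taskConst h * ((tctx x.C).size + 1)) + 1 := by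
    rw [size_tlist]
    refine Nat.add_le_add_right ((List.sum_le_card_nsmul _ (taskConst h * ((tctx x.C).size + 1))
      fun m hm => ?_).trans (by simp)) 1
    simp only [List.map_map, List.mem_map, Function.comp] at hm
    obtain ⟨t, -, rfl⟩ := hm
    exact size_ttask_le _ _
  have h₂ := size_vals_le x.vals
  simp only [tconfig, Tree.size]
  omega

theorem valsBound_op_le (vs : List ℕ) (v : ℕ)
    (hv : v.size ≤ (vs.getD 0 0).size + (vs.getD 1 0).size + 1) :
    valsBound (v :: vs.drop 2) ≤ valsBound vs + 9 := by
  rcases vs with _ | ⟨a, _ | ⟨b, vs⟩⟩ <;> simp [valsBound] at * <;> omega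

namespace Palette

variable (P : Palette h)

theorem step_C (x : Config h) : (P.step x).C = x.C := by
  obtain ⟨C, _ | ⟨_ | _ | _, ts⟩, vs⟩ := x
  · rfl
  · simp only [step]
    cases P.expand C _ <;> rfl
  · rfl
  · rfl

theorem length_tasks_step_le (x : Config h) : (P.step x).tasks.length ≤ x.tasks.length + 2 := by
  obtain ⟨C, _ | ⟨_ | _ | _, ts⟩, vs⟩ := x
  · simp [step]
  · simp only [step]
    cases P.expand C _ <;> simp [Node.push]
    omega
  · simp [step]; omega
  · simp [step]; omega

theorem markCount_le {n : ℕ} (I : Inst h n) : markCount I ≤ n :=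
  (Finset.card_le_univ _).trans (by simp)

theorem size_leaf_le {C : Ctx} {I : Inst h C.n} {v : ℕ} (hv : P.expand C I = .leaf v) :
    v.size ≤ (tctx C).size ^ 2 + 1 := by
  have hv' : v = 0 ∨ v = C.B ^ markCount I := by
    unfold expand at hv
    split_ifs at hv <;> (try split at hv) <;> (try split at hv) <;> simp_all
  rcases hv' with rfl | rfl
  · simp
  · refine (natSize_pow_le _ _).trans ?_
    rw [sq]
    exact Nat.add_le_add_right (Nat.mul_le_mul
      ((markCount_le I).trans (n_le_size_tctx C)) (natSize_le_size_tctx C)) 1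

theorem valsBound_step_le (x : Config h) :
    valsBound (P.step x).vals ≤ valsBound x.vals + (4 * (tctx x.C).size ^ 2 + 9) := by
  obtain ⟨C, _ | ⟨I | _ | _, ts⟩, vs⟩ := x
  · simp [step]
  · simp only [step]
    cases hv : P.expand C I with
    | leaf v =>
      have := P.size_leaf_le hv
      simp only [Node.push, valsBound, List.map_cons, List.sum_cons]
      omega
    | _ => simp [Node.push]
  · exact (valsBound_op_le vs _ (natSize_add_le _ _)).trans (by simp only; omega)
  · exact (valsBound_op_le vs _ ((natSize_mul_le _ _).trans (by omega))).trans
      (by simp only; omega)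

theorem iterate_step_bounds (x : Config h) (i : ℕ) : (P.step^[i] x).C = x.C ∧
    (P.step^[i] x).tasks.length ≤ x.tasks.length + 2 * i ∧
    valsBound (P.step^[i] x).vals ≤ valsBound x.vals + i * (4 * (tctx x.C).size ^ 2 + 9) := by
  induction i with
  | zero => simp
  | succ i ih =>
    obtain ⟨h₁, h₂, h₃⟩ := ih
    rw [Function.iterate_succ_apply']
    have h₄ := P.length_tasks_step_le (P.step^[i] x)
    have h₅ := P.valsBound_step_le (P.step^[i] x)
    rw [h₁] at h₅
    refine ⟨(P.step_C _).trans h₁, by omega, ?_⟩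
    rw [Nat.succ_mul]
    omega

/-- The configurations stay small. -/
theorem size_iterate_step_le (x : Config h) {i s : ℕ} (hi : i ≤ s) {S : ℕ}
    (hS : S = (tconfig x).size + s) :
    (tconfig (P.step^[i] x)).size ≤
      S + 3 * S * (taskConst h * (S + 1)) + (9 * S + S * (4 * S ^ 2 + 9)) + 4 := by
  obtain ⟨h₁, h₂, h₃⟩ := P.iterate_step_bounds x i
  have h₄ := size_tconfig_le (P.step^[i] x)
  have e₁ : (tctx (P.step^[i] x).C).size = (tctx x.C).size := by rw [h₁]
  have h₅ := valsBound_le x.vals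
  have h₆ : x.tasks.length ≤ (tlist (x.tasks.map ttask)).size := by
    simpa using length_le_size_tlist (x.tasks.map ttask)
  have h₇ : (tctx x.C).size + (tlist (x.tasks.map ttask)).size + (tlist (x.vals.map tbits)).size ≤
      (tconfig x).size := by
    simp only [tconfig, Tree.size]
    omega
  rw [e₁] at h₄
  have hc : (tctx x.C).size ≤ S := by omega
  have ht : (P.step^[i] x).tasks.length ≤ 3 * S := by omega
  have hv : valsBound (P.step^[i] x).vals ≤ 9 * S + S * (4 * S ^ 2 + 9) :=
    h₃.trans (Nat.add_le_add (by omega) (Nat.mul_le_mul (by omega)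
      (Nat.add_le_add_right (Nat.mul_le_mul_left _ (Nat.pow_le_pow_left hc 2)) _)))
  have := Nat.mul_le_mul ht (Nat.mul_le_mul_left (taskConst h) (Nat.add_le_add_right hc 1))
  omega

theorem iterate_step_eq {x : Config h} {i j : ℕ} (hij : i ≤ j) (hi : (P.step^[i] x).tasks = []) :
    P.step^[j] x = P.step^[i] x := by
  induction j, hij using Nat.le_induction with
  | base => rfl
  | succ j _ ih => rw [Function.iterate_succ_apply', ih, P.step_nil hi]

/-- The stack machine can be run until there are no tasks left, in time polynomial in the size of
its configuration and the number of its steps. -/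
theorem exists_run : ∃ (p : Fn) (k : ℕ), ∀ (x : Config h) (s : ℕ), (P.step^[s] x).tasks = [] →
    p.EvalLe (tconfig x) (tconfig (P.step^[s] x)) (((tconfig x).size + s + 1) ^ k) := by
  obtain ⟨p, n, hp, ⟨k₁, hn⟩, -⟩ := Poly.step P
  let L : ℕ → ℕ := fun S => S + 3 * S * (taskConst h * (S + 1)) + (9 * S + S * (4 * S ^ 2 + 9)) + 4
  have hS : PolyBd unary fun S => S := PolyBd.size.of_le fun x => by simp; omega
  have hL : PolyBd unary L :=
    (((hS.add (((PolyBd.const 3).mul hS).mul ((PolyBd.const _).mul (hS.add (.const 1))))).add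
      (((PolyBd.const 9).mul hS).add
        (hS.mul (((PolyBd.const 4).mul (hS.pow 2)).add (.const 9))))).add (.const 4))
  let M : ℕ → ℕ := fun S => (L S + 1) ^ k₁ + L S + (16 * L S + 16)
  have hM : PolyBd unary M := (((hL.add (.const 1)).pow k₁).add hL).add
    (((PolyBd.const 16).mul hL).add (.const 16))
  obtain ⟨k, hk⟩ := (hS.add (.const 1)).mul (((PolyBd.const 12).mul hM).add (.const 14))
  refine ⟨.loop (.comp .snd .fst) p, 2 * k, fun x s hs => ?_⟩
  have hex : ∃ i, (P.step^[i] x).tasks = [] := ⟨s, hs⟩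
  classical
  let N := Nat.find hex
  have hN : (P.step^[N] x).tasks = [] := Nat.find_spec hex
  have hNs : N ≤ s := Nat.find_min' hex hs
  rw [P.iterate_step_eq hNs hN]
  set S := (tconfig x).size + s with hSdef
  have hsize : ∀ i ≤ N, (tconfig (P.step^[i] x)).size ≤ L S := fun i hi =>
    P.size_iterate_step_le x (hi.trans hNs) hSdef
  have key := Fn.evalLe_loop (c := .comp .snd .fst) (f := p) (N := N) (M := M S)
    (fun i => tconfig (P.step^[i] x)) (fun i => tlist ((P.step^[i] x).tasks.map ttask))
    (fun i hi => ?_) (fun i hi => ?_) ?_ (fun i hi => ?_) (fun i hi => ?_) fun i hi => ?_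
  · obtain ⟨m, hm, he⟩ := key
    refine ⟨m, hm.trans ?_, he⟩
    have h₁ := hk S
    simp only [size_unary] at h₁
    have hx : 0 < (tconfig x).size := by simp only [tconfig, Tree.size]; omega
    calc (N + 1) * (12 * M S + 14) ≤ (S + 1) * (12 * M S + 14) :=
          Nat.mul_le_mul_right _ (by omega)
      _ ≤ (2 * S + 1 + 1) ^ k := h₁
      _ ≤ ((S + 1) ^ 2) ^ k := Nat.pow_le_pow_left (by nlinarith) k
      _ = (S + 1) ^ (2 * k) := by rw [← pow_mul]
  · refine ⟨_, ?_, .comp (.snd _) (.fst _)⟩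
    have := hsize i hi
    simp only [tconfig, Tree.size] at this
    simp only [tconfig, Tree.size, Tree.snd, M]
    omega
  · have := Nat.find_min hex hi
    intro h
    apply this
    cases h' : (P.step^[i] x).tasks with
    | nil => rfl
    | cons a l => simp [h'] at h
  · simp [hN]
  · refine ⟨_, (hn _).trans ((Nat.pow_le_pow_left (Nat.add_le_add_right
      (hsize i hi.le) 1) k₁).trans ?_), ?_⟩
    · simp only [M]; omega
    · have := hp (P.step^[i] x)
      rwa [show P.step^[i + 1] x = P.step (P.step^[i] x) from Function.iterate_succ_apply' _ _ _]
  · have := hsize i hi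
    simp only [M]; omega
  · have := hsize i hi
    simp only [tconfig, Tree.size] at this
    simp only [M]; omega

end Palette

end

/-! ### Setting up the computation and reading off the result -/

namespace Poly

variable {X : Type} {c : X → Tree}

theorem append {l l' : X → List Tree} (hl : Poly c fun x => tlist (l x))
    (hl' : Poly c fun x => tlist (l' x)) : Poly c fun x => tlist (l x ++ l' x) := by
  refine (foldl (E := fun _ => Tree) (S := fun _ => List Tree) (ℓ := fun x => (l x).reverse)
    (eE := fun _ t => t) (eS := fun _ => tlist) (init := l') (step := fun _ a e => e :: a)
    (hl.reverse.of_eq fun x => by simp) hl' (Poly.id.right.right.cons Poly.id.right.left)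
    (hl.bd.add hl'.bd) fun x r hr => ?_).of_eq fun x => by simp
  obtain ⟨r', hr'⟩ := hr
  have h : l x = r'.reverse ++ r.reverse := by rw [← List.reverse_append, hr', List.reverse_reverse]
  rw [List.foldl_flip_cons_eq_append, size_tlist, size_tlist, size_tlist, h]
  simp
  omega

theorem flatMap {E : X → Type} {ℓ : ∀ x, List (E x)} {eE : ∀ x, E x → Tree}
    {F : ∀ x, E x → List Tree} (hℓ : Poly c fun x => tlist ((ℓ x).map (eE x)))
    (hF : Poly (fun z : Σ x, E x => .cons (c z.1) (eE z.1 z.2)) fun z => tlist (F z.1 z.2)) :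
    Poly c fun x => tlist ((ℓ x).flatMap (F x)) := by
  have hfold : ∀ x (l : List (E x)) (a : List Tree),
      l.foldl (fun a e => a ++ F x e) a = a ++ l.flatMap (F x) := by
    intro x l
    induction l with
    | nil => simp
    | cons e l ih => intro a; simp [ih]
  obtain ⟨k, hk⟩ := hF.bd
  let M : X → ℕ := fun x => ((c x).size + (tlist ((ℓ x).map (eE x))).size + 1 + 1) ^ k
  have hsum : ∀ x (l : List (E x)), l ⊆ ℓ x →
      (tlist (l.flatMap (F x))).size ≤ l.length * M x + 1 := by
    intro x l hl
    induction l with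
    | nil => simp [Tree.size]
    | cons e l ih =>
      have h₁ := ih fun e he => hl (List.mem_cons_of_mem _ he)
      have h₂ : (tlist (F x e)).size ≤ M x := by
        refine (hk ⟨x, e⟩).trans (Nat.pow_le_pow_left ?_ k)
        have := size_le_size_tlist (List.mem_map_of_mem (f := eE x) (hl List.mem_cons_self))
        simp only [Tree.size]
        omega
      rw [size_tlist] at h₁ h₂ ⊢
      simp only [List.flatMap_cons, List.map_append, List.sum_append, List.length_cons]
      rw [Nat.succ_mul]
      omega
  refine (foldl (S := fun _ => List Tree) (eS := fun _ => tlist) (init := fun _ => [])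
    (step := fun x a e => a ++ F x e) hℓ (const _)
    (B := fun x => (tlist ((ℓ x).map (eE x))).size * M x + 1) ?_ ?_
    fun x l hl => ?_).of_eq fun x => by simp [hfold]
  · exact append Poly.id.right.left ((Poly.id.left.cons Poly.id.right.right).trans
      (hF.precomp fun z : Σ x, List Tree × E x => ⟨z.1, z.2.2⟩))
  · exact (hℓ.bd.mul ((((PolyBd.size.add hℓ.bd).add (.const 1)).add (.const 1)).pow k)).add
      (.const 1)
  · rw [hfold, List.nil_append]
    refine (hsum x l hl.subset).trans (Nat.add_le_add_right (Nat.mul_le_mul_right _ ?_) 1)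
    have := length_le_size_tlist ((ℓ x).map (eE x))
    have := hl.length_le
    simp at *
    omega

end Poly

/-- The input of the algorithm, together with the parameter of the class of graphs. -/
structure Input where
  n : ℕ
  G : SimpleGraph (Fin n)
  t : ℕ

/-- The tree that represents the input. -/
def Input.code (x : Input) : Tree := .cons (tlist ((encodeGraph x.G).map tbool)) (unary x.t)

/-- The degree threshold `d` of the first phase. It is about `√(n * log n / t)`. -/
def threshold (t n : ℕ) : ℕ := Nat.sqrt (n * n.size / t) + 1

open Classical in
/-- The data of the computation for a given graph. -/
def Input.ctx (x : Input) : Ctx :=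
  ⟨x.n, fun i j => decide (x.G.Adj i j), threshold x.t x.n, 2 ^ (x.n + 1)⟩

/-- The first subproblem: all vertices are open, and all colours are allowed. -/
def initInst (h n : ℕ) : Inst h n := fun _ => (true, false, false, Finset.univ)

open Classical in
theorem encodeGraph_eq {n : ℕ} (G : SimpleGraph (Fin n)) : encodeGraph G =
    List.replicate n true ++ false :: List.ofFn fun k : Fin (n * n) =>
      decide (G.Adj k.divNat k.modNat) := by
  rw [encodeGraph, List.ofFn_mul]
  congr 2
  rw [List.flatMap, List.ofFn_eq_map]
  congr 1
  refine List.map_congr_left fun i _ => ?_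
  rw [List.ofFn_eq_map]
  refine List.map_congr_left fun j _ => ?_
  congr 2
  · ext
    simp [Fin.divNat, Nat.add_comm (i.val * n), Nat.add_mul_div_right _ _ j.pos,
      Nat.div_eq_of_lt j.isLt]
  · ext
    simp [Fin.modNat, Nat.mod_eq_of_lt j.isLt]

theorem length_encodeGraph {n : ℕ} (G : SimpleGraph (Fin n)) :
    (encodeGraph G).length = n + 1 + n * n := by
  classical
  rw [encodeGraph_eq]
  simp
  omega

theorem getD_encodeGraph_lt {n i : ℕ} (G : SimpleGraph (Fin n)) (hi : i < n) :
    (encodeGraph G).getD i false = true := by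
  classical
  rw [encodeGraph_eq, List.getD_append _ _ _ _ (by simpa using hi)]
  simp [hi]

theorem getD_encodeGraph_self {n : ℕ} (G : SimpleGraph (Fin n)) :
    (encodeGraph G).getD n false = false := by
  classical
  rw [encodeGraph_eq, List.getD_append_right _ _ _ _ (by simp)]
  simp

open Classical in
theorem getD_encodeGraph_adj {n : ℕ} (G : SimpleGraph (Fin n)) (i j : Fin n) :
    (encodeGraph G).getD (n + 1 + (n * i + j)) false = decide (G.Adj i j) := by
  have hlt : n * i.val + j.val < n * n := by
    have := i.isLt
    have := j.isLt
    nlinarith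
  rw [encodeGraph_eq, List.getD_append_right _ _ _ _ (by simp; omega)]
  simp only [List.length_replicate]
  rw [show n + 1 + (n * i.val + j.val) - n = n * i.val + j.val + 1 by omega, List.getD_cons_succ,
    List.getD_eq_getElem _ _ (by simpa using hlt), List.getElem_ofFn]
  congr 2
  · ext
    simp [Fin.divNat, Nat.mul_add_div j.pos, Nat.div_eq_of_lt j.isLt]
  · ext
    simp [Fin.modNat, Nat.mod_eq_of_lt j.isLt]

namespace Poly

theorem bit_input {X : Type} {c : X → Tree} {g : X → Input} {i : X → ℕ}
    (hg : Poly c fun x => tlist ((encodeGraph (g x).G).map tbool))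
    (hi : Poly c fun x => unary (i x)) :
    Poly c fun x => tbool ((encodeGraph (g x).G).getD (i x) false) :=
  (getD hg hi).of_eq fun x => by rw [show Tree.nil = tbool false from rfl, List.getD_map]

theorem input_n : Poly Input.code fun x => unary x.n := by
  have hl : Poly Input.code fun x => tlist ((encodeGraph x.G).map tbool) := Poly.id.left
  have hlen : Poly Input.code fun x => unary (encodeGraph x.G).length :=
    (length hl).of_eq fun x => by rw [List.length_map]
  refine (find (q := fun x i => !(encodeGraph x.G).getD i.val false) hlen
    (bit_input (g := fun z : Σ x : Input, Fin (encodeGraph x.G).length => z.1)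
      hl.liftFin var).not).snd.of_eq fun x => ?_
  have hn : x.n < (encodeGraph x.G).length := by rw [length_encodeGraph]; omega
  have : (List.finRange (encodeGraph x.G).length).find?
      (fun i => !(encodeGraph x.G).getD i.val false) = some ⟨x.n, hn⟩ := by
    rw [List.find?_eq_some_iff_getElem]
    refine ⟨by simp only [getD_encodeGraph_self]; rfl, x.n, by simpa using hn, by simp,
      fun j hj => ?_⟩
    simp only [List.getElem_finRange, Fin.cast_mk]
    rw [getD_encodeGraph_lt x.G hj]
    rfl
  rw [this]
  rfl

theorem input_adj {X : Type} {c : X → Tree} {g : X → Input} {i j : ∀ x, Fin (g x).n}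
    (hg : Poly c fun x => (g x).code) (hi : Poly c fun x => unary (i x))
    (hj : Poly c fun x => unary (j x)) : Poly c fun x => tbool ((g x).ctx.A (i x) (j x)) := by
  have hn : Poly c fun x => unary (g x).n := hg.trans (input_n.precomp g)
  refine (bit_input (g := g) hg.left (add (succ hn) (add (mul hn hi) hj))).of_eq fun x => ?_
  rw [getD_encodeGraph_adj]
  rfl

theorem input_threshold : Poly Input.code fun x => unary (threshold x.t x.n) := by
  have ht : Poly Input.code fun x => unary x.t := Poly.id.right
  have hm : Poly Input.code fun x => unary (x.n * x.n.size) :=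
    mul input_n (natSize (unaryToBits input_n))
  have hi : Poly (fun z : Σ x : Input, Fin (x.n * x.n.size) => .cons (z.1.code) (unary z.2.val))
    fun z => unary (z.2.val + 1) := succ var
  refine (succ (card (q := fun x i => decide (0 < x.t) &&
    decide ((i.val + 1) * (i.val + 1) * x.t ≤ x.n * x.n.size)) hm
    ((lt (const (unary 0)) ht.liftFin).and
      (le (mul (mul hi hi) ht.liftFin) hm.liftFin)))).of_eq fun x => ?_
  rw [threshold]
  congr 2
  set m := x.n * x.n.size
  have hs : Nat.sqrt (m / x.t) ≤ m := (Nat.sqrt_le_self _).trans (Nat.div_le_self _ _)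
  have : (Finset.univ.filter fun i : Fin m => (decide (0 < x.t) &&
      decide ((i.val + 1) * (i.val + 1) * x.t ≤ m)) = true) =
      Finset.univ.filter fun i : Fin m => i.val < Nat.sqrt (m / x.t) := by
    refine Finset.filter_congr fun i _ => ?_
    rw [Bool.and_eq_true, decide_eq_true_eq, decide_eq_true_eq]
    rcases Nat.eq_zero_or_pos x.t with h | h
    · simp [h]
    · rw [← Nat.le_div_iff_mul_le h, ← Nat.le_sqrt, Nat.succ_le_iff]
      simp [h]
  rw [this, Fin.card_filter_val_lt]
  omega

theorem input_ctx : Poly Input.code fun x => tctx x.ctx :=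
  input_n.cons ((tab (F := fun (x : Input) (i : Fin x.n) => tset (x.ctx.A i)) input_n
    (tab (N := fun z : Σ x : Input, Fin x.n => z.1.n)
      (F := fun (z : Σ x : Input, Fin x.n) j => tbool (z.1.ctx.A z.2 j)) input_n.liftFin
      (input_adj (g := fun z : Σ z : Σ x : Input, Fin x.n, Fin z.1.n => z.1.1)
        (i := fun z => z.1.2) (j := fun z => z.2)
        (liftFin (liftFin Poly.id)) (liftFin var)
        (var (c := fun z : Σ x : Input, Fin x.n => .cons z.1.code (unary z.2.val)))))).cons
      (input_threshold.cons (powBits (const (tbits 2)) (succ input_n))))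

theorem input_config (h : ℕ) : Poly Input.code fun x =>
    tconfig (⟨x.ctx, [.inst (initInst h x.n)], []⟩ : Config h) :=
  input_ctx.cons (((const (unary 2)).cons
    (tab (F := fun x v => tstate (initInst h x.n v)) input_n
      (const (tstate ((true, false, false, Finset.univ) : VState h))))).cons
        (const .nil) |>.cons (const .nil))

end Poly

theorem Fn.Eval.size_le {p : Fn} {x y : Tree} {m : ℕ} (hp : p.Eval x y m) :
    y.size ≤ x.size + m := by
  induction hp with
  | fst x =>
    cases x <;> simp [Tree.fst, Tree.size]
    omega
  | snd x =>
    cases x <;> simp [Tree.snd, Tree.size]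
    omega
  | _ => (try simp only [Tree.size] at *); omega

/-- The recursive algorithm, together with a conversion `out` of the result, can be performed by a
Turing machine, whose running time is polynomial in the size of the graph and the number of nodes of
the recursion tree. The exponent does not depend on the parameter `t`. -/
theorem exists_machine {h : ℕ} (P : Palette h) {Γ : Type} [Finite Γ] (w : Symb → Γ)
    (out : ℕ → ℕ → List Symb)
    (hout : Poly (fun x : ℕ × ℕ => .cons (unary x.1) (tbits x.2))
      fun x => tlist ((out x.1 x.2).map tsymb)) :
    ∃ K : ℕ, ∀ t : ℕ, ∃ M : Turing.TM2ComputableAux Bool Γ, (∀ k, Finite (M.tm.Γ k)) ∧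
      ∀ (n : ℕ) (G : SimpleGraph (Fin n)) (Z k : ℕ),
        P.Evals (Input.ctx ⟨n, G, t⟩) (initInst h n) Z k →
        OutputsWithin M (encodeGraph G) ((out n Z).map w) (((t + n + 2) * (k + 1)) ^ K) := by
  obtain ⟨p₁, n₁, h₁, ⟨k₁, hn₁⟩, -⟩ := Poly.input_config h
  obtain ⟨p₂, k₂, h₂⟩ := P.exists_run
  have hpoly : Poly (fun x : Ctx × ℕ => tconfig (⟨x.1, [], [x.2]⟩ : Config h))
      fun x => tlist ((out x.1.n x.2).map tsymb) :=
    (Poly.id.left.left.cons Poly.id.right.right.fst).trans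
      (hout.precomp fun x : Ctx × ℕ => (x.1.n, x.2))
  obtain ⟨p₃, n₃, h₃, ⟨k₃, hn₃⟩, -⟩ := hpoly
  -- `a` bounds the size of the input, `b` that of the first configuration, and so on.
  let a : ℕ → ℕ := fun U => 10 * (U + 1) ^ 2
  let b : ℕ → ℕ := fun U => (a U + 1) ^ k₁
  let s : ℕ → ℕ := fun U => (a U + b U + 2 * U + 1) ^ k₂
  let e : ℕ → ℕ := fun U => (a U + b U + s U + 1) ^ k₃
  let T : ℕ → ℕ := fun U => 12 * a U + (30 * a U + 30 + (b U + (s U + e U))) +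
    14 * (a U + b U + s U + e U) + 9
  have hU : PolyBd unary fun U => U := PolyBd.size.of_le fun x => by simp; omega
  have ha : PolyBd unary a := (PolyBd.const 10).mul ((hU.add (.const 1)).pow 2)
  have hb : PolyBd unary b := (ha.add (.const 1)).pow k₁
  have hs : PolyBd unary s := (((ha.add hb).add ((PolyBd.const 2).mul hU)).add (.const 1)).pow k₂
  have he : PolyBd unary e := (((ha.add hb).add hs).add (.const 1)).pow k₃
  obtain ⟨K, hK⟩ : PolyBd unary T :=
    ((((PolyBd.const 12).mul ha).add
      ((((PolyBd.const 30).mul ha).add (.const 30)).add (hb.add (hs.add he)))).add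
      ((PolyBd.const 14).mul (((ha.add hb).add hs).add he))).add (.const 9)
  refine ⟨3 * K, fun t => ⟨((Fn.pair .id (.const (unary t))).comp
    (p₁.comp (p₂.comp p₃))).machine Γ w, Fn.finite_machine w _, fun n G Z k hZ => ?_⟩⟩
  set x : Input := ⟨n, G, t⟩
  set U := (t + n + 2) * (k + 1)
  have hU₁ : t + n + 2 ≤ U := Nat.le_mul_of_pos_right _ (by omega)
  have hU₂ : k + 1 ≤ U := Nat.le_mul_of_pos_left _ (by omega)
  have hlen : (encodeGraph G).length ≤ a U ∧
      (tlist ((encodeGraph G).map tbool)).size + (unary t).size + 1 ≤ a U := by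
    have h₄ := length_encodeGraph G
    have h₅ : (tlist ((encodeGraph G).map tbool)).size ≤ (encodeGraph G).length * (3 + 1) + 1 := by
      refine (size_tlist_le fun t' ht' => ?_).trans (by rw [List.length_map])
      obtain ⟨b', -, rfl⟩ := List.mem_map.1 ht'
      exact size_tbool_le b'
    have h₆ : n + 1 + n * n ≤ (U + 1) ^ 2 := by nlinarith
    simp only [size_unary, a]
    rw [h₄] at h₅ ⊢
    constructor <;> nlinarith
  have e₀ : Fn.Eval (Fn.pair .id (.const (unary t))) (tlist ((encodeGraph G).map tbool)) x.code _ :=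
    .pair (.id _) (.const (unary t) _)
  set q₁ := tconfig (⟨x.ctx, [.inst (initInst h n)], []⟩ : Config h)
  set q₂ := tconfig (⟨x.ctx, [], [Z]⟩ : Config h)
  have e₁ : p₁.Eval x.code q₁ (n₁ x) := h₁ x
  obtain ⟨σ, hσ, hrun⟩ := hZ.exists_steps
  have hrun' := hrun [] []
  obtain ⟨m₂, hm₂, e₂⟩ : p₂.EvalLe q₁ q₂ ((q₁.size + σ + 1) ^ k₂) := by
    have := h₂ ⟨x.ctx, [.inst (initInst h n)], []⟩ σ (by rw [hrun'])
    rwa [hrun'] at this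
  have e₃ : p₃.Eval q₂ (tlist ((out n Z).map tsymb)) (n₃ (x.ctx, Z)) := h₃ (x.ctx, Z)
  have hn₃ : n₃ (x.ctx, Z) ≤ (q₂.size + 1) ^ k₃ := hn₃ (x.ctx, Z)
  have hcode : x.code.size ≤ a U := by
    have := hlen.2
    simp only [Input.code, Tree.size]
    omega
  have hn₁' : n₁ x ≤ b U := (hn₁ x).trans (Nat.pow_le_pow_left (by omega) _)
  have l₁ := e₁.size_le
  have hm₂' : m₂ ≤ s U := hm₂.trans (Nat.pow_le_pow_left (by omega) _)
  have l₂ := e₂.size_le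
  have hn₃' : n₃ (x.ctx, Z) ≤ e U := hn₃.trans (Nat.pow_le_pow_left (by omega) _)
  have l₃ := e₃.size_le
  have hout' : (out n Z).length ≤ (tlist ((out n Z).map tsymb)).size := by
    simpa using length_le_size_tlist ((out n Z).map tsymb)
  have key := (e₀.comp (e₁.comp (e₂.comp e₃))).outputsWithin (w := w) (y := out n Z)
  obtain ⟨⟨r, hr⟩⟩ := key
  refine ⟨⟨r, hr.trans ?_⟩⟩
  have hT : T U ≤ U ^ (3 * K) := by
    have h₁ := hK U
    simp only [size_unary] at h₁
    refine h₁.trans ?_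
    rw [pow_mul]
    refine Nat.pow_le_pow_left ?_ K
    have : 2 ≤ U := by omega
    nlinarith [Nat.mul_le_mul this this, Nat.mul_le_mul (Nat.mul_le_mul this this) (le_refl U)]
  refine le_trans ?_ hT
  have hl2 := hlen.2
  have hl1 := hlen.1
  have hx₁ : (tlist ((encodeGraph x.G).map tbool)).size =
    (tlist ((encodeGraph G).map tbool)).size := rfl
  have hx₂ : (unary x.t).size = (unary t).size := rfl
  simp only [T]
  omega

/-! ### The three forms of the output -/

/-- Digits as symbols. -/
def digit (b : Bool) : Symb := if b then 1 else 0

theorem tsymb_digit (b : Bool) : tsymb (digit b) = tbool b := by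
  cases b <;> rfl

theorem map_tsymb_digit (l : List Bool) : (l.map digit).map tsymb = l.map tbool := by
  rw [List.map_map]
  exact List.map_congr_left fun b _ => tsymb_digit b

/-- The binary digits of the result. -/
theorem poly_output_nat : Poly (fun x : ℕ × ℕ => .cons (unary x.1) (tbits x.2))
    fun x => tlist ((x.2.bits.map digit).map tsymb) :=
  Poly.id.right.of_eq fun x => by rw [map_tsymb_digit, tbits]

/-- Whether the result is nonzero. -/
theorem poly_output_bool : Poly (fun x : ℕ × ℕ => .cons (unary x.1) (tbits x.2))
    fun x => tlist (([decide (x.2 ≠ 0)].map digit).map tsymb) := by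
  have h : Poly (fun x : ℕ × ℕ => .cons (unary x.1) (tbits x.2))
      fun x => tbool (decide (x.2 ≠ 0)) :=
    Poly.id.right.tbool_of_tree fun x => by
      rw [decide_eq_false_iff_not, not_not]
      constructor
      · intro h
        simp [h, tbits]
      · intro h
        rw [← foldr_bit_bits x.2]
        cases h' : x.2.bits with
        | nil => rfl
        | cons a l => simp [tbits, h'] at h
  exact (h.cons (.const .nil)).of_eq fun x => by simp only [map_tsymb_digit]; rfl

/-- The digits of `Z` in base `2 ^ (n + 1)`, each of them in binary and followed by a separator. -/
def digitsOutput (n Z : ℕ) : List Symb :=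
  (List.range (Finset.univ.filter fun k : Fin (n + 1) => (n + 1) * k.val < Z.size).card).flatMap
    fun k => (Z / 2 ^ ((n + 1) * k) % 2 ^ (n + 1)).bits.map digit ++ [2]

theorem poly_output_digits : Poly (fun x : ℕ × ℕ => .cons (unary x.1) (tbits x.2))
    fun x => tlist ((digitsOutput x.1 x.2).map tsymb) := by
  set c : ℕ × ℕ → Tree := fun x => .cons (unary x.1) (tbits x.2)
  have hN : Poly c fun x => unary (x.1 + 1) := .succ Poly.id.left
  have hZ : Poly c fun x => tbits x.2 := Poly.id.right
  let cnt : ℕ × ℕ → ℕ := fun x =>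
    (Finset.univ.filter fun k : Fin (x.1 + 1) => (x.1 + 1) * k.val < x.2.size).card
  have hcnt : Poly c fun x => unary (cnt x) :=
    (Poly.card (q := fun x k => decide ((x.1 + 1) * k.val < x.2.size)) hN
      (.lt (.mul hN.liftFin .var) (.liftFin (.natSize hZ)))).of_eq fun x => by simp [cnt]
  let Y : Type := Σ x : ℕ × ℕ, Fin (cnt x)
  let c' : Y → Tree := fun z => .cons (c z.1) (unary z.2.val)
  have hN' : Poly c' fun z => unary (z.1.1 + 1) := hN.liftFin
  have hk' : Poly c' fun z => unary z.2.val := .var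
  have hdig : Poly c' fun z => tbits (z.1.2 / 2 ^ ((z.1.1 + 1) * z.2.val) % 2 ^ (z.1.1 + 1)) :=
    .ofDigits hN' ((Poly.testBit (f := fun z : Σ z : Y, Fin (z.1.1 + 1) => z.1.1.2)
      (i := fun z => (z.1.1.1 + 1) * z.1.2.val + z.2.val) (.liftFin (.liftFin hZ))
      (.add (.liftFin (.mul hN' hk')) (.var (c := c')))).of_eq fun z => by
        rw [Nat.testBit_div_two_pow, Nat.add_comm])
  refine (Poly.flatMap (ℓ := fun x => List.finRange (cnt x)) (eE := fun x k => unary k.val)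
    (F := fun x k => (x.2 / 2 ^ ((x.1 + 1) * k.val) % 2 ^ (x.1 + 1)).bits.map tbool ++ [unary 2])
    (.finRange hcnt) (.append hdig (.const (tlist [unary 2])))).of_eq fun x => ?_
  rw [digitsOutput, ← List.map_coe_finRange_eq_range, List.flatMap_map, List.map_flatMap]
  congr 1
  refine List.flatMap_congr fun k _ => ?_
  simp only [List.map_append, map_tsymb_digit]
  rfl

/-! ### Components of the open vertices -/

section

variable {h : ℕ} {C : Ctx} {I : Inst h C.n} {x : Fin C.n}

theorem grow_eq_true {S : Fin C.n → Bool} {w : Fin C.n} : grow C I S w = true ↔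
    S w = true ∨ (I w).op = true ∧ ∃ z, C.A z w = true ∧ S z = true := by
  simp [grow]

theorem self_mem_component : component C I x x = true := by
  have : ∀ i, (grow C I)^[i] (fun w => decide (w = x)) x = true := by
    intro i
    induction i with
    | zero => simp
    | succ i ih =>
      rw [Function.iterate_succ_apply']
      exact grow_eq_true.2 (.inl ih)
  exact this _

/-- The component of `x` is the smallest set of open vertices that contains `x` and is closed under
adjacency. -/
theorem component_induction {Q : Fin C.n → Prop} (hx : Q x)
    (hQ : ∀ z w, Q z → C.A z w = true → (I w).op = true → Q w) {w : Fin C.n}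
    (hw : component C I x w = true) : Q w := by
  have : ∀ i w, (grow C I)^[i] (fun w => decide (w = x)) w = true → Q w := by
    intro i
    induction i with
    | zero =>
      intro w hw
      rw [Function.iterate_zero_apply, decide_eq_true_eq] at hw
      rwa [hw]
    | succ i ih =>
      intro w hw
      rw [Function.iterate_succ_apply'] at hw
      rcases grow_eq_true.1 hw with h | ⟨ho, z, hz, hS⟩
      exacts [ih w h, hQ z w (ih z hS) hz ho]
  exact this _ w hw

theorem op_of_mem_component (hx : (I x).op = true) {w : Fin C.n}
    (hw : component C I x w = true) : (I w).op = true :=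
  component_induction hx (fun _ _ _ _ h => h) hw

/-- Growing a set often enough makes it stable, since its size increases in each round before. -/
theorem mem_component_of_adj {z w : Fin C.n} (hz : component C I x z = true)
    (hzw : C.A z w = true) (hw : (I w).op = true) : component C I x w = true := by
  let T : ℕ → Fin C.n → Bool := fun i => (grow C I)^[i] fun w => decide (w = x)
  have hT : ∀ i, T (i + 1) = grow C I (T i) := fun i => Function.iterate_succ_apply' _ _ _
  have key : ∀ i, grow C I (T i) = T i ∨
      i + 1 ≤ (Finset.univ.filter fun w => T i w = true).card := by
    intro i
    induction i with
    | zero => exact .inr (Finset.card_pos.2 ⟨x, by simp [T]⟩)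
    | succ i ih =>
      rcases ih with ih | ih
      · left
        rw [hT, ih, ih]
      · by_cases hs : grow C I (T i) = T i
        · left
          rw [hT, hs, hs]
        · right
          refine Nat.succ_le_of_lt (ih.trans_lt (Finset.card_lt_card ?_))
          have hsub : ∀ w, T i w = true → T (i + 1) w = true := fun w hw => by
            rw [hT]
            exact grow_eq_true.2 (.inl hw)
          refine ⟨fun w hw => ?_, fun hsub' => hs (funext fun w => ?_)⟩
          · simp only [Finset.mem_filter, Finset.mem_univ, true_and] at hw ⊢
            exact hsub w hw
          · rw [Bool.eq_iff_iff, ← hT]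
            refine ⟨fun hw => ?_, hsub w⟩
            simpa using hsub' (by simpa using hw :
              w ∈ Finset.univ.filter fun w => T (i + 1) w = true)
  have hstable : grow C I (component C I x) = component C I x := by
    rcases key C.n with h | h
    · exact h
    · have := h.trans (Finset.card_le_univ _)
      simp at this
  rw [← hstable]
  exact grow_eq_true.2 (.inr ⟨hw, z, hzw, hz⟩)

end

/-! ### The algorithm computes the number of colourings -/

section

variable {h n : ℕ}

/-- The weight of an optional colour. -/
def Palette.wt (P : Palette h) (B : ℕ) : Option (Fin h) → ℕ
  | none => 1
  | some a => bif P.marked a then B else 1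

/-- The colourings of the open vertices with colours from their lists. Closed vertices have
no colour. -/
structure Palette.Valid (P : Palette h) (C : Ctx) (I : Inst h C.n) (φ : Fin C.n → Option (Fin h)) :
    Prop where
  closed : ∀ v, (I v).op = false → φ v = none
  isOpen : ∀ v, (I v).op = true → ∃ a ∈ (I v).cols, φ v = some a
  adj : ∀ u v a b, C.A u v = true → φ u = some a → φ v = some b → P.R a b = true

open Classical in
/-- The solution of a subproblem: the number of its colourings, where each vertex with a marked
colour contributes a factor `B`. -/
def Palette.val (P : Palette h) (C : Ctx) (I : Inst h C.n) : ℕ :=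
  C.B ^ markCount I * ∑ φ with P.Valid C I φ, ∏ v, P.wt C.B (φ v)

/-- The adjacency relation of the data is that of a graph. -/
structure Ctx.IsGraph (C : Ctx) : Prop where
  symm : ∀ u v, C.A u v = C.A v u
  irrefl : ∀ v, C.A v v = false

/-- The colour graph is undirected. -/
def Palette.IsSymm (P : Palette h) : Prop := ∀ a b, P.R a b = P.R b a

theorem Palette.mem_nbhd {P : Palette h} {a b : Fin h} : b ∈ P.nbhd a ↔ P.R a b = true := by
  simp [nbhd]

theorem markCount_eq {I J : Inst h n}
    (hIJ : ∀ v, (!(I v).op && (I v).marked) = (!(J v).op && (J v).marked)) :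
    markCount I = markCount J := by
  simp only [markCount, hIJ]

variable {C : Ctx} {I : Inst h C.n} {P : Palette h} {v w : Fin C.n} {a : Fin h}

theorem Palette.assign_self : P.assign C I v a v = (false, (I v).fr, P.marked a, (I v).cols) := by
  simp [assign]

theorem Palette.assign_of_adj (hw : w ≠ v) (ha : C.A v w = true) : P.assign C I v a w =
    ((I w).op, (I w).fr, (I w).marked, (I w).cols ∩ P.nbhd a) := by
  simp [assign, hw, ha]

theorem Palette.assign_of_not_adj (hw : w ≠ v) (ha : C.A v w = false) :
    P.assign C I v a w = I w := by
  simp [assign, hw, ha]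

theorem Palette.op_assign : (P.assign C I v a w).op = ((I w).op && !decide (w = v)) := by
  by_cases hw : w = v
  · subst hw
    simp [assign_self, VState.op]
  · cases ha : C.A v w
    · simp [assign_of_not_adj hw ha, hw]
    · simp [assign_of_adj hw ha, hw, VState.op]

theorem Palette.fr_assign : (P.assign C I v a w).fr = (I w).fr := by
  by_cases hw : w = v
  · subst hw
    simp [assign_self, VState.fr]
  · cases ha : C.A v w
    · simp [assign_of_not_adj hw ha]
    · simp [assign_of_adj hw ha, VState.fr]

theorem Palette.marked_assign :
    (P.assign C I v a w).marked = if w = v then P.marked a else (I w).marked := by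
  by_cases hw : w = v
  · subst hw
    simp [assign_self, VState.marked]
  · cases ha : C.A v w
    · simp [assign_of_not_adj hw ha, hw]
    · simp [assign_of_adj hw ha, hw, VState.marked]

theorem Palette.cols_assign_subset : (P.assign C I v a w).cols ⊆ (I w).cols := by
  by_cases hw : w = v
  · subst hw
    simp [assign_self, VState.cols]
  · cases ha : C.A v w
    · simp [assign_of_not_adj hw ha]
    · simp [assign_of_adj hw ha, VState.cols]

theorem forbid_self : forbid I v a v =
    ((I v).op, (I v).fr, (I v).marked, (I v).cols.erase a) := by
  simp [forbid]

theorem forbid_of_ne (hw : w ≠ v) : forbid I v a w = I w := by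
  simp [forbid, hw]

theorem op_forbid : (forbid I v a w).op = (I w).op := by
  by_cases hw : w = v
  · subst hw; simp [forbid_self, VState.op]
  · rw [forbid_of_ne hw]

theorem fr_forbid : (forbid I v a w).fr = (I w).fr := by
  by_cases hw : w = v
  · subst hw; simp [forbid_self, VState.fr]
  · rw [forbid_of_ne hw]

theorem marked_forbid : (forbid I v a w).marked = (I w).marked := by
  by_cases hw : w = v
  · subst hw; simp [forbid_self, VState.marked]
  · rw [forbid_of_ne hw]

theorem cols_forbid_subset : (forbid I v a w).cols ⊆ (I w).cols := by
  by_cases hw : w = v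
  · subst hw
    simpa [forbid_self, VState.cols] using Finset.erase_subset _ _
  · rw [forbid_of_ne hw]

namespace Palette

theorem valid_forbid {φ : Fin C.n → Option (Fin h)} :
    P.Valid C (forbid I v a) φ ↔ P.Valid C I φ ∧ ((I v).op = true → φ v ≠ some a) := by
  constructor
  · rintro ⟨h₁, h₂, h₃⟩
    simp only [op_forbid] at h₁ h₂
    refine ⟨⟨h₁, fun w hw => ?_, h₃⟩, fun hv hφ => ?_⟩
    · obtain ⟨b, hb, hb'⟩ := h₂ w hw
      exact ⟨b, cols_forbid_subset hb, hb'⟩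
    · obtain ⟨b, hb, hb'⟩ := h₂ v hv
      rw [hφ, Option.some_inj] at hb'
      subst hb'
      simp [forbid_self, VState.cols] at hb
  · rintro ⟨⟨h₁, h₂, h₃⟩, h₄⟩
    refine ⟨fun w hw => h₁ w (by rwa [op_forbid] at hw), fun w hw => ?_, h₃⟩
    rw [op_forbid] at hw
    obtain ⟨b, hb, hb'⟩ := h₂ w hw
    refine ⟨b, ?_, hb'⟩
    by_cases hwv : w = v
    · subst hwv
      have : b ≠ a := fun h => h₄ hw (by rw [hb', h])
      simpa [forbid_self, VState.cols, this] using hb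
    · rwa [forbid_of_ne hwv]

theorem valid_assign (hC : C.IsGraph) (hP : P.IsSymm) (hv : (I v).op = true)
    (ha : a ∈ (I v).cols) {φ : Fin C.n → Option (Fin h)} :
    P.Valid C (P.assign C I v a) φ ↔
      φ v = none ∧ P.Valid C I (Function.update φ v (some a)) := by
  constructor
  · rintro ⟨h₁, h₂, h₃⟩
    have hn : φ v = none := h₁ v (by simp [op_assign])
    have hnb : ∀ w b, C.A v w = true → φ w = some b → P.R a b = true := by
      intro w b hw hb
      have hne : w ≠ v := by
        rintro rfl
        simp [hn] at hb
      cases ho : (I w).op with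
      | false =>
        rw [h₁ w (by simp [op_assign, ho])] at hb
        simp at hb
      | true =>
        obtain ⟨b', hb', hb''⟩ := h₂ w (by simp [op_assign, ho, hne])
        rw [hb, Option.some_inj] at hb''
        subst hb''
        rw [assign_of_adj hne hw] at hb'
        exact mem_nbhd.1 (Finset.mem_inter.1 hb').2
    refine ⟨hn, fun w hw => ?_, fun w hw => ?_, fun u w b c huw hb hc => ?_⟩
    · have : w ≠ v := by
        rintro rfl
        simp [hv] at hw
      rw [Function.update_of_ne this]
      exact h₁ w (by simp [op_assign, hw])
    · by_cases hwv : w = v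
      · subst hwv
        exact ⟨a, ha, by simp⟩
      · obtain ⟨b, hb, hb'⟩ := h₂ w (by simp [op_assign, hw, hwv])
        exact ⟨b, cols_assign_subset hb, by rwa [Function.update_of_ne hwv]⟩
    · by_cases hu : u = v <;> by_cases hw : w = v
      · subst hu
        subst hw
        simp [hC.irrefl] at huw
      · subst hu
        rw [Function.update_self, Option.some_inj] at hb
        rw [Function.update_of_ne hw] at hc
        subst hb
        exact hnb w c huw hc
      · subst hw
        rw [Function.update_self, Option.some_inj] at hc
        rw [Function.update_of_ne hu] at hb
        subst hc
        rw [hP]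
        exact hnb u b (by rwa [hC.symm]) hb
      · rw [Function.update_of_ne hu] at hb
        rw [Function.update_of_ne hw] at hc
        exact h₃ u w b c huw hb hc
  · rintro ⟨hn, h₁, h₂, h₃⟩
    refine ⟨fun w hw => ?_, fun w hw => ?_, fun u w b c huw hb hc => ?_⟩
    · by_cases hwv : w = v
      · rwa [hwv]
      · have := h₁ w (by simpa [op_assign, hwv] using hw)
        rwa [Function.update_of_ne hwv] at this
    · have hwv : w ≠ v := by
        rintro rfl
        simp [op_assign] at hw
      obtain ⟨b, hb, hb'⟩ := h₂ w (by simpa [op_assign, hwv] using hw)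
      rw [Function.update_of_ne hwv] at hb'
      refine ⟨b, ?_, hb'⟩
      cases hvw : C.A v w with
      | false => rwa [assign_of_not_adj hwv hvw]
      | true =>
        rw [assign_of_adj hwv hvw]
        exact Finset.mem_inter.2 ⟨hb, mem_nbhd.2 (h₃ v w a b hvw (by simp)
          (by rwa [Function.update_of_ne hwv]))⟩
    · have hu : u ≠ v := by
        rintro rfl
        simp [hn] at hb
      have hw : w ≠ v := by
        rintro rfl
        simp [hn] at hc
      exact h₃ u w b c huw (by rwa [Function.update_of_ne hu]) (by rwa [Function.update_of_ne hw])

theorem markCount_assign (hv : (I v).op = true) :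
    C.B ^ markCount (P.assign C I v a) = C.B ^ markCount I * P.wt C.B (some a) := by
  have hset : (Finset.univ.filter fun w => (!(P.assign C I v a w).op &&
      (P.assign C I v a w).marked) = true) =
      (Finset.univ.filter fun w => (!(I w).op && (I w).marked) = true) ∪
        if P.marked a then {v} else ∅ := by
    ext w
    by_cases hwv : w = v
    · subst hwv
      cases hm : P.marked a <;> simp [op_assign, marked_assign, hv, hm]
    · cases hm : P.marked a <;> simp [op_assign, marked_assign, hwv]
  rw [markCount, hset, Finset.card_union_of_disjoint, pow_add, markCount]
  · cases hm : P.marked a <;> simp [wt, hm]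
  · cases hm : P.marked a <;> simp [hv]

/-- Branching on whether `v` has the colour `a`. -/
theorem val_branch (hC : C.IsGraph) (hP : P.IsSymm) (hv : (I v).op = true)
    (ha : a ∈ (I v).cols) :
    P.val C I = P.val C (P.assign C I v a) + P.val C (forbid I v a) := by
  classical
  have hmf : markCount (forbid I v a) = markCount I :=
    markCount_eq fun w => by rw [op_forbid, marked_forbid]
  rw [val, val, val, hmf, markCount_assign hv, mul_assoc, ← Nat.mul_add]
  congr 1
  rw [← Finset.sum_filter_add_sum_filter_not (Finset.univ.filter fun φ => P.Valid C I φ)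
    (fun φ => φ v = some a)]
  congr 1
  · rw [Finset.mul_sum]
    refine Finset.sum_bij' (fun φ _ => Function.update φ v none)
      (fun φ _ => Function.update φ v (some a)) (fun φ hφ => ?_) (fun φ hφ => ?_) (fun φ hφ => ?_)
      (fun φ hφ => ?_) (fun φ hφ => ?_)
    · simp only [Finset.mem_filter, Finset.mem_univ, true_and] at hφ ⊢
      rw [valid_assign hC hP hv ha]
      refine ⟨by simp, ?_⟩
      rw [Function.update_idem, ← hφ.2, Function.update_eq_self]
      exact hφ.1
    · simp only [Finset.mem_filter, Finset.mem_univ, true_and] at hφ ⊢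
      exact ⟨((valid_assign hC hP hv ha).1 hφ).2, by simp⟩
    · simp only [Finset.mem_filter, Finset.mem_univ, true_and] at hφ
      rw [Function.update_idem, ← hφ.2, Function.update_eq_self]
    · simp only [Finset.mem_filter, Finset.mem_univ, true_and] at hφ
      rw [Function.update_idem, ← ((valid_assign hC hP hv ha).1 hφ).1, Function.update_eq_self]
    · simp only [Finset.mem_filter, Finset.mem_univ, true_and] at hφ
      rw [← Finset.mul_prod_erase _ _ (Finset.mem_univ v),
        ← Finset.mul_prod_erase _ (fun w => P.wt C.B (Function.update φ v none w))
          (Finset.mem_univ v), hφ.2, Function.update_self]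
      simp only [wt, one_mul]
      congr 1
      refine Finset.prod_congr rfl fun w hw => ?_
      rw [Function.update_of_ne (Finset.ne_of_mem_erase hw)]
  · refine Finset.sum_congr ?_ fun _ _ => rfl
    ext φ
    simp [valid_forbid, hv]

/-- A set of open vertices without edges to other open vertices can be treated separately. -/
theorem val_split (hC : C.IsGraph) {S : Fin C.n → Bool} (hS : ∀ w, S w = true → (I w).op = true)
    (hadj : ∀ z w, S z = true → C.A z w = true → (I w).op = true → S w = true) (x : Fin C.n) :
    P.val C I = P.val C (inner C I S x) * P.val C (outer I S) := by
  classical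
  have opI : ∀ w, (inner C I S x w).op = S w := fun w => rfl
  have colsI : ∀ w, (inner C I S x w).cols = (I w).cols := fun w => rfl
  have opO : ∀ w, (outer I S w).op = ((I w).op && !S w) := fun w => by
    cases h : S w <;> simp [outer, h, VState.op]
  have colsO : ∀ w, (outer I S w).cols = (I w).cols := fun w => by
    cases h : S w <;> simp [outer, h, VState.cols]
  have hmI : markCount (inner C I S x) = 0 := by
    simp [markCount, inner, VState.marked]
  have hmO : markCount (outer I S) = markCount I := markCount_eq fun w => by
    rw [opO]
    cases h : S w
    · simp [outer, h]
    · simp [outer, h, hS w h, VState.marked]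
  rw [val, val, val, hmI, hmO, pow_zero, one_mul, mul_left_comm]
  congr 1
  rw [Finset.sum_mul_sum, ← Finset.sum_product']
  refine Finset.sum_bij' (fun φ _ => (fun w => if S w then φ w else none,
      fun w => if S w then none else φ w))
    (fun p _ => fun w => if S w then p.1 w else p.2 w) (fun φ hφ => ?_) (fun p hp => ?_)
    (fun φ hφ => ?_) (fun p hp => ?_) (fun φ hφ => ?_)
  · simp only [Finset.mem_filter, Finset.mem_univ, true_and, Finset.mem_product] at hφ ⊢
    obtain ⟨h₁, h₂, h₃⟩ := hφ
    refine ⟨⟨fun w hw => ?_, fun w hw => ?_, fun u w b c huw hb hc => ?_⟩,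
      fun w hw => ?_, fun w hw => ?_, fun u w b c huw hb hc => ?_⟩
    · rw [opI] at hw
      simp [hw]
    · rw [opI] at hw
      rw [colsI]
      simpa [hw] using h₂ w (hS w hw)
    · cases hu : S u <;> cases hw : S w <;> simp [hu, hw] at hb hc
      exact h₃ u w b c huw hb hc
    · rw [opO] at hw
      cases hs : S w
      · simpa [hs] using h₁ w (by simpa [hs] using hw)
      · simp
    · rw [opO, Bool.and_eq_true] at hw
      have hs : S w = false := by simpa using hw.2
      rw [colsO]
      simpa [hs] using h₂ w hw.1
    · cases hu : S u <;> cases hw : S w <;> simp [hu, hw] at hb hc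
      exact h₃ u w b c huw hb hc
  · simp only [Finset.mem_filter, Finset.mem_univ, true_and, Finset.mem_product] at hp ⊢
    obtain ⟨⟨h₁, h₂, h₃⟩, h₄, h₅, h₆⟩ := hp
    -- Vertices with a colour in the second part are open.
    have hop : ∀ w b, p.2 w = some b → (I w).op = true := by
      intro w b hb
      by_contra ho
      rw [h₄ w (by rw [opO]; simp [ho])] at hb
      simp at hb
    refine ⟨fun w hw => ?_, fun w hw => ?_, fun u w b c huw hb hc => ?_⟩
    · have hs : S w = false := by
        by_contra hs
        rw [hS w (by simpa using hs)] at hw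
        simp at hw
      simpa [hs] using h₄ w (by rw [opO]; simp [hw])
    · cases hs : S w
      · simpa [colsO] using h₅ w (by rw [opO]; simp [hw, hs])
      · simpa [colsI] using h₂ w (by rw [opI, hs])
    · cases hu : S u <;> cases hw : S w <;> simp [hu, hw] at hb hc
      · exact h₆ u w b c huw hb hc
      · rw [hC.symm] at huw
        rw [hadj w u hw huw (hop u b hb)] at hu
        simp at hu
      · rw [hadj u w hu huw (hop w c hc)] at hw
        simp at hw
      · exact h₃ u w b c huw hb hc
  · funext w
    cases hs : S w <;> simp [hs]
  · simp only [Finset.mem_filter, Finset.mem_univ, true_and, Finset.mem_product] at hp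
    obtain ⟨⟨h₁, -, -⟩, h₄, -, -⟩ := hp
    ext1
    · funext w
      cases hs : S w
      · simp [hs, h₁ w (by rw [opI, hs])]
      · simp [hs]
    · funext w
      cases hs : S w
      · simp [hs]
      · simp [hs, h₄ w (by rw [opO]; simp [hs])]
  · rw [← Finset.prod_mul_distrib]
    refine Finset.prod_congr rfl fun w _ => ?_
    cases hs : S w <;> simp [hs, wt]

theorem val_dead (hI : isDead I = true) : P.val C I = 0 := by
  classical
  simp only [isDead, Bool.and_eq_true, decide_eq_true_eq] at hI
  obtain ⟨v, hv, hv'⟩ := hI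
  rw [val, Finset.filter_eq_empty_iff.2, Finset.sum_empty, mul_zero]
  intro φ _ hφ
  obtain ⟨a, ha, -⟩ := hφ.isOpen v hv
  simp [hv'] at ha

theorem val_closed (hI : ∀ v, (I v).op = false) : P.val C I = C.B ^ markCount I := by
  classical
  rw [val, Finset.sum_eq_single fun _ => none]
  · simp [wt]
  · intro φ hφ hne
    simp only [Finset.mem_filter, Finset.mem_univ, true_and] at hφ
    exact absurd (funext fun v => hφ.closed v (hI v)) hne
  · intro hφ
    refine absurd ?_ hφ
    simp only [Finset.mem_filter, Finset.mem_univ, true_and]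
    exact ⟨fun _ _ => rfl, fun v hv => by simp [hI v] at hv, fun _ _ _ _ _ h => by simp at h⟩

theorem cand_of_pick (h₂ : P.pickColour C I v = some a) :
    P.cand C I v a = true :=
  List.find?_some h₂

theorem exists_pickColour (h₁ : P.pickVertex C I = some v) : ∃ a, P.pickColour C I v = some a := by
  have h₃ := List.find?_some h₁
  rw [decide_eq_true_eq] at h₃
  obtain ⟨a, ha⟩ := h₃
  rw [← Option.isSome_iff_exists, pickColour, List.find?_isSome]
  exact ⟨a, by simp, ha⟩

theorem cand_eq_true : P.cand C I v a = true ↔ (I v).op = true ∧ a ∈ (I v).cols ∧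
    if hasFrontier I then (I v).fr = true else (I v).cols.card = 1 ∨ C.d ≤ P.defect C I v a := by
  cases hf : hasFrontier I <;> simp [cand, hf, and_assoc]

theorem not_cand (h₁ : P.pickVertex C I = none) (v : Fin C.n) (a : Fin h) :
    P.cand C I v a = false := by
  have := List.find?_eq_none.1 h₁ v (by simp)
  simpa using (by simpa using this : ∀ a, P.cand C I v a = false) a

end Palette

theorem op_of_firstOpen {n : ℕ} {I : Inst h n} {x : Fin n} (hx : firstOpen I = some x) :
    (I x).op = true :=
  List.find?_some (p := fun v => (I v).op) hx

theorem closed_of_firstOpen {n : ℕ} {I : Inst h n} (hI : firstOpen I = none) (v : Fin n) :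
    (I v).op = false := by
  simpa using List.find?_eq_none.1 hI v (by simp)

/-- The recursion computes the solution. -/
theorem Palette.Evals.eq_val (hC : C.IsGraph) (hP : P.IsSymm) {k z : ℕ} (hI : P.Evals C I z k) :
    z = P.val C I := by
  -- The possible results of a single expansion.
  have key : ∀ I : Inst h C.n, (∃ z, P.expand C I = .leaf z ∧ P.val C I = z) ∨
      (∃ J J', P.expand C I = .add J J' ∧ P.val C I = P.val C J + P.val C J') ∨
      ∃ J J', P.expand C I = .mul J J' ∧ P.val C I = P.val C J * P.val C J' := by
    intro I
    cases h₁ : isDead I with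
    | true => exact .inl ⟨0, expand_dead h₁, val_dead h₁⟩
    | false =>
      cases h₂ : P.pickVertex C I with
      | some v =>
        obtain ⟨a, ha⟩ := exists_pickColour h₂
        obtain ⟨hv, ha', -⟩ := cand_eq_true.1 (cand_of_pick ha)
        exact .inr (.inl ⟨_, _, expand_add h₁ h₂ ha, val_branch hC hP hv ha'⟩)
      | none =>
        cases h₃ : firstOpen I with
        | none => exact .inl ⟨_, expand_closed h₁ h₂ h₃, val_closed (closed_of_firstOpen h₃)⟩
        | some x =>
          exact .inr (.inr ⟨_, _, expand_mul h₁ h₂ h₃, val_split hC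
            (fun w => op_of_mem_component (op_of_firstOpen h₃))
            (fun z w => mem_component_of_adj) x⟩)
  induction hI with
  | @leaf I v he =>
    rcases key I with ⟨z, h₁, h₂⟩ | ⟨J, J', h₁, h₂⟩ | ⟨J, J', h₁, h₂⟩ <;> rw [he] at h₁ <;> simp_all
  | @add I J J' _ _ _ _ he _ _ ih ih' =>
    rcases key I with ⟨z, h₁, h₂⟩ | ⟨J, J', h₁, h₂⟩ | ⟨J, J', h₁, h₂⟩ <;> rw [he] at h₁ <;> simp_all
  | @mul I J J' _ _ _ _ he _ _ ih ih' =>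
    rcases key I with ⟨z, h₁, h₂⟩ | ⟨J, J', h₁, h₂⟩ | ⟨J, J', h₁, h₂⟩ <;> rw [he] at h₁ <;> simp_all

end

/-! ### Induced paths -/

/-- The list `l` of vertices is an induced path. -/
def IsInducedPath (C : Ctx) : List (Fin C.n) → Prop
  | [] => True
  | v :: l => IsInducedPath C l ∧ v ∉ l ∧ ∀ w ∈ l, C.A v w = true ↔ l.head? = some w

namespace IsInducedPath

variable {C : Ctx} {l : List (Fin C.n)}

theorem drop (hl : IsInducedPath C l) (i : ℕ) : IsInducedPath C (l.drop i) := by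
  induction l generalizing i with
  | nil => simpa using hl
  | cons v l ih =>
    cases i with
    | zero => exact hl
    | succ i => exact ih hl.1 i

theorem nodup (hl : IsInducedPath C l) : l.Nodup := by
  induction l with
  | nil => exact List.nodup_nil
  | cons v l ih => exact List.nodup_cons.2 ⟨hl.2.1, ih hl.1⟩

theorem adj_iff (hl : IsInducedPath C l) {i j : ℕ} (hi : i < j) (hj : j < l.length) :
    C.A l[i] l[j] = true ↔ i + 1 = j := by
  induction l generalizing i j with
  | nil => simp at hj
  | cons v l ih =>
    obtain ⟨j, rfl⟩ := Nat.exists_eq_succ_of_ne_zero (by omega : j ≠ 0)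
    simp only [List.length_cons] at hj
    have hj' : j < l.length := by omega
    cases i with
    | succ i =>
      simp only [List.getElem_cons_succ]
      rw [ih hl.1 (by omega) hj']
      omega
    | zero =>
      simp only [List.getElem_cons_succ, List.getElem_cons_zero]
      rw [hl.2.2 _ (List.getElem_mem hj'), List.head?_eq_getElem?,
        List.getElem?_eq_some_iff]
      constructor
      · rintro ⟨h₁, h₂⟩
        have := (hl.1.nodup.getElem_inj_iff).1 h₂
        omega
      · intro h
        obtain rfl : j = 0 := by omega
        exact ⟨hj', rfl⟩

/-- An induced path in the given sense is the image of an embedding of the path graph. -/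
theorem length_lt {n t : ℕ} {G : SimpleGraph (Fin n)} (hG : IsPathFree t G)
    {l : List (Fin (Input.ctx ⟨n, G, t⟩).n)} (hl : IsInducedPath (Input.ctx ⟨n, G, t⟩) l) :
    l.length < t := by
  by_contra! hlt
  have hl' := hl.drop (l.length - t)
  have hlen : (l.drop (l.length - t)).length = t := by
    rw [List.length_drop]
    omega
  set l' := l.drop (l.length - t)
  have hadj : ∀ u v : Fin n, (Input.ctx ⟨n, G, t⟩).A u v = true ↔ G.Adj u v := fun u v => by
    simp [Input.ctx]
  let f : Fin t → Fin n := fun i => l'[i.val]'(by omega)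
  refine hG ⟨⟨⟨f, fun i j hij => Fin.ext ((hl'.nodup.getElem_inj_iff).1 hij)⟩, fun {i j} => ?_⟩⟩
  change G.Adj (f i) (f j) ↔ _
  rw [SimpleGraph.pathGraph_adj]
  rcases lt_trichotomy i.val j.val with h | h | h
  · rw [← hadj]
    refine (hl'.adj_iff h (by omega)).trans ?_
    omega
  · obtain rfl := Fin.ext h
    simp
  · rw [SimpleGraph.adj_comm, ← hadj]
    refine (hl'.adj_iff h (by omega)).trans ?_
    omega

end IsInducedPath

/-! ### The number of nodes in the second phase -/

section

variable {h : ℕ}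

/-- The recursion tree of `I` has at most `N` nodes. -/
def Palette.Small (P : Palette h) (C : Ctx) (I : Inst h C.n) (N : ℕ) : Prop :=
  ∃ z k, P.Evals C I z k ∧ k ≤ N

variable {P : Palette h} {C : Ctx} {I J : Inst h C.n} {v x : Fin C.n} {a : Fin h} {N N' : ℕ}

namespace Palette.Small

theorem mono (hI : P.Small C I N) (hN : N ≤ N') : P.Small C I N' :=
  let ⟨z, k, hz, hk⟩ := hI
  ⟨z, k, hz, hk.trans hN⟩

theorem of_leaf {z : ℕ} (hI : P.expand C I = .leaf z) (hN : 1 ≤ N) : P.Small C I N :=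
  ⟨z, 1, .leaf hI, hN⟩

theorem of_add {J' : Inst h C.n} (hI : P.expand C I = .add J J') (hJ : P.Small C J N)
    (hJ' : P.Small C J' N') : P.Small C I (N + N' + 1) :=
  let ⟨_, _, hz, hk⟩ := hJ
  let ⟨_, _, hz', hk'⟩ := hJ'
  ⟨_, _, .add hI hz hz', by omega⟩

theorem of_mul {J' : Inst h C.n} (hI : P.expand C I = .mul J J') (hJ : P.Small C J N)
    (hJ' : P.Small C J' N') : P.Small C I (N + N' + 1) :=
  let ⟨_, _, hz, hk⟩ := hJ
  let ⟨_, _, hz', hk'⟩ := hJ'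
  ⟨_, _, .mul hI hz hz', by omega⟩

end Palette.Small

/-- The factor that the frontier contributes to the number of nodes. -/
def frontierFactor {n : ℕ} (I : Inst h n) : ℕ :=
  ∏ v, if (I v).op = true ∧ (I v).fr = true then 2 * (I v).cols.card + 1 else 1

/-- The number of open vertices outside the frontier. -/
def innerCount {n : ℕ} (I : Inst h n) : ℕ :=
  (Finset.univ.filter fun v => (I v).op = true ∧ (I v).fr = false).card

/-- The total number of colours and open vertices. -/
def openSize {n : ℕ} (I : Inst h n) : ℕ := ∑ v, if (I v).op = true then (I v).cols.card + 1 else 0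

open Classical in
/-- A measure that decreases in each step of the second phase. The second summand takes care of
instances with a connected graph of open vertices and an empty frontier, where only the frontier
changes. -/
def rank {n : ℕ} (I : Inst h n) : ℕ :=
  2 * openSize I + if ∃ v, (I v).op = true ∧ (I v).fr = true then 0 else 1

theorem frontierFactor_pos {n : ℕ} (I : Inst h n) : 0 < frontierFactor I :=
  Finset.prod_pos fun v _ => by split_ifs <;> omega

theorem openSize_assign_lt (hv : (I v).op = true) : openSize (P.assign C I v a) < openSize I := by
  refine Finset.sum_lt_sum (fun w _ => ?_) ⟨v, Finset.mem_univ v, ?_⟩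
  · have := Finset.card_le_card (Palette.cols_assign_subset (P := P) (C := C) (I := I) (v := v)
      (w := w) (a := a))
    rw [Palette.op_assign]
    cases (I w).op <;> by_cases h : w = v <;> simp [h] at *
    omega
  · simp [Palette.op_assign, hv]

theorem card_cols_forbid (ha : a ∈ (I v).cols) :
    (forbid I v a v).cols.card + 1 = (I v).cols.card := by
  rw [forbid_self]
  exact Finset.card_erase_add_one ha

theorem openSize_forbid_lt (hv : (I v).op = true) (ha : a ∈ (I v).cols) :
    openSize (forbid I v a) < openSize I := by
  refine Finset.sum_lt_sum (fun w _ => ?_) ⟨v, Finset.mem_univ v, ?_⟩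
  · have := Finset.card_le_card (cols_forbid_subset (I := I) (v := v) (w := w) (a := a))
    rw [op_forbid]
    cases (I w).op <;> simp
    omega
  · have := card_cols_forbid ha
    simp only [op_forbid, hv, if_true]
    omega

theorem rank_assign_lt (hv : (I v).op = true) : rank (P.assign C I v a) < rank I := by
  have := openSize_assign_lt (P := P) (a := a) hv
  unfold rank
  split_ifs <;> omega

theorem rank_forbid_lt (hv : (I v).op = true) (ha : a ∈ (I v).cols) :
    rank (forbid I v a) < rank I := by
  have := openSize_forbid_lt hv ha
  unfold rank
  simp only [op_forbid, fr_forbid]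
  omega

section

variable {S : Fin C.n → Bool}

theorem op_inner {w : Fin C.n} : (inner C I S x w).op = S w := rfl

theorem fr_inner {w : Fin C.n} : (inner C I S x w).fr = newFrontier C I S x w := rfl

theorem cols_inner {w : Fin C.n} : (inner C I S x w).cols = (I w).cols := rfl

theorem op_outer {w : Fin C.n} : (outer I S w).op = ((I w).op && !S w) := by
  cases h : S w <;> simp [outer, h, VState.op]

theorem fr_outer {w : Fin C.n} : (outer I S w).fr = (I w).fr := by
  cases h : S w <;> simp [outer, h, VState.fr]

theorem cols_outer {w : Fin C.n} : (outer I S w).cols = (I w).cols := by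
  cases h : S w <;> simp [outer, h, VState.cols]

theorem openSize_inner_le (hS : ∀ w, S w = true → (I w).op = true) :
    openSize (inner C I S x) ≤ openSize I := by
  refine Finset.sum_le_sum fun w _ => ?_
  rw [op_inner, cols_inner]
  cases hs : S w
  · simp
  · simp [hS w hs]

theorem openSize_outer_lt (hS : ∀ w, S w = true → (I w).op = true) (hx : S x = true) :
    openSize (outer I S) < openSize I := by
  refine Finset.sum_lt_sum (fun w _ => ?_) ⟨x, Finset.mem_univ x, ?_⟩
  · rw [op_outer, cols_outer]
    cases S w <;> cases (I w).op <;> simp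
  · simp [op_outer, hx, hS x hx]

end

/-- The invariants of the second phase. The vertices of the frontier continue an induced path `p`,
the other open vertices are neither on `p` nor adjacent to it, and each component of the open
vertices has contact to the frontier. Everything happens inside a fixed set `U`. -/
structure Exploring (C : Ctx) (I : Inst h C.n) (U : Finset (Fin C.n)) (p : List (Fin C.n)) :
    Prop where
  mem : ∀ v, (I v).op = true ∨ (I v).fr = true → v ∈ U
  path : ∀ v, (I v).fr = true → IsInducedPath C (v :: p)
  avoids : ∀ v, (I v).op = true → (I v).fr = false → v ∉ p ∧ ∀ w ∈ p, C.A v w = false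
  contact : ∀ S : Fin C.n → Prop, (∃ u, S u) → (∀ u, S u → (I u).op = true) →
    (∀ z w, S z → C.A z w = true → (I w).op = true → S w) →
    ∃ u, S u ∧ ((I u).fr = true ∨ ∃ q, (I q).fr = true ∧ C.A q u = true)
  nonempty : ∃ v, (I v).fr = true

namespace Exploring

variable {U : Finset (Fin C.n)} {p : List (Fin C.n)}

theorem of_assign (hI : Exploring C I U p) (hC : C.IsGraph) (hf : (I v).fr = true) :
    Exploring C (P.assign C I v a) U p := by
  obtain ⟨h₁, h₂, h₃, h₄, h₅⟩ := hI
  refine ⟨fun w hw => h₁ w ?_, fun w hw => h₂ w (by rwa [Palette.fr_assign] at hw),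
    fun w ho hw => h₃ w ?_ (by rwa [Palette.fr_assign] at hw), fun S hS hS' hadj => ?_,
    by simpa only [Palette.fr_assign] using h₅⟩
  · rw [Palette.op_assign, Palette.fr_assign, Bool.and_eq_true] at hw
    exact hw.imp_left And.left
  · rw [Palette.op_assign, Bool.and_eq_true] at ho
    exact ho.1
  · simp only [Palette.fr_assign]
    by_cases hv : ∃ z, S z ∧ C.A z v = true
    · obtain ⟨z, hz, hzv⟩ := hv
      exact ⟨z, hz, .inr ⟨v, hf, by rwa [hC.symm]⟩⟩
    · refine h₄ S hS (fun u hu => ?_) fun z w hz hzw hw => hadj z w hz hzw ?_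
      · have := hS' u hu
        rw [Palette.op_assign, Bool.and_eq_true] at this
        exact this.1
      · have : w ≠ v := by
          rintro rfl
          exact hv ⟨z, hz, hzw⟩
        simp [Palette.op_assign, hw, this]

theorem of_forbid (hI : Exploring C I U p) : Exploring C (forbid I v a) U p := by
  obtain ⟨h₁, h₂, h₃, h₄, h₅⟩ := hI
  constructor <;> simpa only [op_forbid, fr_forbid]

/-- If the frontier consists of closed vertices, the components of the open vertices can be treated
one after another. -/
theorem of_outer (hI : Exploring C I U p) (hC : C.IsGraph) :
    Exploring C (outer I (component C I x)) U p := by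
  obtain ⟨h₁, h₂, h₃, h₄, h₅⟩ := hI
  refine ⟨fun w hw => h₁ w ?_, fun w hw => h₂ w (by rwa [fr_outer] at hw),
    fun w ho hw => h₃ w ?_ (by rwa [fr_outer] at hw), fun S hS hS' hadj => ?_,
    by simpa only [fr_outer] using h₅⟩
  · rw [op_outer, fr_outer, Bool.and_eq_true] at hw
    exact hw.imp_left And.left
  · rw [op_outer, Bool.and_eq_true] at ho
    exact ho.1
  · simp only [fr_outer]
    simp only [op_outer, Bool.and_eq_true] at hS' hadj
    refine h₄ S hS (fun u hu => (hS' u hu).1) fun z w hz hzw hw => hadj z w hz hzw ⟨hw, ?_⟩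
    by_contra hs
    have hs' : component C I x w = true := by simpa using hs
    have := mem_component_of_adj hs' (by rwa [hC.symm] : C.A w z = true) (hS' z hz).1
    simpa [this] using (hS' z hz).2

/-- Sets that are closed under adjacency inside a component contain this component. -/
theorem eq_component (hC : C.IsGraph) {S : Fin C.n → Prop} (hS : ∃ u, S u)
    (hS' : ∀ u, S u → component C I x u = true)
    (hadj : ∀ z w, S z → C.A z w = true → component C I x w = true → S w)
    {w : Fin C.n} (hw : component C I x w = true) : S w := by
  have hSx : S x := by
    by_contra hSx
    obtain ⟨u, hu⟩ := hS
    refine (component_induction (C := C) (I := I) (x := x)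
      (Q := fun w => component C I x w = true ∧ ¬ S w) ⟨self_mem_component, hSx⟩ ?_ (hS' u hu)).2 hu
    rintro z w ⟨hz, hz'⟩ hzw hw
    exact ⟨mem_component_of_adj hz hzw hw, fun hSw => hz' (hadj w z hSw (by rwa [hC.symm]) hz)⟩
  exact (component_induction (C := C) (I := I) (x := x)
    (Q := fun w => component C I x w = true ∧ S w) ⟨self_mem_component, hSx⟩
    (fun z w hz hzw hw => ⟨mem_component_of_adj hz.1 hzw hw,
      hadj z w hz.2 hzw (mem_component_of_adj hz.1 hzw hw)⟩) hw).2

/-- When the algorithm descends into a component, the path is prolonged by the pivot. -/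
theorem of_inner (hI : Exploring C I U p) (hC : C.IsGraph) (hx : (I x).op = true)
    (hF : ∀ w, (I w).op = true → (I w).fr = false) {q : Fin C.n}
    (hq : nextPivot C I (component C I x) = some q) :
    Exploring C (inner C I (component C I x) x) U (q :: p) := by
  have hop : ∀ w, component C I x w = true → (I w).op = true := fun w => op_of_mem_component hx
  obtain ⟨h₁, h₂, h₃, h₄, h₅⟩ := hI
  have hq' := List.find?_some hq
  rw [Bool.and_eq_true, decide_eq_true_eq] at hq'
  obtain ⟨hqf, f, hf⟩ := hq'
  rw [Bool.and_eq_true] at hf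
  have hfr : ∀ w, newFrontier C I (component C I x) x w = (C.A q w && component C I x w) := by
    intro w
    simp [newFrontier, hq]
  have hne : ∀ w, component C I x w = true → w ≠ q := by
    rintro w hw rfl
    simp [hF w (hop w hw)] at hqf
  refine ⟨fun w hw => ?_, fun w hw => ?_, fun w ho hw => ?_, fun S hS hS' hadj => ?_,
    ⟨f, by rw [fr_inner, hfr, hf.1, hf.2]; rfl⟩⟩
  · rw [op_inner, fr_inner, hfr, Bool.and_eq_true] at hw
    exact h₁ w (.inl (hop w (hw.elim id And.right)))
  · rw [fr_inner, hfr, Bool.and_eq_true] at hw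
    obtain ⟨hw₁, hw₂⟩ := h₃ w (hop w hw.2) (hF w (hop w hw.2))
    refine ⟨h₂ q hqf, ?_, fun y hy => ?_⟩
    · rw [List.mem_cons, not_or]
      exact ⟨hne w hw.2, hw₁⟩
    · rw [List.head?_cons, Option.some_inj]
      rcases List.mem_cons.1 hy with rfl | hy
      · simp [hC.symm w, hw.1]
      · rw [hw₂ y hy]
        simp only [Bool.false_eq_true, false_iff]
        rintro rfl
        exact (h₂ q hqf).2.1 hy
  · rw [op_inner] at ho
    rw [fr_inner, hfr, ho, Bool.and_true] at hw
    obtain ⟨hw₁, hw₂⟩ := h₃ w (hop w ho) (hF w (hop w ho))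
    refine ⟨?_, fun y hy => ?_⟩
    · rw [List.mem_cons, not_or]
      exact ⟨hne w ho, hw₁⟩
    · rcases List.mem_cons.1 hy with rfl | hy
      · rwa [hC.symm]
      · exact hw₂ y hy
  · exact ⟨f, eq_component hC hS hS' hadj hf.2, .inl (by rw [fr_inner, hfr, hf.1, hf.2]; rfl)⟩

end Exploring

theorem frontierFactor_branch (hv : (I v).op = true) (hf : (I v).fr = true) (ha : a ∈ (I v).cols)
    {X : ℕ} (hX : 0 < X) : frontierFactor (P.assign C I v a) * X +
      frontierFactor (forbid I v a) * X + 1 ≤ frontierFactor I * X := by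
  let r : ℕ := ∏ w ∈ Finset.univ.erase v,
    if (I w).op = true ∧ (I w).fr = true then 2 * (I w).cols.card + 1 else 1
  have hr : 0 < r := Finset.prod_pos fun v _ => by split_ifs <;> omega
  have h₀ : frontierFactor I = (2 * (I v).cols.card + 1) * r := by
    rw [frontierFactor, ← Finset.mul_prod_erase _ _ (Finset.mem_univ v)]
    simp [hv, hf, r]
  have h₁ : frontierFactor (P.assign C I v a) ≤ r := by
    rw [frontierFactor, ← Finset.mul_prod_erase _ _ (Finset.mem_univ v)]
    simp only [Palette.op_assign, decide_true, Bool.not_true, Bool.and_false, Bool.false_eq_true,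
      false_and, if_false, one_mul]
    refine Finset.prod_le_prod' fun w hw => ?_
    have := Finset.card_le_card (Palette.cols_assign_subset (P := P) (C := C) (I := I) (v := v)
      (w := w) (a := a))
    simp only [Palette.fr_assign, Finset.ne_of_mem_erase hw, decide_false, Bool.not_false,
      Bool.and_true]
    split_ifs <;> omega
  have h₂ : frontierFactor (forbid I v a) + 2 * r = (2 * (I v).cols.card + 1) * r := by
    rw [frontierFactor, ← Finset.mul_prod_erase _ _ (Finset.mem_univ v)]
    simp only [op_forbid, fr_forbid, hv, hf, and_self, if_true]
    rw [← card_cols_forbid ha]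
    have : ∏ w ∈ Finset.univ.erase v, (if (I w).op = true ∧ (I w).fr = true then
        2 * (PathFreeColouring.forbid I v a w).cols.card + 1 else 1) = r :=
      Finset.prod_congr rfl fun w hw => by rw [forbid_of_ne (Finset.ne_of_mem_erase hw)]
    rw [this]
    ring
  rw [h₀, ← h₂]
  nlinarith [Nat.mul_le_mul_right X h₁, Nat.mul_pos hr hX]

open Classical in
/-- In the second phase, the recursion depth is bounded by the length of the induced paths and the
branching is bounded by the degrees. -/
theorem Exploring.small (hC : C.IsGraph) {U : Finset (Fin C.n)} {Δ τ : ℕ}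
    (hU : ∀ v ∈ U, (U.filter fun w => C.A v w = true).card ≤ Δ)
    (hτ : ∀ l, IsInducedPath C l → l.length < τ) {p : List (Fin C.n)}
    (hI : Exploring C I U p) : P.Small C I
      (frontierFactor I * (1 + innerCount I * (2 * (2 * h + 1) ^ (Δ * (τ - p.length))))) := by
  induction hr : rank I using Nat.strong_induction_on generalizing I p with
  | _ r ih =>
  subst hr
  set X := (2 * h + 1) ^ (Δ * (τ - p.length)) with hX
  have hXpos : 0 < X := by positivity
  have hpos : 1 ≤ frontierFactor I * (1 + innerCount I * (2 * X)) :=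
    Nat.mul_pos (frontierFactor_pos I) (by omega)
  have hfront : Palette.hasFrontier I = true := by
    simpa [Palette.hasFrontier] using hI.nonempty
  cases h₁ : isDead I with
  | true => exact .of_leaf (Palette.expand_dead h₁) hpos
  | false =>
  cases h₂ : P.pickVertex C I with
  | some v =>
    obtain ⟨a, ha⟩ := Palette.exists_pickColour h₂
    obtain ⟨hv, ha', hf⟩ := Palette.cand_eq_true.1 (Palette.cand_of_pick ha)
    rw [hfront] at hf
    replace hf : (I v).fr = true := hf
    have ih₁ := ih _ (rank_assign_lt hv) (hI.of_assign (P := P) (a := a) hC hf) rfl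
    have ih₂ := ih _ (rank_forbid_lt hv ha') (hI.of_forbid (v := v) (a := a)) rfl
    have e₂ : innerCount (forbid I v a) = innerCount I := by
      simp only [innerCount, op_forbid, fr_forbid]
    have e₁ : innerCount (P.assign C I v a) ≤ innerCount I := by
      refine Finset.card_le_card fun w hw => ?_
      simp only [Finset.mem_filter, Finset.mem_univ, true_and, Palette.op_assign,
        Palette.fr_assign, Bool.and_eq_true] at hw ⊢
      exact ⟨hw.1.1, hw.2⟩
    rw [e₂] at ih₂
    replace ih₁ := ih₁.mono (Nat.mul_le_mul_left _ (Nat.add_le_add_left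
      (Nat.mul_le_mul_right _ e₁) 1))
    exact (Palette.Small.of_add (Palette.expand_add h₁ h₂ ha) ih₁ ih₂).mono
      (frontierFactor_branch hv hf ha' (by omega))
  | none =>
  cases h₃ : firstOpen I with
  | none => exact .of_leaf (Palette.expand_closed h₁ h₂ h₃) hpos
  | some x =>
    have hx := op_of_firstOpen h₃
    have hF : ∀ w, (I w).op = true → (I w).fr = false := by
      intro w hw
      by_contra hf
      have hne : (I w).cols ≠ ∅ := by
        intro h₀
        have : isDead I = true := by
          simp only [isDead, decide_eq_true_eq, Bool.and_eq_true]
          exact ⟨w, hw, h₀⟩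
        simp [this] at h₁
      obtain ⟨a, ha⟩ := Finset.nonempty_iff_ne_empty.2 hne
      have : P.cand C I w a = true :=
        Palette.cand_eq_true.2 ⟨hw, ha, by rw [hfront]; simpa using hf⟩
      simp [Palette.not_cand h₂] at this
    have hop : ∀ w, component C I x w = true → (I w).op = true := fun w => op_of_mem_component hx
    obtain ⟨u, hu, hu'⟩ := hI.contact (fun w => component C I x w = true) ⟨x, self_mem_component⟩
      hop (fun z w => mem_component_of_adj)
    simp only [hF u (hop u hu), Bool.false_eq_true, false_or] at hu'
    obtain ⟨q', hq'⟩ := hu'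
    have hq : ∃ q, nextPivot C I (component C I x) = some q := by
      rw [← Option.isSome_iff_exists, nextPivot, List.find?_isSome]
      refine ⟨q', by simp, ?_⟩
      rw [Bool.and_eq_true, decide_eq_true_eq]
      exact ⟨hq'.1, u, by rw [hq'.2, hu]; rfl⟩
    obtain ⟨q, hq⟩ := hq
    have hqs := List.find?_some hq
    rw [Bool.and_eq_true, decide_eq_true_eq] at hqs
    obtain ⟨hqf, f, hf⟩ := hqs
    rw [Bool.and_eq_true] at hf
    set S := component C I x with hS
    have hfr : ∀ w, newFrontier C I S x w = (C.A q w && S w) := by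
      intro w
      simp [newFrontier, hq]
    have hlen := hτ _ (hI.path q hqf)
    simp only [List.length_cons] at hlen
    have hnoF : ¬ ∃ v, (I v).op = true ∧ (I v).fr = true := by
      rintro ⟨v, hv, hv'⟩
      simp [hF v hv] at hv'
    have r₁ : rank (inner C I S x) < rank I := by
      have := openSize_inner_le (x := x) hop
      have hF' : ∃ v, (inner C I S x v).op = true ∧ (inner C I S x v).fr = true :=
        ⟨f, hf.2, by rw [fr_inner, hfr, hf.1, hf.2]; rfl⟩
      rw [rank, rank, if_pos hF', if_neg hnoF]
      omega
    have r₂ : rank (outer I S) < rank I := by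
      have := openSize_outer_lt hop self_mem_component
      rw [rank, rank, if_neg hnoF]
      split_ifs <;> omega
    let Y := (2 * h + 1) ^ (Δ * (τ - (q :: p).length))
    have hY : Y = (2 * h + 1) ^ (Δ * (τ - (q :: p).length)) := rfl
    have ih₁ : P.Small C (inner C I S x)
        (frontierFactor (inner C I S x) * (1 + innerCount (inner C I S x) * (2 * Y))) :=
      ih _ r₁ (hI.of_inner hC hx hF hq) rfl
    have ih₂ : P.Small C (outer I S)
        (frontierFactor (outer I S) * (1 + innerCount (outer I S) * (2 * X))) :=
      ih _ r₂ (hI.of_outer (x := x) hC) rfl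
    have hYpos : 0 < Y := by positivity
    have hXY : X = (2 * h + 1) ^ Δ * Y := by
      rw [hX, hY, ← pow_add, List.length_cons]
      congr 1
      rw [show τ - p.length = τ - (p.length + 1) + 1 by omega]
      ring
    have f₁ : frontierFactor (inner C I S x) ≤ (2 * h + 1) ^ Δ := by
      rw [frontierFactor, ← Finset.prod_filter]
      refine (Finset.prod_le_pow_card _ _ (2 * h + 1) fun w _ => ?_).trans
        (Nat.pow_le_pow_right (by omega) (le_trans (Finset.card_le_card ?_)
          (hU q (hI.mem q (.inr hqf)))))
      · have : (inner C I S x w).cols.card ≤ h := (Finset.card_le_univ _).trans (by simp)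
        omega
      · intro w hw
        simp only [Finset.mem_filter, Finset.mem_univ, true_and, op_inner, fr_inner, hfr,
          Bool.and_eq_true] at hw ⊢
        exact ⟨hI.mem w (.inl (hop w hw.1)), hw.2.1⟩
    have f₂ : ∀ J : Inst h C.n, (∀ w, (J w).op = true → (J w).fr = false) →
        frontierFactor J = 1 := fun J hJ => Finset.prod_eq_one fun w _ => by
      rw [if_neg]
      rintro ⟨h₁, h₂⟩
      simp [hJ w h₁] at h₂
    have c : innerCount (inner C I S x) + 1 + innerCount (outer I S) ≤ innerCount I := by
      have hd : Disjoint (Finset.univ.filter fun w => S w = true)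
          (Finset.univ.filter fun w => (outer I S w).op = true ∧ (outer I S w).fr = false) := by
        refine Finset.disjoint_filter.2 fun w _ hs hw => ?_
        simp [op_outer, hs] at hw
      have hsub : insert f (Finset.univ.filter fun w => (inner C I S x w).op = true ∧
          (inner C I S x w).fr = false) ⊆ Finset.univ.filter fun w => S w = true := by
        intro w hw
        rw [Finset.mem_insert, Finset.mem_filter] at hw
        simp only [Finset.mem_filter, Finset.mem_univ, true_and]
        rcases hw with rfl | hw
        exacts [hf.2, hw.2.1]
      have hc := Finset.card_le_card hsub
      rw [Finset.card_insert_of_notMem (by simp [fr_inner, hfr, hf.1, hf.2])] at hc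
      refine le_trans (Nat.add_le_add_right hc _) ?_
      rw [innerCount, ← Finset.card_union_of_disjoint hd]
      refine Finset.card_le_card fun w hw => ?_
      simp only [Finset.mem_union, Finset.mem_filter, Finset.mem_univ, true_and, op_outer,
        fr_outer, Bool.and_eq_true] at hw ⊢
      rcases hw with hw | hw
      exacts [⟨hop w hw, hF w (hop w hw)⟩, ⟨hw.1.1, hw.2⟩]
    refine (Palette.Small.of_mul (Palette.expand_mul h₁ h₂ h₃) ih₁ ih₂).mono ?_
    rw [f₂ I hF, f₂ (outer I S) fun w hw => by
      rw [op_outer, Bool.and_eq_true] at hw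
      rw [fr_outer]
      exact hF w hw.1, one_mul, one_mul]
    have g₁ : frontierFactor (inner C I S x) * (1 + innerCount (inner C I S x) * (2 * Y)) ≤
        X + innerCount (inner C I S x) * (2 * X) := by
      calc _ ≤ (2 * h + 1) ^ Δ * (1 + innerCount (inner C I S x) * (2 * Y)) :=
            Nat.mul_le_mul_right _ f₁
        _ = (2 * h + 1) ^ Δ * 1 + innerCount (inner C I S x) * (2 * X) := by rw [hXY]; ring
        _ ≤ _ := Nat.add_le_add_right (by rw [hXY]; exact Nat.mul_le_mul_left _ hYpos) _
    have g₂ := Nat.mul_le_mul_right (2 * X) c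
    rw [add_mul, add_mul] at g₂
    omega

end

/-! ### The number of nodes in the first phase -/

section

variable {h : ℕ} {P : Palette h} {C : Ctx} {I : Inst h C.n} {v x : Fin C.n} {a : Fin h}

/-- The total number of colours that are available at the open vertices. -/
def budget {n : ℕ} (I : Inst h n) : ℕ := ∑ v, if (I v).op = true then (I v).cols.card else 0

theorem budget_le {n : ℕ} (I : Inst h n) : budget I ≤ h * n := by
  refine (Finset.sum_le_card_nsmul _ _ h fun v _ => ?_).trans (by simp [mul_comm])
  have : (I v).cols.card ≤ h := (Finset.card_le_univ _).trans (by simp)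
  split_ifs <;> omega

theorem budget_forbid_lt (hv : (I v).op = true) (ha : a ∈ (I v).cols) :
    budget (forbid I v a) < budget I := by
  refine Finset.sum_lt_sum (fun w _ => ?_) ⟨v, Finset.mem_univ v, ?_⟩
  · have := Finset.card_le_card (cols_forbid_subset (I := I) (v := v) (w := w) (a := a))
    rw [op_forbid]
    split_ifs <;> omega
  · have := card_cols_forbid ha
    simp only [op_forbid, hv, if_true]
    omega

theorem budget_assign_lt (hv : (I v).op = true) (ha : a ∈ (I v).cols) :
    budget (P.assign C I v a) < budget I := by
  refine Finset.sum_lt_sum (fun w _ => ?_) ⟨v, Finset.mem_univ v, ?_⟩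
  · have := Finset.card_le_card (Palette.cols_assign_subset (P := P) (C := C) (I := I) (v := v)
      (w := w) (a := a))
    simp only [Palette.op_assign, Bool.and_eq_true]
    split_ifs <;> simp_all
  · simpa [Palette.op_assign, hv] using ⟨a, ha⟩

/-- Each neighbour that is counted by the defect loses a colour. -/
theorem budget_assign_add_le (hC : C.IsGraph) :
    budget (P.assign C I v a) + P.defect C I v a ≤ budget I := by
  rw [budget, budget, Palette.defect, Finset.card_filter, ← Finset.sum_add_distrib]
  refine Finset.sum_le_sum fun w _ => ?_
  by_cases hwv : w = v
  · subst hwv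
    simp [Palette.op_assign, hC.irrefl]
  · have hsub := Palette.cols_assign_subset (P := P) (C := C) (I := I) (v := v) (w := w) (a := a)
    have hle := Finset.card_le_card hsub
    cases ho : (I w).op with
    | false => simp [Palette.op_assign, ho]
    | true =>
      simp only [Palette.op_assign, ho, hwv, decide_false, Bool.not_false, Bool.and_true, if_true,
        Bool.true_and]
      split_ifs with hd
      · simp only [Bool.and_eq_true, Bool.not_eq_true', decide_eq_false_iff_not] at hd
        refine Finset.card_lt_card ⟨hsub, fun hsub' => hd.2 fun b hb => ?_⟩
        have := hsub' hb
        rw [Palette.assign_of_adj hwv hd.1] at this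
        exact (Finset.mem_inter.1 this).2
      · omega

theorem budget_outer_lt {S : Fin C.n → Bool} (hS : ∀ w, S w = true → (I w).op = true)
    (hx : S x = true) (hne : (I x).cols ≠ ∅) : budget (outer I S) < budget I := by
  refine Finset.sum_lt_sum (fun w _ => ?_) ⟨x, Finset.mem_univ x, ?_⟩
  · rw [op_outer, cols_outer]
    cases S w <;> cases (I w).op <;> simp
  · simpa [op_outer, hx, hS x hx] using Finset.nonempty_iff_ne_empty.2 hne

/-- Any two different colours have at most one common neighbour. -/
def Palette.IsQuadFree (P : Palette h) : Prop :=
  ∀ a b c c', a ≠ b → P.R a c = true → P.R b c = true → P.R a c' = true → P.R b c' = true → c = c'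

theorem cols_ne_empty (hI : isDead I = false) (hv : (I v).op = true) : (I v).cols ≠ ∅ := by
  intro h₀
  have : isDead I = true := by
    simp only [isDead, decide_eq_true_eq, Bool.and_eq_true]
    exact ⟨v, hv, h₀⟩
  simp [this] at hI

/-- If no branching is possible in the first phase, the open vertices have small degrees: each of
them has two colours `a` and `b`, and each neighbour has two colours as well, which cannot both be
compatible with both `a` and `b`. -/
theorem degree_le (hP : P.IsQuadFree) (hfr : ∀ v, (I v).fr = false) (h₁ : isDead I = false)
    (h₂ : P.pickVertex C I = none) (hv : (I v).op = true) :
    (Finset.univ.filter fun w => (I w).op = true ∧ C.A v w = true).card ≤ 2 * C.d := by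
  have hno : Palette.hasFrontier I = false := by simp [Palette.hasFrontier, hfr]
  have hcard : ∀ w, (I w).op = true → ∃ a ∈ (I w).cols, ∃ b ∈ (I w).cols, a ≠ b := by
    intro w hw
    rw [← Finset.one_lt_card]
    obtain ⟨a, ha⟩ := Finset.nonempty_iff_ne_empty.2 (cols_ne_empty h₁ hw)
    have h₃ := Palette.not_cand h₂ w a
    have h₄ : (I w).cols.card ≠ 1 := by
      intro h₄
      rw [Palette.cand_eq_true.2 ⟨hw, ha, by rw [hno]; simp [h₄]⟩] at h₃
      simp at h₃
    have := Finset.card_pos.2 ⟨a, ha⟩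
    omega
  have hdef : ∀ a ∈ (I v).cols, P.defect C I v a ≤ C.d := by
    intro a ha
    by_contra hd
    have h₃ := Palette.not_cand h₂ v a
    rw [Palette.cand_eq_true.2 ⟨hv, ha, by rw [hno]; simp; omega⟩] at h₃
    simp at h₃
  obtain ⟨a, ha, b, hb, hab⟩ := hcard v hv
  have hsub : (Finset.univ.filter fun w => (I w).op = true ∧ C.A v w = true) ⊆
      (Finset.univ.filter fun w =>
        (C.A v w && ((I w).op && !decide ((I w).cols ⊆ P.nbhd a))) = true) ∪
      (Finset.univ.filter fun w =>
        (C.A v w && ((I w).op && !decide ((I w).cols ⊆ P.nbhd b))) = true) := by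
    intro w hw
    replace hw := (Finset.mem_filter.1 hw).2
    simp only [Finset.mem_filter, Finset.mem_univ, true_and, Finset.mem_union, Bool.and_eq_true,
      Bool.not_eq_true', decide_eq_false_iff_not]
    simp only [hw.1, hw.2, true_and]
    by_contra! hcon
    obtain ⟨c, hc, c', hc', hne⟩ := hcard w hw.1
    exact hne (hP a b c c' hab (Palette.mem_nbhd.1 (hcon.1 hc)) (Palette.mem_nbhd.1 (hcon.2 hc))
      (Palette.mem_nbhd.1 (hcon.1 hc')) (Palette.mem_nbhd.1 (hcon.2 hc')))
  have h₃ := (Finset.card_le_card hsub).trans (Finset.card_union_le _ _)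
  have h₄ := hdef a ha
  have h₅ := hdef b hb
  rw [Palette.defect] at h₄ h₅
  omega

/-- The start of the second phase. -/
theorem Exploring.of_start (hC : C.IsGraph) (hfr : ∀ v, (I v).fr = false) (hx : (I x).op = true) :
    Exploring C (inner C I (component C I x) x)
      (Finset.univ.filter fun v => (I v).op = true) [] := by
  have hop : ∀ w, component C I x w = true → (I w).op = true := fun w => op_of_mem_component hx
  have hF : ∀ w, newFrontier C I (component C I x) x w = decide (w = x) := by
    intro w
    have : nextPivot C I (component C I x) = none := by
      simp [nextPivot, List.find?_eq_none, hfr]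
    simp [newFrontier, this]
  refine ⟨fun w hw => ?_, fun w _ => ⟨trivial, by simp, by simp⟩, fun w _ _ => by simp,
    fun S hS hS' hadj => ?_, ⟨x, by rw [fr_inner, hF]; simp⟩⟩
  · rw [op_inner, fr_inner, hF, decide_eq_true_eq] at hw
    simp only [Finset.mem_filter, Finset.mem_univ, true_and]
    rcases hw with hw | rfl
    exacts [hop w hw, hx]
  · exact ⟨x, eq_component hC hS hS' hadj self_mem_component,
      .inl (by rw [fr_inner, hF]; simp)⟩

/-- The number of nodes below a subproblem with which the second phase starts. -/
def startBound (h n d τ : ℕ) : ℕ := (2 * h + 1) * (1 + n * (2 * (2 * h + 1) ^ (2 * d * τ)))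

theorem Exploring.small_start (hC : C.IsGraph) (hP : P.IsQuadFree) {τ : ℕ}
    (hτ : ∀ l, IsInducedPath C l → l.length < τ) (hfr : ∀ v, (I v).fr = false)
    (h₁ : isDead I = false) (h₂ : P.pickVertex C I = none) (hx : (I x).op = true) :
    P.Small C (PathFreeColouring.inner C I (component C I x) x) (startBound h C.n C.d τ) := by
  refine (Exploring.small (Δ := 2 * C.d) hC (fun v hv => ?_) hτ (of_start hC hfr hx)).mono ?_
  · simp only [Finset.mem_filter, Finset.mem_univ, true_and] at hv
    rw [Finset.filter_filter]
    exact degree_le hP hfr h₁ h₂ hv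
  · have hF : ∀ w, newFrontier C I (component C I x) x w = decide (w = x) := by
      intro w
      have : nextPivot C I (component C I x) = none := by
        simp [nextPivot, List.find?_eq_none, hfr]
      simp [newFrontier, this]
    refine Nat.mul_le_mul ?_ (Nat.add_le_add_left (Nat.mul_le_mul ?_ le_rfl) 1)
    · rw [frontierFactor, ← Finset.prod_filter]
      refine (Finset.prod_le_pow_card _ _ (2 * h + 1) fun w _ => ?_).trans
        ((Nat.pow_le_pow_right (by omega) (?_ : _ ≤ 1)).trans (by simp))
      · have : (PathFreeColouring.inner C I (component C I x) x w).cols.card ≤ h :=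
          (Finset.card_le_univ _).trans (by simp)
        omega
      · refine Finset.card_le_one.2 fun w hw w' hw' => ?_
        simp only [Finset.mem_filter, Finset.mem_univ, true_and, fr_inner, hF,
          decide_eq_true_eq] at hw hw'
        rw [hw.2, hw'.2]
    · exact (Finset.card_le_univ _).trans (by simp)

/-- In the first phase, the recursion tree has few branches in which a vertex receives a colour that
affects many neighbours, since this uses up the budget. -/
theorem Palette.small_of_budget (hC : C.IsGraph) (hP : P.IsQuadFree) {τ : ℕ} (hd : 0 < C.d)
    (hτ : ∀ l, IsInducedPath C l → l.length < τ) (hfr : ∀ v, (I v).fr = false) :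
    P.Small C I ((2 * budget I + 1) *
      (startBound h C.n C.d τ * (h * C.n + 1) ^ (budget I / C.d))) := by
  induction hm : budget I using Nat.strong_induction_on generalizing I with
  | _ m ih =>
  subst hm
  set M := startBound h C.n C.d τ
  set q := h * C.n + 1 with hq
  have hM : 0 < M := Nat.mul_pos (by omega) (by omega)
  have hqpos : ∀ k, 0 < M * q ^ k := fun k => Nat.mul_pos hM (by positivity)
  have hstep : ∀ m', m' < budget I → (2 * m' + 1) * (M * q ^ (m' / C.d)) +
      2 * (M * q ^ (budget I / C.d)) ≤ (2 * budget I + 1) * (M * q ^ (budget I / C.d)) := by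
    intro m' hm'
    have h₁ : M * q ^ (m' / C.d) ≤ M * q ^ (budget I / C.d) :=
      Nat.mul_le_mul_left _ (Nat.pow_le_pow_right (by omega) (Nat.div_le_div_right hm'.le))
    calc _ ≤ (2 * m' + 1) * (M * q ^ (budget I / C.d)) + 2 * (M * q ^ (budget I / C.d)) :=
          Nat.add_le_add_right (Nat.mul_le_mul_left _ h₁) _
      _ = (2 * m' + 3) * (M * q ^ (budget I / C.d)) := by ring
      _ ≤ _ := Nat.mul_le_mul_right _ (by omega)
  have hpos : 1 ≤ (2 * budget I + 1) * (M * q ^ (budget I / C.d)) :=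
    Nat.mul_pos (by omega) (hqpos _)
  have hpos' := hqpos (budget I / C.d)
  have hno : hasFrontier I = false := by simp [hasFrontier, hfr]
  cases h₁ : isDead I with
  | true => exact .of_leaf (expand_dead h₁) hpos
  | false =>
  cases h₂ : P.pickVertex C I with
  | some v =>
    obtain ⟨a, ha⟩ := exists_pickColour h₂
    obtain ⟨hv, ha', hor⟩ := cand_eq_true.1 (cand_of_pick ha)
    replace hor : (I v).cols.card = 1 ∨ C.d ≤ P.defect C I v a := by simpa [hno] using hor
    have b₁ := budget_assign_lt (P := P) hv ha'
    have b₂ := budget_forbid_lt hv ha'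
    have ih₁ := ih _ b₁ (fun w => by rw [fr_assign, hfr]) rfl
    rcases hor with hor | hor
    · have hdead : isDead (forbid I v a) = true := by
        simp only [isDead, decide_eq_true_eq, Bool.and_eq_true]
        refine ⟨v, by rw [op_forbid, hv], ?_⟩
        have := card_cols_forbid ha'
        rw [← Finset.card_eq_zero]
        omega
      have := hstep _ b₁
      exact (Small.of_add (expand_add h₁ h₂ ha) ih₁
        (.of_leaf (expand_dead hdead) le_rfl)).mono (by omega)
    · have ih₂ := ih _ b₂ (fun w => by rw [fr_forbid, hfr]) rfl
      refine (Small.of_add (expand_add h₁ h₂ ha) ih₁ ih₂).mono ?_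
      have h₃ := hstep _ b₂
      have h₄ := budget_assign_add_le (P := P) (I := I) (v := v) (a := a) hC
      set m' := budget (P.assign C I v a)
      have h₅ : m' / C.d + 1 ≤ budget I / C.d := by
        rw [← Nat.add_div_right m' hd]
        exact Nat.div_le_div_right (by omega)
      have h₆ : (2 * m' + 1) * (M * q ^ (m' / C.d)) + 1 ≤ 2 * (M * q ^ (budget I / C.d)) := by
        calc _ ≤ (2 * m' + 1) * (M * q ^ (m' / C.d)) + M * q ^ (m' / C.d) :=
              Nat.add_le_add_left (hqpos _) _
          _ = 2 * ((m' + 1) * (M * q ^ (m' / C.d))) := by ring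
          _ ≤ 2 * (q * (M * q ^ (m' / C.d))) := by
              have := budget_le I
              gcongr
              omega
          _ = 2 * (M * q ^ (m' / C.d + 1)) := by ring
          _ ≤ _ := Nat.mul_le_mul_left _
            (Nat.mul_le_mul_left _ (Nat.pow_le_pow_right (by omega) h₅))
      omega
  | none =>
  cases h₃ : firstOpen I with
  | none => exact .of_leaf (expand_closed h₁ h₂ h₃) hpos
  | some x =>
    have hx := op_of_firstOpen h₃
    have b := budget_outer_lt (fun w => op_of_mem_component hx) self_mem_component
      (cols_ne_empty h₁ hx) (S := component C I x)
    have ih₂ := ih _ b (fun w => by rw [fr_outer, hfr]) rfl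
    refine (Small.of_mul (expand_mul h₁ h₂ h₃)
      (Exploring.small_start hC hP hτ hfr h₁ h₂ hx) ih₂).mono ?_
    have h₄ := hstep _ b
    have h₅ : M ≤ M * q ^ (budget I / C.d) := Nat.le_mul_of_pos_right _ (by positivity)
    omega

/-- A bound for the number of nodes of the whole recursion tree. -/
def nodeBound (h t n : ℕ) : ℕ := (2 * (h * n) + 1) *
  (startBound h n (threshold t n) (min t (n + 1)) * (h * n + 1) ^ (h * n / threshold t n))

open Classical in
theorem Input.isGraph_ctx (x : Input) : x.ctx.IsGraph :=
  ⟨fun u v => decide_eq_decide.2 (x.G.adj_comm u v),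
    fun v => decide_eq_false (x.G.loopless.irrefl v)⟩

theorem Palette.small_initInst (hP : P.IsQuadFree) {n t : ℕ} {G : SimpleGraph (Fin n)}
    (hG : IsPathFree t G) : P.Small (Input.ctx ⟨n, G, t⟩) (initInst h n) (nodeBound h t n) := by
  have hτ : ∀ l, IsInducedPath (Input.ctx ⟨n, G, t⟩) l → l.length < min t (n + 1) := fun l hl => by
    have h₁ := hl.length_lt hG
    have h₂ : l.length ≤ n := by
      have := hl.nodup.length_le_card
      rwa [Fintype.card_fin] at this
    omega
  have hb : budget (initInst h n) = h * n := by
    simp [budget, initInst, VState.op, VState.cols, mul_comm]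
  have := small_of_budget (P := P) (I := initInst h n) (Input.isGraph_ctx ⟨n, G, t⟩) hP
    (by simp [Input.ctx, threshold]) hτ fun v => rfl
  rw [show budget (n := (Input.ctx ⟨n, G, t⟩).n) (initInst h n) = h * n from hb] at this
  exact this

open Classical in
/-- The solution of the first subproblem counts all homomorphisms to the colour graph. -/
theorem Palette.val_initInst (P : Palette h) {n t : ℕ} (G : SimpleGraph (Fin n)) :
    P.val (Input.ctx ⟨n, G, t⟩) (initInst h n) =
      ∑ f : Fin n → Fin h with ∀ u v, G.Adj u v → P.R (f u) (f v) = true,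
        (2 ^ (n + 1)) ^ (Finset.univ.filter fun v => P.marked (f v) = true).card := by
  have hm : markCount (initInst h n) = 0 := by
    simp [markCount, initInst, VState.op]
  have hval : P.val (Input.ctx ⟨n, G, t⟩) (initInst h n) =
    (2 ^ (n + 1)) ^ markCount (initInst h n) *
    ∑ φ with P.Valid (Input.ctx ⟨n, G, t⟩) (initInst h n) φ,
      ∏ v, P.wt (2 ^ (n + 1)) (φ v) := rfl
  rw [hval, hm, pow_zero, one_mul]
  refine (Finset.sum_bij (fun f _ v => some (f v)) (fun f hf => ?_) (fun f _ g _ hfg => ?_)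
    (fun φ hφ => ?_) (fun f _ => ?_)).symm
  · replace hf := (Finset.mem_filter.1 hf).2
    refine Finset.mem_filter.2 ⟨Finset.mem_univ _, fun v hv => by simp [initInst, VState.op] at hv,
      fun v _ => ⟨f v, by simp [initInst, VState.cols], rfl⟩, fun u v a b huv ha hb => ?_⟩
    rw [Option.some_inj] at ha hb
    rw [← ha, ← hb]
    exact hf u v (of_decide_eq_true huv)
  · funext v
    exact Option.some_inj.1 (congrFun hfg v)
  · replace hφ := (Finset.mem_filter.1 hφ).2
    have : ∀ v, ∃ a, φ v = some a := fun v =>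
      let ⟨a, _, ha⟩ := hφ.isOpen v rfl
      ⟨a, ha⟩
    choose f hf using this
    refine ⟨f, Finset.mem_filter.2 ⟨Finset.mem_univ _, fun u v huv => ?_⟩,
      funext fun v => (hf v).symm⟩
    exact hφ.adj u v _ _ (decide_eq_true huv) (hf u) (hf v)
  · have : ∀ v, P.wt (2 ^ (n + 1)) (some (f v)) =
        if P.marked (f v) = true then 2 ^ (n + 1) else 1 := fun v => by
      cases h : P.marked (f v) <;> simp [wt, h]
    simp only [Input.ctx, this, Finset.prod_ite, Finset.prod_const, one_pow, mul_one]
    rfl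

end

/-! ### Asymptotic estimates -/

/-- `f t n` is at most `exp (c * √(t * n * log n))` for some constant `c`. -/
def SqrtExp (f : ℕ → ℕ → ℕ) : Prop :=
  ∃ c : ℝ, 0 ≤ c ∧ ∀ t n : ℕ, 1 ≤ t → 2 ≤ n →
    (f t n : ℝ) ≤ Real.exp (c * √((t : ℝ) * n * Real.log n))

section

variable {t n : ℕ}

theorem half_le_log (hn : 2 ≤ n) : (1 / 2 : ℝ) ≤ Real.log n := by
  have h₁ : Real.log 2 ≤ Real.log n := Real.log_le_log (by norm_num) (by exact_mod_cast hn)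
  have := Real.log_two_gt_d9
  linarith

theorem sqrt_mul_le (hn : 2 ≤ n) : √((t : ℝ) * n) ≤ 2 * √((t : ℝ) * n * Real.log n) := by
  rw [show (2 : ℝ) = √4 by rw [show (4 : ℝ) = 2 ^ 2 by norm_num]; simp,
    ← Real.sqrt_mul (by norm_num)]
  refine Real.sqrt_le_sqrt ?_
  have := half_le_log hn
  have h₀ : (0 : ℝ) ≤ t * n := by positivity
  nlinarith

theorem natSize_le_log (hn : 2 ≤ n) : (n.size : ℝ) ≤ 3 * Real.log n := by
  have h₁ : 2 ^ (n.size - 1) ≤ n := Nat.lt_size.1 (by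
    have := Nat.size_pos.2 (by omega : 0 < n)
    omega)
  have h₂ : ((n.size - 1 : ℕ) : ℝ) * Real.log 2 ≤ Real.log n := by
    rw [← Real.log_pow]
    exact Real.log_le_log (by positivity) (by exact_mod_cast h₁)
  have h₃ : (n.size : ℝ) ≤ ((n.size - 1 : ℕ) : ℝ) + 1 := by
    have : n.size ≤ n.size - 1 + 1 := by omega
    exact_mod_cast this
  have h₄ := Real.log_two_gt_d9
  have h₅ : Real.log 2 ≤ Real.log n := Real.log_le_log (by norm_num) (by exact_mod_cast hn)
  nlinarith

theorem log_le_natSize (n : ℕ) : Real.log n ≤ n.size := by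
  rcases Nat.eq_zero_or_pos n with rfl | hn
  · simp
  have h₁ : Real.log n ≤ Real.log ((2 : ℝ) ^ n.size) :=
    Real.log_le_log (by exact_mod_cast hn) (by exact_mod_cast (Nat.lt_size_self n).le)
  rw [Real.log_pow] at h₁
  have h₂ := Real.log_two_lt_d9
  have h₃ : (0 : ℝ) ≤ n.size := by positivity
  nlinarith

/-- The threshold is at least `√(n * log n / t)`. -/
theorem mul_log_le (ht : 1 ≤ t) (hn : 2 ≤ n) :
    n * Real.log n ≤ threshold t n * √((t : ℝ) * n * Real.log n) := by
  have h₁ : n * n.size ≤ threshold t n * threshold t n * t := by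
    have := Nat.lt_succ_sqrt (n * n.size / t)
    rw [Nat.div_lt_iff_lt_mul ht] at this
    exact this.le
  have h₂ : (n : ℝ) * n.size ≤ threshold t n * threshold t n * t := by exact_mod_cast h₁
  have h₃ := log_le_natSize n
  have h₄ := half_le_log hn
  have h₅ : (0 : ℝ) ≤ n * Real.log n := by positivity
  refine le_of_sq_le_sq ?_ (by positivity)
  rw [mul_pow _ (√_), Real.sq_sqrt (by positivity)]
  calc (n * Real.log n) ^ 2 = n * Real.log n * (n * Real.log n) := by ring
    _ ≤ n * n.size * (n * Real.log n) := by gcongr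
    _ ≤ threshold t n * threshold t n * t * (n * Real.log n) := by gcongr
    _ = _ := by ring

/-- The threshold is at most about `√(n * log n / t)`. -/
theorem threshold_mul_le (ht : 1 ≤ t) (hn : 2 ≤ n) :
    (threshold t n : ℝ) * (min t (n + 1) : ℕ) ≤ 5 * √((t : ℝ) * n * Real.log n) := by
  set s := √((t : ℝ) * n * Real.log n)
  have hs : 0 ≤ s := Real.sqrt_nonneg _
  have hL := half_le_log hn
  have hsq : s ^ 2 = (t : ℝ) * n * Real.log n := Real.sq_sqrt (by positivity)
  set m := Nat.sqrt (n * n.size / t)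
  set τ := min t (n + 1)
  have h₁ : m * m * t ≤ n * n.size := by
    rw [← Nat.le_div_iff_mul_le ht]
    exact Nat.sqrt_le _
  have h₂ : (m : ℝ) * m * t ≤ n * n.size := by exact_mod_cast h₁
  have hτ₁ : (τ : ℝ) ≤ t := by exact_mod_cast min_le_left _ _
  have hτ₂ : (τ : ℝ) ≤ n + 1 := by exact_mod_cast min_le_right t (n + 1)
  have hn' : (2 : ℝ) ≤ n := by exact_mod_cast hn
  have ht' : (1 : ℝ) ≤ t := by exact_mod_cast ht
  have hτ₀ : (0 : ℝ) ≤ τ := by positivity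
  have e₁ : (m : ℝ) * τ ≤ 2 * s := by
    refine le_of_sq_le_sq ?_ (by positivity)
    calc ((m : ℝ) * τ) ^ 2 = m * m * (τ * τ) := by ring
      _ ≤ m * m * (t * t) := by gcongr
      _ = m * m * t * t := by ring
      _ ≤ n * n.size * t := by gcongr
      _ ≤ n * (3 * Real.log n) * t := by
          gcongr
          exact natSize_le_log hn
      _ ≤ (2 * s) ^ 2 := by
          rw [mul_pow, hsq]
          have : 0 ≤ (t : ℝ) * n * Real.log n := by positivity
          nlinarith
  have e₂ : (τ : ℝ) ≤ 3 * s := by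
    refine le_of_sq_le_sq ?_ (by positivity)
    calc (τ : ℝ) ^ 2 = τ * τ := by ring
      _ ≤ t * (n + 1) := by gcongr
      _ ≤ t * (2 * n) := by gcongr; linarith
      _ ≤ (3 * s) ^ 2 := by
          rw [mul_pow, hsq]
          have : 0 ≤ (t : ℝ) * n := by positivity
          nlinarith
  have e₃ : (threshold t n : ℝ) = m + 1 := by simp [threshold, m]
  rw [e₃]
  linarith

end

namespace SqrtExp

variable {f g : ℕ → ℕ → ℕ}

theorem of_le (hg : SqrtExp g) (h : ∀ t n, 1 ≤ t → 2 ≤ n → f t n ≤ g t n) : SqrtExp f :=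
  let ⟨c, hc, hg⟩ := hg
  ⟨c, hc, fun t n ht hn => le_trans (by exact_mod_cast h t n ht hn) (hg t n ht hn)⟩

theorem mul (hf : SqrtExp f) (hg : SqrtExp g) : SqrtExp fun t n => f t n * g t n :=
  let ⟨c, hc, hf⟩ := hf
  let ⟨c', hc', hg⟩ := hg
  ⟨c + c', by positivity, fun t n ht hn => by
    rw [Nat.cast_mul, add_mul, Real.exp_add]
    exact mul_le_mul (hf t n ht hn) (hg t n ht hn) (by positivity) (by positivity)⟩

theorem pow (hf : SqrtExp f) (k : ℕ) : SqrtExp fun t n => f t n ^ k :=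
  let ⟨c, hc, hf⟩ := hf
  ⟨k * c, by positivity, fun t n ht hn => by
    rw [Nat.cast_pow, mul_assoc, Real.exp_nat_mul]
    exact pow_le_pow_left₀ (by positivity) (hf t n ht hn) k⟩

/-- Powers with an exponent of the right order of magnitude. -/
theorem of_log_le {c : ℝ} (hc : 0 ≤ c) (h : ∀ t n : ℕ, 1 ≤ t → 2 ≤ n →
    Real.log (f t n) ≤ c * √((t : ℝ) * n * Real.log n)) : SqrtExp f :=
  ⟨c, hc, fun t n ht hn => by
    rcases Nat.eq_zero_or_pos (f t n) with h₀ | h₀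
    · rw [h₀, Nat.cast_zero]
      positivity
    · rw [← Real.log_le_iff_le_exp (by exact_mod_cast h₀)]
      exact h t n ht hn⟩

theorem mul_self : SqrtExp fun t n => t * n :=
  of_log_le (c := 4) (by norm_num) fun t n ht hn => by
    have h₀ : (0 : ℝ) < t * n := by
      have : 0 < t * n := Nat.mul_pos ht (by omega)
      exact_mod_cast this
    have h₁ := Real.log_le_sub_one_of_pos (Real.sqrt_pos.2 h₀)
    rw [Real.log_sqrt h₀.le] at h₁
    have h₂ := sqrt_mul_le (t := t) hn
    push_cast
    linarith

theorem left : SqrtExp fun t _ => t :=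
  mul_self.of_le fun t n _ hn => Nat.le_mul_of_pos_right t (by omega)

theorem right : SqrtExp fun _ n => n :=
  mul_self.of_le fun t n ht _ => Nat.le_mul_of_pos_left n (by omega)

theorem const (k : ℕ) : SqrtExp fun _ _ => k :=
  (right.pow k).of_le fun _ _ _ hn => (Nat.lt_two_pow_self).le.trans (Nat.pow_le_pow_left hn k)

theorem add (hf : SqrtExp f) (hg : SqrtExp g) : SqrtExp fun t n => f t n + g t n := by
  obtain ⟨c₂, hc₂, h₂⟩ := const 2
  obtain ⟨c, hc, hf⟩ := hf
  obtain ⟨c', hc', hg⟩ := hg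
  refine ⟨c₂ + (c + c'), by positivity, fun t n ht hn => ?_⟩
  have hs := Real.sqrt_nonneg ((t : ℝ) * n * Real.log n)
  have h₁ := hf t n ht hn
  have h₃ := hg t n ht hn
  have h₄ := h₂ t n ht hn
  have h₅ : Real.exp (c * √((t : ℝ) * n * Real.log n)) ≤
      Real.exp ((c + c') * √((t : ℝ) * n * Real.log n)) := by
    refine Real.exp_le_exp.2 ?_
    gcongr
    linarith
  have h₆ : Real.exp (c' * √((t : ℝ) * n * Real.log n)) ≤
      Real.exp ((c + c') * √((t : ℝ) * n * Real.log n)) := by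
    refine Real.exp_le_exp.2 ?_
    gcongr
    linarith
  have h₇ : (0 : ℝ) ≤ Real.exp ((c + c') * √((t : ℝ) * n * Real.log n)) := by positivity
  rw [add_mul, Real.exp_add]
  push_cast at h₄ ⊢
  nlinarith

end SqrtExp

theorem sqrtExp_nodeBound (h : ℕ) : SqrtExp (nodeBound h) := by
  have hn : SqrtExp fun _ n => h * n := (SqrtExp.const h).mul .right
  refine (((SqrtExp.const 2).mul hn).add (.const 1)).mul (.mul ?_ ?_)
  · refine (SqrtExp.const (2 * h + 1)).mul ((SqrtExp.const 1).add (SqrtExp.right.mul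
      ((SqrtExp.const 2).mul ?_)))
    refine .of_log_le (c := Real.log (2 * h + 1) * 10)
      (mul_nonneg (Real.log_nonneg (by linarith [h.cast_nonneg (α := ℝ)])) (by norm_num))
      fun t n ht hn => ?_
    have h₁ := threshold_mul_le ht hn
    have h₂ : 0 ≤ Real.log (2 * h + 1) := Real.log_nonneg (by linarith [h.cast_nonneg (α := ℝ)])
    rw [Nat.cast_pow, Real.log_pow]
    push_cast at h₁ ⊢
    nlinarith
  · refine .of_log_le (c := (2 * Real.log (h + 1) + 1) * h)
      (mul_nonneg (by linarith [Real.log_nonneg (by linarith [h.cast_nonneg (α := ℝ)] :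
        (1 : ℝ) ≤ h + 1)]) h.cast_nonneg) fun t n ht hn => ?_
    have hL := half_le_log hn
    have hn' : (2 : ℝ) ≤ n := by exact_mod_cast hn
    have hh : (0 : ℝ) ≤ h := h.cast_nonneg
    have hlh : 0 ≤ Real.log (h + 1) := Real.log_nonneg (by linarith)
    have hd : (0 : ℝ) < threshold t n := by simp [threshold]; positivity
    have h₁ : Real.log ((h * n + 1 : ℕ) : ℝ) ≤ (2 * Real.log (h + 1) + 1) * Real.log n := by
      calc Real.log ((h * n + 1 : ℕ) : ℝ) ≤ Real.log ((h + 1) * n) := by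
            refine Real.log_le_log (by positivity) ?_
            push_cast
            nlinarith
        _ = Real.log (h + 1) + Real.log n := Real.log_mul (by positivity) (by positivity)
        _ ≤ _ := by nlinarith
    have h₂ : ((h * n / threshold t n : ℕ) : ℝ) ≤ h * n / threshold t n := by
      refine Nat.cast_div_le.trans ?_
      push_cast
      exact le_rfl
    have h₃ : n * Real.log n / threshold t n ≤ √((t : ℝ) * n * Real.log n) := by
      rw [div_le_iff₀ hd, mul_comm (√_)]
      exact mul_log_le ht hn
    rw [Nat.cast_pow, Real.log_pow]
    calc ((h * n / threshold t n : ℕ) : ℝ) * Real.log ((h * n + 1 : ℕ) : ℝ) ≤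
          (h * n / threshold t n) * ((2 * Real.log (h + 1) + 1) * Real.log n) := by gcongr
      _ = (2 * Real.log (h + 1) + 1) * h * (n * Real.log n / threshold t n) := by ring
      _ ≤ _ := by gcongr

/-- A bound for the running time. -/
def timeBound (h K t n : ℕ) : ℕ :=
  if t = 0 then 0 else ((t + n + 2) * (nodeBound h t n + 1)) ^ K

theorem exists_sqrtExpBound (h K : ℕ) : ∃ C : ℝ, ∀ t, SqrtExpBound C t (timeBound h K t) := by
  obtain ⟨c, hc, hT⟩ : SqrtExp fun t n => ((t + n + 2) * (nodeBound h t n + 1)) ^ K :=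
    (((SqrtExp.left.add .right).add (.const 2)).mul ((sqrtExp_nodeBound h).add (.const 1))).pow K
  refine ⟨c / Real.log 2, fun t n hn => ?_⟩
  rw [timeBound]
  split_ifs with ht
  · simp only [Nat.cast_zero]
    positivity
  · refine (hT t n (by omega) hn).trans (le_of_eq ?_)
    have := Real.log_pos one_lt_two
    rw [Real.rpow_def_of_pos two_pos]
    congr 1
    field_simp

theorem SqrtExpBound.subexponential {C : ℝ} {t : ℕ} {T : ℕ → ℕ} (hT : SqrtExpBound C t T) :
    Subexponential T := by
  have hlog : (fun n : ℕ => Real.log n) =o[Filter.atTop] fun n : ℕ => (n : ℝ) :=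
    Real.isLittleO_log_id_atTop.comp_tendsto tendsto_natCast_atTop_atTop
  have hsqrt : (fun n : ℕ => √((t : ℝ) * n * Real.log n)) =o[Filter.atTop]
      fun n : ℕ => (n : ℝ) := by
    refine Asymptotics.isLittleO_iff.2 fun ε hε => ?_
    have hδ : 0 < ε ^ 2 / (t + 1) := by positivity
    filter_upwards [Asymptotics.isLittleO_iff.1 hlog hδ, Filter.eventually_ge_atTop 1] with n hn hn1
    have hn1' : (1 : ℝ) ≤ n := by exact_mod_cast hn1
    have hl : 0 ≤ Real.log n := Real.log_nonneg hn1'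
    rw [Real.norm_of_nonneg hl, Real.norm_of_nonneg (by positivity : (0 : ℝ) ≤ n)] at hn
    rw [Real.norm_of_nonneg (Real.sqrt_nonneg _), Real.norm_of_nonneg (by positivity : (0 : ℝ) ≤ n)]
    refine Real.sqrt_le_iff.2 ⟨by positivity, ?_⟩
    calc (t : ℝ) * n * Real.log n ≤ (t + 1) * n * (ε ^ 2 / (t + 1) * n) := by
          gcongr
          linarith
      _ = (ε * n) ^ 2 := by field_simp
  refine Asymptotics.IsBigO.trans_isLittleO
    (Asymptotics.IsBigO.of_bound (|C| * Real.log 2) ?_) hsqrt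
  filter_upwards [Filter.eventually_ge_atTop 2] with n hn
  have h2 := Real.log_pos one_lt_two
  rw [Real.norm_of_nonneg (Real.sqrt_nonneg _), Real.norm_of_nonneg (Real.log_natCast_nonneg _)]
  rcases Nat.eq_zero_or_pos (T n) with h₀ | h₀
  · rw [h₀, Nat.cast_zero, Real.log_zero]
    positivity
  · calc Real.log (T n) ≤ Real.log ((2 : ℝ) ^ (C * √((t : ℝ) * n * Real.log n))) :=
          Real.log_le_log (by exact_mod_cast h₀) (hT n hn)
      _ = C * √((t : ℝ) * n * Real.log n) * Real.log 2 := Real.log_rpow two_pos _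
      _ ≤ |C| * √((t : ℝ) * n * Real.log n) * Real.log 2 := by
          gcongr
          exact le_abs_self C
      _ = _ := by ring

open Polynomial

/-! ### Homomorphisms, independent sets, and colourings -/

open Classical in
/-- The sum of `2 ^ ((n + 1) * k)` over all homomorphisms from `G` to the colour graph, where `k` is
the number of vertices with a marked colour. -/
def Palette.homSum {h : ℕ} (P : Palette h) {n : ℕ} (G : SimpleGraph (Fin n)) : ℕ :=
  ∑ f : Fin n → Fin h with ∀ u v, G.Adj u v → P.R (f u) (f v) = true,
    (2 ^ (n + 1)) ^ (Finset.univ.filter fun v => P.marked (f v) = true).card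

/-- Whatever can be read off from `Palette.homSum` can be computed in subexponential time. -/
theorem Palette.exists_solvable {h : ℕ} {P : Palette h} (hS : P.IsSymm) (hQ : P.IsQuadFree)
    {β Γ : Type} [Finite Γ] {f : ∀ n : ℕ, SimpleGraph (Fin n) → β} {enc : β → List Γ}
    (w : Symb → Γ) (out : ℕ → ℕ → List Symb)
    (hout : Poly (fun x : ℕ × ℕ => .cons (unary x.1) (tbits x.2))
      fun x => tlist ((out x.1 x.2).map tsymb))
    (henc : ∀ n (G : SimpleGraph (Fin n)), enc (f n G) = (out n (P.homSum G)).map w) :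
    ∃ C : ℝ, ∀ t : ℕ, ∃ T : ℕ → ℕ, SqrtExpBound C t T ∧ Subexponential T ∧
      SolvableOnPathFree f enc t T := by
  obtain ⟨K, hK⟩ := exists_machine P w out hout
  obtain ⟨C, hC⟩ := exists_sqrtExpBound h K
  refine ⟨C, fun t => ⟨timeBound h K t, hC t, (hC t).subexponential, ?_⟩⟩
  obtain ⟨M, hM, hrun⟩ := hK t
  refine ⟨M, hM, fun n G hG => ?_⟩
  -- No graph is `P_0`-free.
  have ht : t ≠ 0 := by
    rintro rfl
    exact hG ⟨⟨⟨Fin.elim0, fun i => i.elim0⟩, fun {i} => i.elim0⟩⟩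
  obtain ⟨z, k, hz, hk⟩ := small_initInst hQ hG
  have hval := hz.eq_val (Input.isGraph_ctx _) hS
  rw [val_initInst] at hval
  obtain ⟨⟨r, hr⟩⟩ := hrun n G z k hz
  rw [henc, show P.homSum G = z from hval.symm]
  refine ⟨⟨r, hr.trans ?_⟩⟩
  rw [timeBound, if_neg ht]
  gcongr

/-- The conversion of digits to truth values. -/
def symbBool (s : Symb) : Bool := decide (s = 1)

theorem map_symbBool_digit (l : List Bool) : (l.map digit).map symbBool = l := by
  rw [List.map_map]
  refine (List.map_congr_left fun b _ => ?_).trans (List.map_id l)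
  cases b <;> rfl

/-- The palette that is given by a graph, without marked colours. -/
def graphPalette {h : ℕ} (H : SimpleGraph (Fin h)) : Palette h where
  R a b := by
    classical
    exact decide (H.Adj a b)
  marked _ := false

section

variable {h : ℕ} {H : SimpleGraph (Fin h)}

theorem graphPalette_R {a b : Fin h} : (graphPalette H).R a b = true ↔ H.Adj a b := by
  simp [graphPalette]

theorem graphPalette_isSymm : (graphPalette H).IsSymm := fun a b => by
  rw [Bool.eq_iff_iff, graphPalette_R, graphPalette_R, SimpleGraph.adj_comm]

theorem graphPalette_isQuadFree (hH : (SimpleGraph.cycleGraph 4).Free H) :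
    (graphPalette H).IsQuadFree := by
  intro a b c c' hab h₁ h₂ h₃ h₄
  rw [graphPalette_R] at h₁ h₂ h₃ h₄
  by_contra hcc
  let f : Fin 4 → Fin h := ![a, c, b, c']
  refine hH ⟨⟨⟨f, fun {i j} hij => ?_⟩, fun i j hij => ?_⟩⟩
  · fin_cases i <;> fin_cases j <;> revert hij <;>
      simp [f, SimpleGraph.cycleGraph_adj, h₁, h₂, h₃, h₄, h₁.symm, h₂.symm, h₃.symm, h₄.symm] <;>
      exact fun h => absurd h (by decide)
  · have := h₁.ne
    have := h₂.ne
    have := h₃.ne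
    have := h₄.ne
    fin_cases i <;> fin_cases j <;> revert hij <;> simp [f] <;> grind

theorem homSum_graphPalette {n : ℕ} (G : SimpleGraph (Fin n)) :
    (graphPalette H).homSum G = Nat.card (G →g H) := by
  classical
  have h₁ : (graphPalette H).homSum G =
      (Finset.univ.filter fun f : Fin n → Fin h => ∀ u v, G.Adj u v → H.Adj (f u) (f v)).card := by
    rw [Palette.homSum, Finset.card_eq_sum_ones]
    refine Finset.sum_congr (Finset.filter_congr fun f _ => ?_) fun f _ => ?_
    · simp only [graphPalette_R]
    · simp [graphPalette]
  rw [h₁, ← Fintype.card_subtype, ← Nat.card_eq_fintype_card]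
  exact Nat.card_congr ⟨fun f => ⟨f.1, fun {u v} => f.2 u v⟩,
    fun f => ⟨f, fun u v => f.map_rel⟩, fun f => rfl, fun f => rfl⟩

end

/-- Counting homomorphisms to a graph without a cycle of length `4`. -/
theorem exists_solvable_hom {W : Type*} [Finite W] (H : SimpleGraph W)
    (hH : (SimpleGraph.cycleGraph 4).Free H) :
    ∃ C : ℝ, ∀ t : ℕ, ∃ T : ℕ → ℕ, SqrtExpBound C t T ∧ Subexponential T ∧
      SolvableOnPathFree (fun _ G => Nat.card (G →g H)) Computability.encodeNat t T := by
  let e : W ≃ Fin (Nat.card W) := Finite.equivFin W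
  let H' : SimpleGraph (Fin (Nat.card W)) := H.map e.toEmbedding
  let i : H ≃g H' := SimpleGraph.Iso.map e H
  have hH' : (SimpleGraph.cycleGraph 4).Free H' :=
    fun ⟨c⟩ => hH ⟨i.symm.toCopy.comp c⟩
  refine Palette.exists_solvable (P := graphPalette H') graphPalette_isSymm
    (graphPalette_isQuadFree hH') symbBool
    (fun _ Z => Z.bits.map digit) poly_output_nat fun n G => ?_
  rw [map_symbBool_digit, encodeNat_eq_bits, homSum_graphPalette]
  congr 1
  exact Nat.card_congr ⟨fun f => i.toHom.comp f, fun f => i.symm.toHom.comp f,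
    fun f => by ext; simp, fun f => by ext; simp⟩

theorem cycleGraph_four_free_top : (SimpleGraph.cycleGraph 4).Free (⊤ : SimpleGraph (Fin 3)) := by
  rintro ⟨c⟩
  have := Fintype.card_le_of_injective c c.injective
  simp at this

theorem colorable_iff_homSum {n : ℕ} (G : SimpleGraph (Fin n)) :
    G.Colorable 3 ↔ (graphPalette (⊤ : SimpleGraph (Fin 3))).homSum G ≠ 0 := by
  rw [homSum_graphPalette, Nat.card_ne_zero]
  exact ⟨fun h => ⟨h, Finite.of_injective _ DFunLike.coe_injective⟩, And.left⟩

/-- Deciding whether a graph is `3`-colourable. -/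
theorem exists_solvable_colorable :
    ∃ C : ℝ, ∀ t : ℕ, ∃ T : ℕ → ℕ, SqrtExpBound C t T ∧ Subexponential T ∧
      SolvableOnPathFree (fun _ G => by classical exact decide (G.Colorable 3))
        Computability.encodeBool t T := by
  classical
  refine Palette.exists_solvable (P := graphPalette (⊤ : SimpleGraph (Fin 3))) graphPalette_isSymm
    (graphPalette_isQuadFree cycleGraph_four_free_top) symbBool
    (fun _ Z => [decide (Z ≠ 0)].map digit) poly_output_bool fun n G => ?_
  rw [map_symbBool_digit, Computability.encodeBool]
  congr 1
  rw [decide_eq_decide]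
  exact colorable_iff_homSum G

/-! ### The independent set polynomial -/

/-- The palette for independent sets: the members of the set have the marked colour `1`, which is
not compatible with itself. -/
def indepPalette : Palette 2 where
  R a b := !(decide (a = 1) && decide (b = 1))
  marked a := decide (a = 1)

theorem indepPalette_isSymm : indepPalette.IsSymm := by
  unfold Palette.IsSymm
  decide

theorem indepPalette_isQuadFree : indepPalette.IsQuadFree := by
  unfold Palette.IsQuadFree
  decide

section

variable {n : ℕ} (G : SimpleGraph (Fin n))

open Classical in
theorem indepSetPoly_eq : indepSetPoly G =
    ∑ S ∈ Finset.univ.filter fun S : Finset (Fin n) => G.IsIndepSet (S : Set (Fin n)),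
      X ^ S.card := by
  rw [indepSetPoly, Finset.sum_filter]
  exact Finset.sum_congr rfl fun S _ => by congr

theorem homSum_indepPalette : indepPalette.homSum G = (indepSetPoly G).eval (2 ^ (n + 1)) := by
  classical
  rw [indepSetPoly_eq, eval_finsetSum, Palette.homSum]
  refine Finset.sum_bij' (fun f _ => Finset.univ.filter fun v => f v = 1)
    (fun S _ v => if v ∈ S then 1 else 0) (fun f hf => ?_) (fun S hS => ?_) (fun f hf => ?_)
    (fun S hS => ?_) (fun f hf => ?_)
  · simp only [Finset.mem_filter, Finset.mem_univ, true_and] at hf ⊢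
    intro u hu v hv _ huv
    have := hf u v huv
    simp only [Finset.coe_filter, Finset.mem_univ, true_and, Set.mem_ofPred_eq] at hu hv
    simp [indepPalette, hu, hv] at this
  · simp only [Finset.mem_filter, Finset.mem_univ, true_and] at hS ⊢
    intro u v huv
    by_cases hu : u ∈ S <;> by_cases hv : v ∈ S <;> simp [indepPalette, hu, hv]
    exact hS hu hv huv.ne huv
  · funext v
    have h : ∀ a : Fin 2, (if a = 1 then (1 : Fin 2) else 0) = a := by decide
    simp [h]
  · ext v
    simp
  · simp [indepPalette]

theorem coeff_indepSetPoly_le (k : ℕ) : (indepSetPoly G).coeff k ≤ 2 ^ n := by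
  classical
  rw [indepSetPoly_eq, finsetSum_coeff]
  calc _ ≤ ∑ S ∈ Finset.univ.filter fun S : Finset (Fin n) => G.IsIndepSet (S : Set (Fin n)), 1 :=
        Finset.sum_le_sum fun S _ => by rw [coeff_X_pow]; split_ifs <;> omega
    _ ≤ _ := by
        rw [← Finset.card_eq_sum_ones]
        exact (Finset.card_le_univ _).trans (by simp)

theorem natDegree_indepSetPoly_le : (indepSetPoly G).natDegree ≤ n := by
  classical
  rw [indepSetPoly_eq]
  refine natDegree_sum_le_of_forall_le _ _ fun S _ => (natDegree_X_pow_le _).trans ?_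
  simpa using Finset.card_le_univ S

theorem indepSetPoly_ne_zero : indepSetPoly G ≠ 0 := by
  classical
  intro h
  have h₁ : (indepSetPoly G).eval 1 = 0 := by rw [h, eval_zero]
  rw [indepSetPoly_eq, eval_finsetSum] at h₁
  simp only [eval_pow, eval_X, one_pow, Finset.sum_eq_zero_iff, one_ne_zero] at h₁
  exact h₁ ∅ (by simp [SimpleGraph.IsIndepSet])

end

theorem eval_eq_coeff_zero_add (p : ℕ[X]) (B : ℕ) :
    p.eval B = p.coeff 0 + p.divX.eval B * B := by
  conv_lhs => rw [← p.divX_mul_X_add]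
  rw [eval_add, eval_mul, eval_X, eval_C, Nat.add_comm]

/-- The value of a polynomial with small coefficients at `B` determines the coefficients, which are
its digits in base `B`. -/
theorem eval_div_mod {p : ℕ[X]} {B : ℕ} (hp : ∀ k, p.coeff k < B) (k : ℕ) :
    p.eval B / B ^ k % B = p.coeff k := by
  have hB : 0 < B := (Nat.zero_le _).trans_lt (hp 0)
  induction k generalizing p with
  | zero =>
    rw [pow_zero, Nat.div_one, eval_eq_coeff_zero_add, Nat.add_mul_mod_self_right,
      Nat.mod_eq_of_lt (hp 0)]
  | succ k ih =>
    rw [pow_succ', ← Nat.div_div_eq_div_mul, eval_eq_coeff_zero_add, Nat.add_mul_div_right _ _ hB,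
      Nat.div_eq_of_lt (hp 0), Nat.zero_add, ih fun k => by rw [coeff_divX]; exact hp _, coeff_divX]

theorem eval_lt {p : ℕ[X]} {B : ℕ} (hp : ∀ k, p.coeff k < B) :
    p.eval B < B ^ (p.natDegree + 1) := by
  have hB : 0 < B := (Nat.zero_le _).trans_lt (hp 0)
  have key : ∀ m, ∑ i ∈ Finset.range m, p.coeff i * B ^ i < B ^ m := by
    intro m
    induction m with
    | zero => simp
    | succ m ih =>
      rw [Finset.sum_range_succ, pow_succ']
      have := Nat.mul_le_mul_right (B ^ m) (hp m)
      rw [Nat.succ_mul] at this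
      omega
  rw [eval_eq_sum_range]
  exact key _

theorem le_eval {p : ℕ[X]} (hp : p ≠ 0) (B : ℕ) : B ^ p.natDegree ≤ p.eval B := by
  rw [eval_eq_sum_range]
  refine le_trans ?_ (Finset.single_le_sum (f := fun i => p.coeff i * B ^ i)
    (fun i _ => Nat.zero_le _) (Finset.self_mem_range_succ p.natDegree))
  exact Nat.le_mul_of_pos_left _ (Nat.pos_of_ne_zero (leadingCoeff_ne_zero.2 hp))

/-- The output symbols for polynomials. -/
def symbSep (s : Symb) : Option Bool := if s = 2 then none else some (decide (s = 1))

theorem encodePoly_eq {p : ℕ[X]} {n : ℕ} (hp : ∀ k, p.coeff k < 2 ^ (n + 1)) (hn : p.natDegree ≤ n)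
    (h₀ : p ≠ 0) : encodePoly p = (digitsOutput n (p.eval (2 ^ (n + 1)))).map symbSep := by
  have hcard : (Finset.univ.filter fun k : Fin (n + 1) =>
      (n + 1) * k.val < (p.eval (2 ^ (n + 1))).size).card = p.natDegree + 1 := by
    have h₁ : ∀ k : ℕ, (n + 1) * k < (p.eval (2 ^ (n + 1))).size ↔ k < p.natDegree + 1 := by
      intro k
      rw [Nat.lt_size, pow_mul]
      constructor
      · intro h
        by_contra! hk
        exact absurd ((h.trans_lt (eval_lt hp)).trans_le
          (Nat.pow_le_pow_right (by positivity) hk)) (lt_irrefl _)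
      · intro h
        exact (Nat.pow_le_pow_right (by positivity) (by omega)).trans (le_eval h₀ _)
    simp only [h₁]
    rw [Fin.card_filter_val_lt]
    omega
  rw [digitsOutput, hcard, encodePoly, List.map_flatMap]
  refine List.flatMap_congr fun k _ => ?_
  rw [pow_mul, eval_div_mod hp, encodeNat_eq_bits, List.map_append, List.map_map]
  congr 1
  refine List.map_congr_left fun b _ => ?_
  cases b <;> rfl

/-- Computing the independent set polynomial. -/
theorem exists_solvable_indepSetPoly :
    ∃ C : ℝ, ∀ t : ℕ, ∃ T : ℕ → ℕ, SqrtExpBound C t T ∧ Subexponential T ∧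
      SolvableOnPathFree (fun _ G => indepSetPoly G) encodePoly t T := by
  refine Palette.exists_solvable indepPalette_isSymm indepPalette_isQuadFree symbSep
    digitsOutput poly_output_digits fun n G => ?_
  rw [homSum_indepPalette]
  refine encodePoly_eq (fun k => (coeff_indepSetPoly_le G k).trans_lt ?_)
    (natDegree_indepSetPoly_le G) (indepSetPoly_ne_zero G)
  exact Nat.pow_lt_pow_right (by omega) (by omega)

end PathFreeColouring

end

open PathFreeColouring in
open Classical in
theorem corollary1 :
    (∀ (W : Type*) [Finite W] (H : SimpleGraph W), (SimpleGraph.cycleGraph 4).Free H →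
      ∃ C : ℝ, ∀ t : ℕ, ∃ T : ℕ → ℕ, SqrtExpBound C t T ∧
        SolvableOnPathFree (fun _ G => Nat.card (G →g H)) Computability.encodeNat t T) ∧
    (∃ C : ℝ, ∀ t : ℕ, ∃ T : ℕ → ℕ, SqrtExpBound C t T ∧
      SolvableOnPathFree (fun _ G => indepSetPoly G) encodePoly t T) ∧
    (∃ C : ℝ, ∀ t : ℕ, ∃ T : ℕ → ℕ, SqrtExpBound C t T ∧ Subexponential T ∧
      SolvableOnPathFree (fun _ G => decide (G.Colorable 3)) Computability.encodeBool t T) ∧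
    (∃ C : ℝ, ∀ t : ℕ, ∃ T : ℕ → ℕ, SqrtExpBound C t T ∧ Subexponential T ∧
      SolvableOnPathFree (fun _ G => Nat.card (G.Coloring (Fin 3)))
        Computability.encodeNat t T) := by
  refine ⟨fun W _ H hH => ?_, ?_, exists_solvable_colorable,
    exists_solvable_hom (⊤ : SimpleGraph (Fin 3)) cycleGraph_four_free_top⟩
  · obtain ⟨C, hC⟩ := exists_solvable_hom H hH
    exact ⟨C, fun t => (hC t).imp fun T hT => ⟨hT.1, hT.2.2⟩⟩
  · obtain ⟨C, hC⟩ := exists_solvable_indepSetPoly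
    exact ⟨C, fun t => (hC t).imp fun T hT => ⟨hT.1, hT.2.2⟩⟩
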